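/- **Log gases – bulk fluctuations.** Let $n\in\{1,2\}$, $\mathrm g(x,u)=\log|x-u|^{-1}$ (with $\mathrm g(x,x)=+\infty$) and $\vartheta(x)=\log(1+|x|)$ for $x,u\in\mathbb R^n$. Let $V:\mathbb R^n\to(-\infty,+\infty]$ be such that the set $\mathscr S_V=\{V<+\infty\}$ is open, $V$ is continuous on $\mathscr S_V$, and for all $\kappa\ge 0$ $$\inf_{x\in\mathscr S_V}\{V(x)-\kappa\,\vartheta(x)\}>-\infty\qquad\text{and}\qquad\int_{\mathbb R^n}|x|^{\kappa}e^{-V(x)}\,dx<+\infty .$$ For $\beta>0$ and $N\in\mathbb N$ let $\mathbb P_N$ be the Gibbs measure on $(\mathbb R^n)^N$, $$\mathbb P_N(d\mathbf x)=\frac{1}{Z_N}\exp\Big(-\beta\sum_{1\le i<j\le N}\mathrm g(x_i,x_j)-\sum_{j=1}^N V(x_j)\Big)\,dx_1\cdots dx_N ,$$ where $Z_N$ is the normalizing constant (which is positive and finite). Let $E\in\mathscr S_V$ and $\gamma\ge 0$. Let $\nu_\gamma$ be the probability measure proportional to $e^{-V(x)+\gamma\vartheta(x)}dx$ and, for a probability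 measure $\mu$ on $\mathbb R^n$, let $$\mathscr F_\gamma(\mu)=\frac{\gamma}{2}\iint\big(\mathrm g(x,z)+\vartheta(x)+\vartheta(z)\big)\,\mu(dz)\,\mu(dx)+\mathrm H(\mu\,|\,\nu_\gamma)\in[0,+\infty],$$ where $\mathrm H$ is the relative entropy and the first term is $0$ if $\gamma=0$. Then $\mathscr F_\gamma$ has a unique minimizer $\mu_\gamma$ among the probability measures on $\mathbb R^n$; it has a Lebesgue density that is continuous on $\mathscr S_V$, again denoted $\mu_\gamma$, and $\mu_\gamma(E)>0$. For every sequence $\beta=\beta_N>0$ with $N\beta_N\to\gamma$ as $N\to+\infty$, the point process $$\Xi_N=\sum_{j=1}^N\delta_{N^{1/n}(x_j-E)},\qquad (x_1,\dots,x_N)\sim\mathbb P_N ,$$ converges in distribution, as $N\to+\infty$, to a homogeneous Poisson point process $\Xi$ on $\mathbb R^n$ with intensity $\mu_\gamma(E)$. Here a Poisson point process with intensity measure $\theta$ is a simple point process $\Xi$ with $\mathbb E[e^{-\Xi(f)}]=\exp\big(\int(e^{-f}-1)\,d\theta\big)$ for all Borel $f:\mathbb R^n\to[0,+\infty)$, and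 convergence in distribution means $\mathbb E[e^{-\Xi_N(f)}]\to\mathbb E[e^{-\Xi(f)}]$ for all continuous $f:\mathbb R^n\to[0,+\infty)$ with compact support. -/

import Mathlib

open MeasureTheory Filter Topology
open scoped ENNReal NNReal

noncomputable section

namespace PointProcess

variable {X : Type*} [MeasurableSpace X]

/-- A (simple) point process on `X`: a random measure which is almost surely the sum of the
Dirac masses at the points of a subset of `X` with finitely many points in every compact set. -/
def IsPointProcess [TopologicalSpace X] {Ω : Type*} [MeasurableSpace Ω] (P : Measure Ω)
    (Ξ : Ω → Measure X) : Prop :=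
  Measurable Ξ ∧ ∀ᵐ ω ∂P, ∃ Λ : Set X, Λ.Countable ∧ (∀ K, IsCompact K → (Λ ∩ K).Finite) ∧
    Ξ ω = Measure.sum fun p : Λ => Measure.dirac (p : X)

/-- The Laplace functional `ψ(f) = 𝔼[exp(-Ξ(f))]` of a random measure, for `f ≥ 0`. The integral
`Ξ(f)` may be `+∞`, and then `exp(-Ξ(f)) = 0`. -/
def laplaceFunctional {Ω : Type*} [MeasurableSpace Ω] (P : Measure Ω) (Ξ : Ω → Measure X)
    (f : X → ℝ≥0) : ℝ≥0∞ :=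
  ∫⁻ ω, EReal.exp (-((∫⁻ x, (f x : ℝ≥0∞) ∂(Ξ ω) : ℝ≥0∞) : EReal)) ∂P

/-- `Ξ` is a Poisson point process with intensity measure `θ`: a point process such that
`ψ(f) = exp(∫ (e^{-f} - 1) dθ) = exp(-∫ (1 - e^{-f}) dθ)` for all Borel `f ≥ 0`. -/
def IsPoisson [TopologicalSpace X] {Ω : Type*} [MeasurableSpace Ω] (P : Measure Ω) (Ξ : Ω → Measure X)
    (θ : Measure X) : Prop :=
  IsProbabilityMeasure P ∧ IsPointProcess P Ξ ∧
    ∀ f : X → ℝ≥0, Measurable f →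
      laplaceFunctional P Ξ f =
        EReal.exp (-((∫⁻ x, ENNReal.ofReal (1 - Real.exp (-(f x : ℝ))) ∂θ : ℝ≥0∞) : EReal))

/-- Convergence in distribution of random measures: convergence of the Laplace functionals at all
nonnegative continuous functions with compact support. -/
def TendstoInDistribution [TopologicalSpace X] {Ω : ℕ → Type*} [∀ N, MeasurableSpace (Ω N)]
    (P : ∀ N, Measure (Ω N)) (Ξ : ∀ N, Ω N → Measure X)
    {Ω' : Type*} [MeasurableSpace Ω'] (P' : Measure Ω') (Ξ' : Ω' → Measure X) : Prop :=
  ∀ f : X → ℝ≥0, Continuous f → HasCompactSupport f →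
    Tendsto (fun N => laplaceFunctional (P N) (Ξ N) f) atTop (𝓝 (laplaceFunctional P' Ξ' f))

end PointProcess

namespace LogGas

variable {n : ℕ}

/-- The kernel `g(x,u) = log |x - u|⁻¹`, equal to `+∞` on the diagonal. -/
def kernel (x u : EuclideanSpace ℝ (Fin n)) : EReal := ENNReal.log (‖x - u‖ₑ)⁻¹

/-- `ϑ(x) = log (1 + |x|)`. -/
def theta (x : EuclideanSpace ℝ (Fin n)) : ℝ := Real.log (1 + ‖x‖)

/-- The energy `β ∑_{i<j} g(x_i, x_j) + ∑_j V(x_j)` of a configuration of `N` particles. -/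
def energy (V : EuclideanSpace ℝ (Fin n) → EReal) (β : ℝ) (N : ℕ)
    (x : Fin N → EuclideanSpace ℝ (Fin n)) : EReal :=
  (β : EReal) * (∑ i, ∑ j ∈ Finset.Ioi i, kernel (x i) (x j)) + ∑ j, V (x j)

/-- The partition function. -/
def partitionFunction (V : EuclideanSpace ℝ (Fin n) → EReal) (β : ℝ) (N : ℕ) : ℝ≥0∞ :=
  ∫⁻ x : Fin N → EuclideanSpace ℝ (Fin n), EReal.exp (-(energy V β N x))

/-- The Gibbs measure `Z⁻¹ e^{-H(x)} dx_1 ⋯ dx_N`. -/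
def gibbs (V : EuclideanSpace ℝ (Fin n) → EReal) (β : ℝ) (N : ℕ) :
    Measure (Fin N → EuclideanSpace ℝ (Fin n)) :=
  (partitionFunction V β N)⁻¹ • volume.withDensity fun x => EReal.exp (-(energy V β N x))

/-- The local process `∑_j δ_{N^{1/n} (x_j - E)}` of a configuration. -/
def localProcess (E : EuclideanSpace ℝ (Fin n)) (N : ℕ)
    (x : Fin N → EuclideanSpace ℝ (Fin n)) : Measure (EuclideanSpace ℝ (Fin n)) :=
  ∑ j, Measure.dirac (((N : ℝ) ^ (1 / (n : ℝ))) • (x j - E))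

/-- The density `e^{-(V - γ ϑ)}`. -/
def refDensity (V : EuclideanSpace ℝ (Fin n) → EReal) (γ : ℝ) (x : EuclideanSpace ℝ (Fin n)) :
    ℝ≥0∞ :=
  EReal.exp (-(V x - ((γ * theta x : ℝ) : EReal)))

/-- The reference measure `ν_γ`, proportional to `e^{-(V - γ ϑ)} dx`. -/
def refMeasure (V : EuclideanSpace ℝ (Fin n) → EReal) (γ : ℝ) :
    Measure (EuclideanSpace ℝ (Fin n)) :=
  (∫⁻ x, refDensity V γ x)⁻¹ • volume.withDensity (refDensity V γ)

/-- The weighted energy `∬ (g(x,z) + ϑ(x) + ϑ(z)) μ(dz) μ(dx)`. The integrand is nonnegative,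
since `|x - z| ≤ (1 + |x|) (1 + |z|)`, so that it is not changed by `EReal.toENNReal`. -/
def weightedEnergy (μ : Measure (EuclideanSpace ℝ (Fin n))) : ℝ≥0∞ :=
  ∫⁻ x, ∫⁻ z, (kernel x z + ((theta x + theta z : ℝ) : EReal)).toENNReal ∂μ ∂μ

/-- The free energy `(γ/2) ∬ (g(x,z) + ϑ(x) + ϑ(z)) μ(dz) μ(dx) + H(μ | ν_γ)` of a probability
measure `μ`, where `H` is the relative entropy. -/
def freeEnergy (V : EuclideanSpace ℝ (Fin n) → EReal) (γ : ℝ)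
    (μ : Measure (EuclideanSpace ℝ (Fin n))) : ℝ≥0∞ :=
  ENNReal.ofReal (γ / 2) * weightedEnergy μ + InformationTheory.klDiv μ (refMeasure V γ)

/-- `μ` is the unique minimizer of the free energy among probability measures. -/
def IsEquilibriumMeasure (V : EuclideanSpace ℝ (Fin n) → EReal) (γ : ℝ)
    (μ : Measure (EuclideanSpace ℝ (Fin n))) : Prop :=
  IsProbabilityMeasure μ ∧
    ∀ ν : Measure (EuclideanSpace ℝ (Fin n)), IsProbabilityMeasure ν → ν ≠ μ →
      freeEnergy V γ μ < freeEnergy V γ ν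

end LogGas

end

/-! The mechanism is mean-field. Adding a particle at `u` to a gas of `M` particles multiplies the
weight by the insertion factor `∏_j |x_j - u|^β`. Since `Mβ → γ`, this factor concentrates around
`e^{γU(u)}`, where `U(u) = ∫ log|x-u| μ(dx)` and `μ` is the equilibrium measure. So an added
particle has limiting density proportional to `e^{-V+γU}`, which is the equilibrium density, and it
ignores the microscopic configuration around it. On the scale `N^{-1/n}` this leaves a homogeneous
Poisson process.

Equilibrium. The kernel `g + ϑ + ϑ` is conditionally positive definite
(`two_mul_mutualEnergy_regKernel_le`): up to terms in one variable and a constant, it is a limit of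
mixtures of Gaussian kernels. Together with a quantitative midpoint convexity of the entropy
(`klFun_midpoint_le`), this makes minimizing sequences Cauchy in Hellinger distance, whence
`exists_minimizer`. The first variation shows that the minimizer is a Gibbs density in its own
potential (`exists_isGibbsDensity`), and positive definiteness makes any such density the strict
minimizer (`IsGibbsDensity.densFreeEnergy_lt`). The resulting equation `IsSelfConsistent`, with a
continuous potential, yields the continuity and positivity of the density.

Concentration. Relative to `μ^{⊗M}` the Gibbs density is `tilt` up to a constant. Positive
definiteness, applied to the empirical measure and `μ`, bounds `tilt` from above; Jensen's
inequality bounds its integral from below; the two exponents agree up to `εM` and a small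
logarithmic weight (`IsTame.eventually_tilt_le`). A loss `e^{εM}` is harmless here, because the
insertion factor carries the exponent `β ~ γ/M`: its moments are expectations of powers of order
`1/M` of `∏_j |x_j - u|^s` with `s` fixed. This gives asymptotic upper bounds `a²` and `a⁻¹`, with
`a = e^{γU(u)}`, for the moments of order `2` and `-1`, and the elementary inequality
`sq_sub_add_le` converts these two one-sided bounds into convergence in `L²`.

Poisson limit. For `H` the rescaled `1 - e^{-f}` put `L(t) = 𝔼 ∏_j (1 - t H(x_j))`. Differentiating
and splitting off one particle (`IsSelfConsistent.lintegral_gasMeasure_succ`) gives `L' ≈ -l L`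
uniformly on `[0,1]`, with `l = ρ(E) ∫ (1 - e^{-f})`. By `abs_sub_exp_neg_le` the Laplace functional
`L(1)` tends to `e^{-l}`, that of the Poisson process built in `exists_isPoisson`. -/

set_option linter.unusedSectionVars false

noncomputable section

namespace LogGas

/-! ### Positive definite kernels with values in `[0, ∞]` -/

section PositiveDefinite

variable {X : Type*} [MeasurableSpace X]

/-- The mutual energy `∬ k(x,z) α(dx) β(dz)` of two measures. -/
def mutualEnergy (k : X → X → ℝ≥0∞) (α β : Measure X) : ℝ≥0∞ := ∫⁻ x, ∫⁻ z, k x z ∂β ∂α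

/-- A kernel is positive definite if `2 ∬ k dα dβ ≤ ∬ k dα dα + ∬ k dβ dβ` for all finite measures. -/
def IsPosDefKernel (k : X → X → ℝ≥0∞) : Prop :=
  Measurable (Function.uncurry k) ∧ ∀ α β : Measure X, IsFiniteMeasure α → IsFiniteMeasure β →
    2 * mutualEnergy k α β ≤ mutualEnergy k α α + mutualEnergy k β β

lemma ENNReal_two_mul_le_add_sq (a b : ℝ≥0∞) : 2 * (a * b) ≤ a * a + b * b := by
  by_cases ha : a = ⊤
  · simp [ha]
  by_cases hb : b = ⊤
  · simp [hb]
  lift a to ℝ≥0 using ha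
  lift b to ℝ≥0 using hb
  norm_cast
  rw [← NNReal.coe_le_coe]
  push_cast
  nlinarith [sq_nonneg ((a : ℝ) - b)]

/-- Tonelli factors the double integral at each `w`, so that positive definiteness reduces to `2ab ≤
a² + b²` under the integral over `w`. -/
lemma mutualEnergy_lintegral_mul {Y : Type*} [MeasurableSpace Y] (τ : Measure Y) [SFinite τ]
    (φ : X → Y → ℝ≥0∞) (hφ : Measurable (Function.uncurry φ)) (α β : Measure X)
    [SFinite α] [SFinite β] :
    mutualEnergy (fun x z => ∫⁻ w, φ x w * φ z w ∂τ) α β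
      = ∫⁻ w, (∫⁻ x, φ x w ∂α) * (∫⁻ z, φ z w ∂β) ∂τ := by
  have h1 : ∀ x, Measurable (φ x) := fun x => hφ.comp (measurable_const.prodMk measurable_id)
  have h2 : ∀ w, Measurable (fun x => φ x w) := fun w => hφ.comp (measurable_id.prodMk measurable_const)
  unfold mutualEnergy
  have e1 : ∀ x, ∫⁻ z, ∫⁻ w, φ x w * φ z w ∂τ ∂β = ∫⁻ w, φ x w * ∫⁻ z, φ z w ∂β ∂τ := by
    intro x
    rw [lintegral_lintegral_swap]
    · refine lintegral_congr fun w => ?_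
      rw [lintegral_const_mul _ (h2 w)]
    · refine Measurable.aemeasurable ?_
      exact ((h1 x).comp measurable_snd).mul hφ
  simp_rw [e1]
  have m2 : Measurable (fun w => ∫⁻ z, φ z w ∂β) :=
    Measurable.lintegral_prod_left' (f := Function.uncurry φ) hφ
  rw [lintegral_lintegral_swap]
  · refine lintegral_congr fun w => ?_
    rw [lintegral_mul_const _ (h2 w)]
  · exact (hφ.mul (m2.comp measurable_snd)).aemeasurable

/-- Kernels of the form `∫ φ(x,w) φ(z,w) τ(dw)` are positive definite. -/
lemma isPosDefKernel_lintegral_mul {Y : Type*} [MeasurableSpace Y] (τ : Measure Y) [SFinite τ]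
    (φ : X → Y → ℝ≥0∞) (hφ : Measurable (Function.uncurry φ)) :
    IsPosDefKernel (fun x z => ∫⁻ w, φ x w * φ z w ∂τ) := by
  refine ⟨?_, fun α β _ _ => ?_⟩
  · refine Measurable.lintegral_prod_right' (f := fun p : (X × X) × Y => φ p.1.1 p.2 * φ p.1.2 p.2) ?_
    exact (hφ.comp (measurable_fst.fst.prodMk measurable_snd)).mul
      (hφ.comp (measurable_fst.snd.prodMk measurable_snd))
  · have m : ∀ β : Measure X, IsFiniteMeasure β → Measurable (fun w => ∫⁻ z, φ z w ∂β) :=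
      fun β _ => Measurable.lintegral_prod_left' (f := Function.uncurry φ) hφ
    rw [mutualEnergy_lintegral_mul τ φ hφ, mutualEnergy_lintegral_mul τ φ hφ,
      mutualEnergy_lintegral_mul τ φ hφ]
    have mm : ∀ α β : Measure X, IsFiniteMeasure α → IsFiniteMeasure β →
        Measurable (fun w => (∫⁻ x, φ x w ∂α) * ∫⁻ z, φ z w ∂β) :=
      fun α β h h' => (m α h).mul (m β h')
    rw [← lintegral_const_mul _ (mm α β ‹_› ‹_›), ← lintegral_add_left (mm α α ‹_› ‹_›)]
    exact lintegral_mono fun w => ENNReal_two_mul_le_add_sq _ _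

/-- Mixtures of positive definite kernels are positive definite. -/
lemma isPosDefKernel_lintegral {Y : Type*} [MeasurableSpace Y] (τ : Measure Y) [SFinite τ]
    (k : Y → X → X → ℝ≥0∞) (hk : Measurable (fun p : (X × X) × Y => k p.2 p.1.1 p.1.2))
    (h : ∀ᵐ t ∂τ, IsPosDefKernel (k t)) :
    IsPosDefKernel (fun x z => ∫⁻ t, k t x z ∂τ) := by
  refine ⟨Measurable.lintegral_prod_right' hk, fun α β _ _ => ?_⟩
  have key : ∀ α β : Measure X, IsFiniteMeasure α → IsFiniteMeasure β →
      Measurable (fun t => mutualEnergy (k t) α β) ∧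
      mutualEnergy (fun x z => ∫⁻ t, k t x z ∂τ) α β = ∫⁻ t, mutualEnergy (k t) α β ∂τ := by
    intro α β _ _
    have m1 : Measurable (fun p : X × Y => ∫⁻ z, k p.2 p.1 z ∂β) := by
      refine Measurable.lintegral_prod_right' (f := fun p : (X × Y) × X => k p.1.2 p.1.1 p.2) ?_
      exact hk.comp ((measurable_fst.fst.prodMk measurable_snd).prodMk measurable_fst.snd)
    constructor
    · exact Measurable.lintegral_prod_left' (f := fun p : X × Y => ∫⁻ z, k p.2 p.1 z ∂β) m1
    · unfold mutualEnergy
      rw [← lintegral_lintegral_swap (f := fun x t => ∫⁻ z, k t x z ∂β) m1.aemeasurable]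
      refine lintegral_congr fun x => ?_
      rw [lintegral_lintegral_swap]
      exact (hk.comp ((measurable_const.prodMk measurable_fst).prodMk measurable_snd)).aemeasurable
  rw [(key α β ‹_› ‹_›).2, (key α α ‹_› ‹_›).2, (key β β ‹_› ‹_›).2,
    ← lintegral_const_mul _ (key α β ‹_› ‹_›).1, ← lintegral_add_left (key α α ‹_› ‹_›).1]
  refine lintegral_mono_ae ?_
  filter_upwards [h] with t ht using ht.2 α β ‹_› ‹_›

end PositiveDefinite

/-! ### Gaussian kernels and their mixtures -/

section Gaussian

variable {X : Type*} [NormedAddCommGroup X] [InnerProductSpace ℝ X] [FiniteDimensional ℝ X]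
  [MeasurableSpace X] [BorelSpace X]

lemma lintegral_gaussian {b : ℝ} (hb : 0 < b) :
    ∫⁻ v : X, ENNReal.ofReal (Real.exp (-b * ‖v‖ ^ 2))
      = ENNReal.ofReal ((Real.pi / b) ^ (Module.finrank ℝ X / 2 : ℝ)) := by
  have h := GaussianFourier.integral_rexp_neg_mul_sq_norm (V := X) hb
  have hpos : 0 < (Real.pi / b) ^ (Module.finrank ℝ X / 2 : ℝ) := by positivity
  rw [← h, ofReal_integral_eq_lintegral_ofReal]
  -- A non-integrable function has Bochner integral `0`, whereas this integral is known to be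
  -- positive.
  · by_contra hc
    rw [integral_undef hc] at h
    exact hpos.ne h
  · exact ae_of_all _ fun _ => (Real.exp_pos _).le

/-- Parallelogram law for `x - w` and `z - w`: the two squares are exchanged for `x - z` and the
distance from `w` to the midpoint, and only the latter depends on `w`. -/
lemma gaussian_convolution {t : ℝ} (x z w : X) :
    Real.exp (-(2 * t) * ‖x - w‖ ^ 2) * Real.exp (-(2 * t) * ‖z - w‖ ^ 2)
      = Real.exp (-t * ‖x - z‖ ^ 2) * Real.exp (-(4 * t) * ‖w - (1 / 2 : ℝ) • (x + z)‖ ^ 2) := by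
  rw [← Real.exp_add, ← Real.exp_add]
  congr 1
  have h1 := parallelogram_law_with_norm ℝ (x - w) (z - w)
  have h2 : x - w + (z - w) = (-2 : ℝ) • (w - (1 / 2 : ℝ) • (x + z)) := by
    module
  have h3 : x - w - (z - w) = x - z := by abel
  rw [h2, h3, norm_smul] at h1
  rw [show ‖(-2 : ℝ)‖ = 2 by norm_num] at h1
  linear_combination t * h1

/-- A Gaussian is a convolution of narrower ones, hence of the form `∫ φ(x,w) φ(z,w) τ(dw)`; the
constant `c` is the mass of the Gaussian of rate `4t` left over in `w`. -/
lemma isPosDefKernel_gaussian {t : ℝ} (ht : 0 < t) :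
    IsPosDefKernel (fun x z : X => ENNReal.ofReal (Real.exp (-t * ‖x - z‖ ^ 2))) := by
  set c : ℝ := (Real.pi / (4 * t)) ^ (Module.finrank ℝ X / 2 : ℝ) with hc
  have hcpos : 0 < c := by positivity
  have := isPosDefKernel_lintegral_mul (X := X) ((ENNReal.ofReal c)⁻¹ • (volume : Measure X))
    (fun x w => ENNReal.ofReal (Real.exp (-(2 * t) * ‖x - w‖ ^ 2)))
    (by unfold Function.uncurry; fun_prop)
  convert this using 3 with x z
  rw [lintegral_smul_measure]
  simp_rw [← ENNReal.ofReal_mul (Real.exp_pos _).le, gaussian_convolution]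
  simp_rw [ENNReal.ofReal_mul (Real.exp_pos _).le]
  rw [lintegral_const_mul _ (by fun_prop),
    lintegral_sub_right_eq_self (μ := (volume : Measure X))
      (fun w => ENNReal.ofReal (Real.exp (-(4 * t) * ‖w‖ ^ 2))),
    lintegral_gaussian (by positivity), ← hc, smul_eq_mul, mul_comm _ (ENNReal.ofReal c), ← mul_assoc,
    ENNReal.inv_mul_cancel (by simpa using hcpos) ENNReal.ofReal_ne_top, one_mul]

lemma lintegral_exp_neg_mul_Ioi {a : ℝ} (ha : 0 < a) :
    ∫⁻ t in Set.Ioi (0 : ℝ), ENNReal.ofReal (Real.exp (-a * t)) = ENNReal.ofReal (1 / a) := by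
  rw [← ofReal_integral_eq_lintegral_ofReal]
  · rw [integral_exp_mul_Ioi (by linarith) 0]
    simp
  · exact integrableOn_exp_mul_Ioi (by linarith) 0
  · exact ae_of_all _ fun _ => (Real.exp_pos _).le

lemma lintegral_one_div_add_Ioc {r η R : ℝ} (h : 0 < r + η) (hR : η ≤ R) :
    ∫⁻ s in Set.Ioc η R, ENNReal.ofReal (1 / (r + s))
      = ENNReal.ofReal (Real.log (r + R) - Real.log (r + η)) := by
  rw [← ofReal_integral_eq_lintegral_ofReal]
  · rw [← intervalIntegral.integral_of_le hR]
    rw [intervalIntegral.integral_comp_add_left (fun s => 1 / s) r, integral_one_div_of_pos h (by linarith),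
      Real.log_div (by linarith) (by linarith)]
  · have : IntervalIntegrable (fun s => 1 / (r + s)) volume η R := by
      refine ContinuousOn.intervalIntegrable fun s hs => ContinuousAt.continuousWithinAt ?_
      rw [Set.uIcc_of_le hR] at hs
      have : r + s ≠ 0 := by linarith [hs.1]
      fun_prop (disch := assumption)
    exact (intervalIntegrable_iff_integrableOn_Ioc_of_le hR).1 this
  · refine (ae_restrict_mem measurableSet_Ioc).mono fun s hs => ?_
    have : 0 < r + s := by linarith [hs.1]
    simp only [Pi.zero_apply]; positivity

/-- The kernel `∫_η^R ds / (|x-z|² + s)`. -/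
def truncKernel (η R : ℝ) (x z : X) : ℝ≥0∞ :=
  ∫⁻ s in Set.Ioc η R, ENNReal.ofReal (1 / (‖x - z‖ ^ 2 + s))

/-- Since `1/(|x-z|² + s) = ∫₀^∞ e^{-st} e^{-t|x-z|²} dt`, the kernel is a double mixture of
Gaussians, over `t` and then over `s`. -/
lemma isPosDefKernel_truncKernel {η R : ℝ} (hη : 0 ≤ η) :
    IsPosDefKernel (truncKernel η R : X → X → ℝ≥0∞) := by
  refine isPosDefKernel_lintegral _ (fun s x z => ENNReal.ofReal (1 / (‖x - z‖ ^ 2 + s)))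
    (by fun_prop) ?_
  refine (ae_restrict_mem measurableSet_Ioc).mono fun s hs => ?_
  have hs0 : 0 < s := lt_of_le_of_lt hη hs.1
  have key := isPosDefKernel_lintegral (X := X)
    ((volume.restrict (Set.Ioi (0:ℝ))).withDensity (fun t => ENNReal.ofReal (Real.exp (-s * t))))
    (fun t x z => ENNReal.ofReal (Real.exp (-t * ‖x - z‖ ^ 2))) (by fun_prop) ?_
  · convert key using 3 with x z
    rw [lintegral_withDensity_eq_lintegral_mul _ (by fun_prop) (by fun_prop),
      ← lintegral_exp_neg_mul_Ioi (by positivity)]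
    refine lintegral_congr fun t => ?_
    rw [Pi.mul_apply, ← ENNReal.ofReal_mul (Real.exp_pos _).le, ← Real.exp_add]
    ring_nf
  · refine (withDensity_absolutelyContinuous _ _).ae_le ?_
    exact (ae_restrict_mem measurableSet_Ioi).mono fun t ht => isPosDefKernel_gaussian ht

end Gaussian

end LogGas

end

/-! ### Conditional positive definiteness of the logarithmic kernel -/

noncomputable section

namespace LogGas

lemma mutualEnergy_eq_lintegral_prod {X : Type*} [MeasurableSpace X] {k : X → X → ℝ≥0∞}
    (hk : Measurable (Function.uncurry k)) (α β : Measure X) [SFinite α] [SFinite β] :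
    mutualEnergy k α β = ∫⁻ p, k p.1 p.2 ∂(α.prod β) :=
  (lintegral_prod (fun p => k p.1 p.2) hk.aemeasurable).symm

section LogKernel

variable {X : Type*} [NormedAddCommGroup X]

/-- `log (1 + |x|)`. -/
def logWeight (x : X) : ℝ := Real.log (1 + ‖x‖)

/-- The regularized weighted kernel `log (1 + |x|) + log (1 + |z|) - log (|x - z|² + η) / 2`. -/
def regKernel (η : ℝ) (x z : X) : ℝ :=
  logWeight x + logWeight z - Real.log (‖x - z‖ ^ 2 + η) / 2

lemma logWeight_nonneg (x : X) : 0 ≤ logWeight x :=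
  Real.log_nonneg (by linarith [norm_nonneg x])

lemma logWeight_le_norm (x : X) : logWeight x ≤ ‖x‖ := by
  have := Real.log_le_sub_one_of_pos (show 0 < 1 + ‖x‖ by positivity)
  unfold logWeight; linarith

lemma norm_sub_sq_add_one_le (x z : X) : ‖x - z‖ ^ 2 + 1 ≤ ((1 + ‖x‖) * (1 + ‖z‖)) ^ 2 := by
  have h1 := norm_sub_le x z
  have h2 := norm_nonneg x
  have h3 := norm_nonneg z
  have h4 : ‖x - z‖ ^ 2 ≤ (‖x‖ + ‖z‖) ^ 2 := by gcongr
  have h5 : (1 + ‖x‖ + ‖z‖) ^ 2 ≤ ((1 + ‖x‖) * (1 + ‖z‖)) ^ 2 := by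
    gcongr; nlinarith [mul_nonneg h2 h3]
  nlinarith

/-- The source of nonnegativity of the weighted kernels with `η ≤ 1`, and the majorant in the limit
`R → ∞` below. -/
lemma log_norm_sq_add_one_le (x z : X) :
    Real.log (‖x - z‖ ^ 2 + 1) / 2 ≤ logWeight x + logWeight z := by
  have h := Real.log_le_log (by positivity) (norm_sub_sq_add_one_le x z)
  rw [Real.log_pow, Real.log_mul (by positivity) (by positivity)] at h
  unfold logWeight
  push_cast at h
  linarith

lemma regKernel_nonneg {η : ℝ} (h0 : 0 ≤ η) (h1 : η ≤ 1) (x z : X) : 0 ≤ regKernel η x z := by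
  unfold regKernel
  have h2 := log_norm_sq_add_one_le x z
  -- The first case is the diagonal with `η = 0`: there `Real.log 0 = 0` gives the kernel a finite
  -- value instead of `+∞`, still nonnegative. Later statements discard the diagonal as a null set.
  rcases (show 0 ≤ ‖x - z‖ ^ 2 + η by positivity).eq_or_lt with h | h
  · rw [← h, Real.log_zero]
    linarith [logWeight_nonneg x, logWeight_nonneg z]
  · have : Real.log (‖x - z‖ ^ 2 + η) ≤ Real.log (‖x - z‖ ^ 2 + 1) :=
      Real.log_le_log h (by linarith)
    linarith

lemma regKernel_comm (η : ℝ) (x z : X) : regKernel η x z = regKernel η z x := by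
  unfold regKernel; rw [norm_sub_rev]; ring

end LogKernel

section

variable {X : Type*} [NormedAddCommGroup X] [InnerProductSpace ℝ X] [FiniteDimensional ℝ X]
  [MeasurableSpace X] [BorelSpace X]

@[fun_prop]
lemma measurable_logWeight : Measurable (logWeight : X → ℝ) := by
  unfold logWeight; fun_prop

@[fun_prop]
lemma measurable_regKernel (η : ℝ) : Measurable (fun p : X × X => regKernel η p.1 p.2) := by
  unfold regKernel; fun_prop

lemma measurable_regKernel_right (η : ℝ) (x : X) : Measurable (fun z => regKernel η x z) := by
  unfold regKernel; fun_prop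

/-- Auxiliary identity comparing the weighted kernel with the positive definite truncated kernel. -/
lemma regKernel_add_log_eq {η R : ℝ} (h0 : 0 ≤ η) (h1 : η ≤ 1) (hR : 1 ≤ R) {x z : X}
    (hxz : 0 < ‖x - z‖ ^ 2 + η) :
    ENNReal.ofReal (regKernel η x z) + ENNReal.ofReal (Real.log (‖x - z‖ ^ 2 + R) / 2)
      = ENNReal.ofReal (logWeight x) + ENNReal.ofReal (logWeight z) + 2⁻¹ * truncKernel η R x z := by
  have hl : 0 ≤ Real.log (‖x - z‖ ^ 2 + R) := Real.log_nonneg (by nlinarith [norm_nonneg (x - z)])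
  have hm : Real.log (‖x - z‖ ^ 2 + η) ≤ Real.log (‖x - z‖ ^ 2 + R) :=
    Real.log_le_log hxz (by linarith)
  rw [truncKernel, lintegral_one_div_add_Ioc hxz (h1.trans hR)]
  rw [show (2⁻¹ : ℝ≥0∞) = ENNReal.ofReal (2⁻¹) by
    rw [ENNReal.ofReal_inv_of_pos (by norm_num)]; simp]
  rw [← ENNReal.ofReal_mul (by norm_num), ← ENNReal.ofReal_add (regKernel_nonneg h0 h1 x z) (by linarith),
    ← ENNReal.ofReal_add (logWeight_nonneg x) (logWeight_nonneg z),
    ← ENNReal.ofReal_add (add_nonneg (logWeight_nonneg x) (logWeight_nonneg z)) (by linarith)]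
  congr 1
  unfold regKernel; ring

/-- The pointwise identity integrated. The term with `R` stands on the left so that all terms are
nonnegative and `ℝ≥0∞` needs no subtraction. -/
lemma mutualEnergy_regKernel_add {η R : ℝ} (h0 : 0 ≤ η) (h1 : η ≤ 1) (hR : 1 ≤ R)
    (α β : Measure X) [IsProbabilityMeasure α] [IsProbabilityMeasure β]
    (h : ∀ᵐ p ∂(α.prod β), 0 < ‖p.1 - p.2‖ ^ 2 + η) :
    mutualEnergy (fun x z => ENNReal.ofReal (regKernel η x z)) α β
      + ∫⁻ p, ENNReal.ofReal (Real.log (‖p.1 - p.2‖ ^ 2 + R) / 2) ∂(α.prod β)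
    = ∫⁻ x, ENNReal.ofReal (logWeight x) ∂α + ∫⁻ x, ENNReal.ofReal (logWeight x) ∂β
      + 2⁻¹ * mutualEnergy (truncKernel η R) α β := by
  have hq := (isPosDefKernel_truncKernel (X := X) (R := R) h0).1
  rw [mutualEnergy_eq_lintegral_prod (by unfold Function.uncurry; fun_prop),
    mutualEnergy_eq_lintegral_prod hq, ← lintegral_add_left (by fun_prop)]
  have hq' : Measurable (fun p : X × X => truncKernel η R p.1 p.2) := hq
  rw [← lintegral_const_mul _ hq']
  have e1 : ∫⁻ x, ENNReal.ofReal (logWeight x) ∂α = ∫⁻ p, ENNReal.ofReal (logWeight p.1) ∂(α.prod β) :=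
    ((measurePreserving_fst (μ := α) (ν := β)).lintegral_comp (by fun_prop)).symm
  have e2 : ∫⁻ x, ENNReal.ofReal (logWeight x) ∂β = ∫⁻ p, ENNReal.ofReal (logWeight p.2) ∂(α.prod β) :=
    ((measurePreserving_snd (μ := α) (ν := β)).lintegral_comp (by fun_prop)).symm
  rw [e1, e2, ← lintegral_add_left (by fun_prop), ← lintegral_add_left (by fun_prop)]
  refine lintegral_congr_ae ?_
  filter_upwards [h] with p hp using regKernel_add_log_eq h0 h1 hR hp

/-- The divergent part `log R / 2` is constant, hence contributes the same for every pair of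
probability measures; what is left vanishes as `R → ∞`. -/
lemma log_norm_sq_add_eq (R : ℝ) (hR : 1 ≤ R) (x z : X) :
    ENNReal.ofReal (Real.log (‖x - z‖ ^ 2 + R) / 2)
      = ENNReal.ofReal (Real.log R / 2) + ENNReal.ofReal (Real.log (‖x - z‖ ^ 2 / R + 1) / 2) := by
  have h1 : 0 ≤ Real.log (‖x - z‖ ^ 2 / R + 1) := Real.log_nonneg (by
    have : 0 ≤ ‖x - z‖ ^ 2 / R := by positivity
    linarith)
  rw [← ENNReal.ofReal_add (by linarith [Real.log_nonneg hR]) (by linarith), ← add_div,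
    ← Real.log_mul (by positivity) (by positivity)]
  congr 4
  field_simp

lemma tendsto_lintegral_log_norm_sq_div (α : Measure X) [IsProbabilityMeasure α]
    (hα : ∫⁻ x, ENNReal.ofReal (logWeight x) ∂α ≠ ⊤) :
    Tendsto (fun m : ℕ => ∫⁻ p, ENNReal.ofReal
      (Real.log (‖p.1 - p.2‖ ^ 2 / ((m : ℝ) + 1) + 1) / 2) ∂(α.prod α)) atTop (𝓝 0) := by
  have h0 : ∫⁻ _p : X × X, (0 : ℝ≥0∞) ∂(α.prod α) = 0 := by simp
  rw [← h0]
  refine tendsto_lintegral_of_dominated_convergence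
    (fun p => ENNReal.ofReal (logWeight p.1) + ENNReal.ofReal (logWeight p.2)) (fun m => by fun_prop)
    (fun m => ae_of_all _ fun p => ?_) ?_ (ae_of_all _ fun p => ?_)
  · beta_reduce
    rw [← ENNReal.ofReal_add (logWeight_nonneg _) (logWeight_nonneg _)]
    refine ENNReal.ofReal_le_ofReal (le_trans ?_ (log_norm_sq_add_one_le _ _))
    have : ‖p.1 - p.2‖ ^ 2 / ((m : ℝ) + 1) ≤ ‖p.1 - p.2‖ ^ 2 := by
      refine div_le_self (by positivity) (by linarith [(Nat.cast_nonneg m : (0 : ℝ) ≤ m)])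
    gcongr
  · rw [lintegral_add_left (by fun_prop),
      (measurePreserving_fst (μ := α) (ν := α)).lintegral_comp (f := fun x => ENNReal.ofReal (logWeight x))
        (by fun_prop),
      (measurePreserving_snd (μ := α) (ν := α)).lintegral_comp (f := fun x => ENNReal.ofReal (logWeight x))
        (by fun_prop)]
    exact ENNReal.add_ne_top.2 ⟨hα, hα⟩
  · have h1 : Tendsto (fun m : ℕ => ‖p.1 - p.2‖ ^ 2 / ((m : ℝ) + 1) + 1) atTop (𝓝 (0 + 1)) := by
      refine Tendsto.add ?_ tendsto_const_nhds
      exact Tendsto.div_atTop tendsto_const_nhds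
        (tendsto_atTop_add_const_right _ _ tendsto_natCast_atTop_atTop)
    have h2 := (h1.log (by norm_num)).div_const 2
    have h3 := ENNReal.tendsto_ofReal h2
    simpa using h3

/-- The weighted logarithmic kernel is conditionally positive definite. -/
theorem two_mul_mutualEnergy_regKernel_le {η : ℝ} (h0 : 0 ≤ η) (h1 : η ≤ 1)
    (α β : Measure X) [IsProbabilityMeasure α] [IsProbabilityMeasure β]
    (hα : ∫⁻ x, ENNReal.ofReal (logWeight x) ∂α ≠ ⊤) (hβ : ∫⁻ x, ENNReal.ofReal (logWeight x) ∂β ≠ ⊤)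
    (hαβ : ∀ᵐ p ∂(α.prod β), 0 < ‖p.1 - p.2‖ ^ 2 + η)
    (hαα : ∀ᵐ p ∂(α.prod α), 0 < ‖p.1 - p.2‖ ^ 2 + η)
    (hββ : ∀ᵐ p ∂(β.prod β), 0 < ‖p.1 - p.2‖ ^ 2 + η) :
    2 * mutualEnergy (fun x z => ENNReal.ofReal (regKernel η x z)) α β
      ≤ mutualEnergy (fun x z => ENNReal.ofReal (regKernel η x z)) α α
        + mutualEnergy (fun x z => ENNReal.ofReal (regKernel η x z)) β β := by
  have lim := ((tendsto_lintegral_log_norm_sq_div α hα).add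
    (tendsto_lintegral_log_norm_sq_div β hβ)).const_add
    (mutualEnergy (fun x z => ENNReal.ofReal (regKernel η x z)) α α
        + mutualEnergy (fun x z => ENNReal.ofReal (regKernel η x z)) β β)
  rw [add_zero, add_zero] at lim
  -- It suffices to prove the inequality for each `R = m + 1` with an error on the right that
  -- vanishes as `m → ∞`.
  refine ge_of_tendsto' lim fun m => ?_
  set R : ℝ := (m : ℝ) + 1
  have hR : 1 ≤ R := by simp [R]
  have split : ∀ (a b : Measure X) [IsProbabilityMeasure a] [IsProbabilityMeasure b],
      ∫⁻ p, ENNReal.ofReal (Real.log (‖p.1 - p.2‖ ^ 2 + R) / 2) ∂(a.prod b)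
        = ENNReal.ofReal (Real.log R / 2)
          + ∫⁻ p, ENNReal.ofReal (Real.log (‖p.1 - p.2‖ ^ 2 / R + 1) / 2) ∂(a.prod b) := by
    intro a b _ _
    simp_rw [log_norm_sq_add_eq R hR]
    rw [lintegral_add_left (by fun_prop)]
    simp
  have eab := mutualEnergy_regKernel_add h0 h1 hR α β hαβ
  have eaa := mutualEnergy_regKernel_add h0 h1 hR α α hαα
  have ebb := mutualEnergy_regKernel_add h0 h1 hR β β hββ
  have pd := (isPosDefKernel_truncKernel (X := X) (R := R) h0).2 α β inferInstance inferInstance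
  have hab := split α β
  rw [split] at eaa ebb
  set G := mutualEnergy (fun x z : X => ENNReal.ofReal (regKernel η x z))
  set Q := mutualEnergy (truncKernel (X := X) η R)
  set c := ENNReal.ofReal (Real.log R / 2)
  have hc : 2 * c ≠ ⊤ := ENNReal.mul_ne_top (by simp) ENNReal.ofReal_ne_top
  -- Both sides carry the finite constant `2c`, because `α` and `β` have equal mass. This
  -- cancellation is why positivity holds only conditionally.
  rw [← ENNReal.add_le_add_iff_right hc]
  set ea := ∫⁻ p, ENNReal.ofReal (Real.log (‖p.1 - p.2‖ ^ 2 / R + 1) / 2) ∂(α.prod α)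
  set eb := ∫⁻ p, ENNReal.ofReal (Real.log (‖p.1 - p.2‖ ^ 2 / R + 1) / 2) ∂(β.prod β)
  set A := ∫⁻ x, ENNReal.ofReal (logWeight x) ∂α
  set B := ∫⁻ x, ENNReal.ofReal (logWeight x) ∂β
  calc 2 * G α β + 2 * c ≤ 2 * (G α β + ∫⁻ p, ENNReal.ofReal
        (Real.log (‖p.1 - p.2‖ ^ 2 + R) / 2) ∂(α.prod β)) := by
        rw [mul_add]; gcongr; rw [hab]; exact le_self_add
    _ = 2 * A + 2 * B + 2⁻¹ * (2 * Q α β) := by rw [eab]; ring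
    _ ≤ 2 * A + 2 * B + 2⁻¹ * (Q α α + Q β β) := by gcongr
    _ = (A + A + 2⁻¹ * Q α α) + (B + B + 2⁻¹ * Q β β) := by ring
    _ = _ := by rw [← eaa, ← ebb]; ring

end

end LogGas

end

/-! ### Logarithmic potentials of measures with bounded density -/

noncomputable section

namespace LogGas

/-- Subadditivity of `y ↦ y^a` gives `a log(1+y) ≤ log(1+y^a) ≤ y^a`. It trades the logarithmic
singularity for a weak power. -/
lemma log_one_add_le_rpow_div {y a : ℝ} (hy : 0 ≤ y) (ha : 0 < a) (ha1 : a ≤ 1) :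
    Real.log (1 + y) ≤ y ^ a / a := by
  have h1 : (1 + y) ^ a ≤ 1 ^ a + y ^ a := Real.rpow_add_le_add_rpow zero_le_one hy ha.le ha1
  rw [Real.one_rpow] at h1
  have h2 : Real.log ((1 + y) ^ a) ≤ y ^ a := by
    have h3 := Real.log_le_log (by positivity) h1
    have h4 := Real.log_le_sub_one_of_pos (show 0 < 1 + y ^ a by positivity)
    linarith
  rw [Real.log_rpow (by positivity)] at h2
  rw [le_div_iff₀ ha]
  linarith

section

variable {X : Type*} [NormedAddCommGroup X]

lemma regKernel_zero_eq {x z : X} :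
    regKernel 0 x z = logWeight x + logWeight z - Real.log ‖x - z‖ := by
  unfold regKernel
  rw [add_zero, Real.log_pow]
  push_cast
  ring

lemma regKernel_zero_sub_le {η : ℝ} (hη : 0 ≤ η) {x z : X} (hxz : x ≠ z) :
    regKernel 0 x z - regKernel η x z ≤ 2 * η ^ (1 / 4 : ℝ) * ‖x - z‖ ^ (-(1 / 2) : ℝ) := by
  have hr : 0 < ‖x - z‖ := norm_pos_iff.2 (sub_ne_zero.2 hxz)
  set r := ‖x - z‖ with hr'
  have h1 : regKernel 0 x z - regKernel η x z = Real.log (1 + η / r ^ 2) / 2 := by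
    unfold regKernel
    rw [← hr', add_zero, show r ^ 2 + η = r ^ 2 * (1 + η / r ^ 2) by field_simp,
      Real.log_mul (by positivity) (by positivity)]
    ring
  rw [h1]
  -- The exponent `1/4` turns `η / r²` into `η^{1/4} r^{-1/2}`, and `r^{-1/2}` is locally integrable
  -- even in dimension one.
  have h2 := log_one_add_le_rpow_div (show 0 ≤ η / r ^ 2 by positivity)
    (show (0 : ℝ) < 1 / 4 by norm_num) (by norm_num)
  rw [Real.div_rpow hη (by positivity)] at h2
  have h3 : (r ^ 2) ^ (1 / 4 : ℝ) = r ^ (1 / 2 : ℝ) := by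
    rw [← Real.rpow_natCast, ← Real.rpow_mul hr.le]; norm_num
  rw [h3] at h2
  rw [Real.rpow_neg hr.le]
  calc _ ≤ η ^ (1 / 4 : ℝ) / r ^ (1 / 2 : ℝ) / (1 / 4) / 2 := by linarith
    _ = _ := by ring

lemma regKernel_le_regKernel_zero {η : ℝ} (hη : 0 ≤ η) {x z : X} (hxz : x ≠ z) :
    regKernel η x z ≤ regKernel 0 x z := by
  have hr : 0 < ‖x - z‖ := norm_pos_iff.2 (sub_ne_zero.2 hxz)
  unfold regKernel
  have : Real.log (‖x - z‖ ^ 2 + 0) ≤ Real.log (‖x - z‖ ^ 2 + η) :=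
    Real.log_le_log (by positivity) (by linarith)
  linarith

lemma logWeight_le_add (x z : X) : logWeight x ≤ logWeight z + Real.log (1 + ‖x - z‖) := by
  unfold logWeight
  rw [← Real.log_mul (by positivity) (by positivity)]
  refine Real.log_le_log (by positivity) ?_
  have : ‖x‖ ≤ ‖z‖ + ‖x - z‖ := by
    calc ‖x‖ = ‖z + (x - z)‖ := by congr 1; abel
      _ ≤ _ := norm_add_le _ _
  nlinarith [norm_nonneg z, norm_nonneg (x - z), mul_nonneg (norm_nonneg z) (norm_nonneg (x - z))]

/-- The growth of `logWeight x` is absorbed by `-log|x-z|`, leaving `log(1 + 1/|x-z|)`. The bound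
therefore integrates in `z` uniformly in `x`. -/
lemma regKernel_zero_le {x z : X} (hxz : x ≠ z) :
    regKernel 0 x z ≤ 2 * logWeight z + 2 * ‖x - z‖ ^ (-(1 / 2) : ℝ) := by
  have hr : 0 < ‖x - z‖ := norm_pos_iff.2 (sub_ne_zero.2 hxz)
  rw [regKernel_zero_eq]
  have h1 := logWeight_le_add x z
  set r := ‖x - z‖
  have h2 : Real.log (1 + r) - Real.log r = Real.log (1 + r⁻¹) := by
    rw [← Real.log_div (by positivity) (by positivity)]
    congr 1; field_simp; ring
  have h3 := log_one_add_le_rpow_div (show 0 ≤ r⁻¹ by positivity)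
    (show (0 : ℝ) < 1 / 2 by norm_num) (by norm_num)
  rw [Real.inv_rpow hr.le, ← Real.rpow_neg hr.le] at h3
  have : r ^ (-(1 / 2) : ℝ) / (1 / 2) = 2 * r ^ (-(1 / 2) : ℝ) := by ring
  linarith

end

section

variable {X : Type*} [NormedAddCommGroup X] [InnerProductSpace ℝ X] [FiniteDimensional ℝ X]
  [MeasurableSpace X] [BorelSpace X]

/-- A probability measure with bounded Lebesgue density and finite second moment. -/
structure IsTame (α : Measure X) : Prop where
  prob : IsProbabilityMeasure α
  le_smul_volume : ∃ C : ℝ≥0, α ≤ C • (volume : Measure X)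
  integrable_sq : Integrable (fun x => (1 + ‖x‖) ^ 2) α

lemma IsTame.integrable_logWeight {α : Measure X} (h : IsTame α) : Integrable logWeight α := by
  refine h.integrable_sq.mono' measurable_logWeight.aestronglyMeasurable (ae_of_all _ fun x => ?_)
  rw [Real.norm_of_nonneg (logWeight_nonneg x)]
  nlinarith [logWeight_le_norm x, norm_nonneg x]

lemma IsTame.lintegral_logWeight_ne_top {α : Measure X} (h : IsTame α) :
    ∫⁻ x, ENNReal.ofReal (logWeight x) ∂α ≠ ⊤ := by
  rw [← ofReal_integral_eq_lintegral_ofReal h.integrable_logWeight (ae_of_all _ logWeight_nonneg)]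
  exact ENNReal.ofReal_ne_top

variable [Nontrivial X]

/-- In polar coordinates the integrand is at most `y^{-1/2}` on `(0,1)`, as the dimension is at
least one. -/
lemma lintegral_ball_norm_rpow_ne_top :
    ∫⁻ y in Metric.ball (0 : X) 1, ENNReal.ofReal (‖y‖ ^ (-(1 / 2) : ℝ)) ≠ ⊤ := by
  have h : IntegrableOn (fun y : X => ‖y‖ ^ (-(1 / 2) : ℝ)) (Metric.ball (0 : X) 1) volume := by
    rw [integrableOn_fun_norm_addHaar volume (f := fun y : ℝ => y ^ (-(1 / 2) : ℝ))]
    have h1 : IntegrableOn (fun y : ℝ => y ^ (-(1 / 2) : ℝ)) (Set.Ioo 0 1) :=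
      (intervalIntegral.integrableOn_Ioo_rpow_iff one_pos).2 (by norm_num)
    refine h1.mono' (by fun_prop) ?_
    refine (ae_restrict_mem measurableSet_Ioo).mono fun y hy => ?_
    rw [smul_eq_mul, Real.norm_of_nonneg (by have := hy.1; positivity)]
    have h2 : y ^ (Module.finrank ℝ X - 1) ≤ 1 := pow_le_one₀ hy.1.le hy.2.le
    have h3 : 0 ≤ y ^ (-(1 / 2) : ℝ) := Real.rpow_nonneg hy.1.le _
    nlinarith
  have := h.2
  rw [hasFiniteIntegral_iff_ofReal (ae_of_all _ fun y => by positivity)] at this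
  exact this.ne

lemma norm_rpow_neg_le {a : ℝ} (ha : 0 ≤ a) (ha' : a ≤ 1 / 2) (y : X) :
    ENNReal.ofReal (‖y‖ ^ (-a)) ≤ 1 + (Metric.ball (0 : X) 1).indicator
      (fun y => ENNReal.ofReal (‖y‖ ^ (-(1 / 2) : ℝ))) y := by
  by_cases h : y ∈ Metric.ball (0 : X) 1
  · rw [Set.indicator_of_mem h]
    rw [mem_ball_zero_iff] at h
    rcases (norm_nonneg y).eq_or_lt with h0 | h0
    · rw [← h0]
      refine le_trans ?_ le_self_add
      rcases ha.eq_or_lt with h1 | h1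
      · simp [← h1]
      -- At the singular point the convention is `0^{-a} = 0` for `a > 0`, so nothing is to be shown
      -- there.
      · rw [Real.zero_rpow (by linarith)]; simp
    · refine le_trans (ENNReal.ofReal_le_ofReal ?_) le_add_self
      exact Real.rpow_le_rpow_of_exponent_ge h0 h.le (by linarith)
  · rw [Set.indicator_of_notMem h, add_zero]
    rw [mem_ball_zero_iff, not_lt] at h
    rw [ENNReal.ofReal_le_one]
    exact Real.rpow_le_one_of_one_le_of_nonpos h (by linarith)

/-- Measures with bounded density have uniformly bounded Riesz potentials of order at most `1/2`. -/
lemma IsTame.exists_riesz_bound {α : Measure X} (h : IsTame α) :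
    ∃ K : ℝ≥0, ∀ a : ℝ, 0 ≤ a → a ≤ 1 / 2 → ∀ x : X,
      ∫⁻ z, ENNReal.ofReal (‖x - z‖ ^ (-a)) ∂α ≤ K := by
  obtain ⟨C, hC⟩ := h.le_smul_volume
  have := h.prob
  set B := ∫⁻ y in Metric.ball (0 : X) 1, ENNReal.ofReal (‖y‖ ^ (-(1 / 2) : ℝ))
  have hB : B ≠ ⊤ := lintegral_ball_norm_rpow_ne_top
  refine ⟨(1 + C * B).toNNReal, fun a ha ha' x => ?_⟩
  rw [ENNReal.coe_toNNReal (by finiteness)]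
  have hm : Measurable (fun z : X => (Metric.ball (0 : X) 1).indicator
      (fun y => ENNReal.ofReal (‖y‖ ^ (-(1 / 2) : ℝ))) (x - z)) := by
    refine Measurable.comp (g := (Metric.ball (0 : X) 1).indicator
      (fun y => ENNReal.ofReal (‖y‖ ^ (-(1 / 2) : ℝ)))) ?_ (by fun_prop)
    exact Measurable.indicator (by fun_prop) measurableSet_ball
  calc ∫⁻ z, ENNReal.ofReal (‖x - z‖ ^ (-a)) ∂α
      ≤ ∫⁻ z, (1 + (Metric.ball (0 : X) 1).indicator
      (fun y => ENNReal.ofReal (‖y‖ ^ (-(1 / 2) : ℝ))) (x - z)) ∂α :=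
        lintegral_mono fun z => norm_rpow_neg_le ha ha' (x - z)
    _ = 1 + ∫⁻ z, (Metric.ball (0 : X) 1).indicator
      (fun y => ENNReal.ofReal (‖y‖ ^ (-(1 / 2) : ℝ))) (x - z) ∂α := by
        rw [lintegral_add_left measurable_const]; simp
    _ ≤ 1 + ∫⁻ z, (Metric.ball (0 : X) 1).indicator
      (fun y => ENNReal.ofReal (‖y‖ ^ (-(1 / 2) : ℝ))) (x - z) ∂(C • (volume : Measure X)) := by
        gcongr
    _ = 1 + C * B := by
        rw [lintegral_smul_measure, lintegral_sub_left_eq_self (μ := (volume : Measure X))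
          ((Metric.ball (0 : X) 1).indicator (fun y => ENNReal.ofReal (‖y‖ ^ (-(1 / 2) : ℝ)))) x,
          lintegral_indicator measurableSet_ball]
        rfl

lemma IsTame.absolutelyContinuous {α : Measure X} (h : IsTame α) : α ≪ volume := by
  obtain ⟨C, hC⟩ := h.le_smul_volume
  exact (Measure.absolutelyContinuous_of_le hC).trans (Measure.smul_absolutelyContinuous)

lemma IsTame.nullSingletonClass {α : Measure X} (h : IsTame α) : NullSingletonClass α :=
  ⟨fun x => h.absolutelyContinuous (measure_singleton x)⟩

lemma IsTame.ae_ne {α : Measure X} (h : IsTame α) (x : X) : ∀ᵐ z ∂α, x ≠ z := by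
  have := h.nullSingletonClass
  filter_upwards [Measure.ae_ne α x] with z hz using hz.symm

lemma ae_prod_ne (α β : Measure X) [SFinite α] [SFinite β] [NullSingletonClass β] :
    ∀ᵐ p ∂(α.prod β), p.1 ≠ p.2 := by
  refine (Measure.ae_prod_iff_ae_ae (p := fun p : X × X => p.1 ≠ p.2)
    (measurableSet_eq_fun measurable_fst measurable_snd).compl).2 (ae_of_all _ fun x => ?_)
  filter_upwards [Measure.ae_ne β x] with z hz using hz.symm

/-- The potential `∫ k_η(x,z) α(dz)`. -/
def potential (η : ℝ) (α : Measure X) (x : X) : ℝ := ∫ z, regKernel η x z ∂α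

lemma IsTame.integrable_norm_rpow {α : Measure X} (h : IsTame α) {a : ℝ} (ha : 0 ≤ a)
    (ha' : a ≤ 1 / 2) (x : X) : Integrable (fun z => ‖x - z‖ ^ (-a)) α := by
  obtain ⟨K, hK⟩ := h.exists_riesz_bound
  refine ⟨Measurable.aestronglyMeasurable (by fun_prop), ?_⟩
  rw [hasFiniteIntegral_iff_ofReal (ae_of_all _ fun y => by positivity)]
  exact (hK a ha ha' x).trans_lt ENNReal.coe_lt_top

lemma IsTame.integral_norm_rpow_le {α : Measure X} (h : IsTame α) :
    ∃ K : ℝ, 0 ≤ K ∧ ∀ a : ℝ, 0 ≤ a → a ≤ 1 / 2 → ∀ x : X, ∫ z, ‖x - z‖ ^ (-a) ∂α ≤ K := by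
  obtain ⟨K, hK⟩ := h.exists_riesz_bound
  refine ⟨K, K.2, fun a ha ha' x => ?_⟩
  rw [integral_eq_lintegral_of_nonneg_ae (ae_of_all _ fun y => by positivity)
    (Measurable.aestronglyMeasurable (by fun_prop))]
  exact ENNReal.toReal_le_of_le_ofReal K.2 (by simpa using hK a ha ha' x)

lemma IsTame.integrable_regKernel {α : Measure X} (h : IsTame α) {η : ℝ} (h0 : 0 ≤ η) (h1 : η ≤ 1)
    (x : X) : Integrable (fun z => regKernel η x z) α := by
  refine ((h.integrable_logWeight.const_mul 2).add
    ((h.integrable_norm_rpow (by norm_num) le_rfl x).const_mul 2)).mono'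
    (measurable_regKernel_right η x).aestronglyMeasurable ?_
  filter_upwards [h.ae_ne x] with z hz
  rw [Real.norm_of_nonneg (regKernel_nonneg h0 h1 x z)]
  exact (regKernel_le_regKernel_zero h0 hz).trans (regKernel_zero_le hz)

lemma potential_nonneg {α : Measure X} {η : ℝ} (h0 : 0 ≤ η) (h1 : η ≤ 1) (x : X) :
    0 ≤ potential η α x :=
  integral_nonneg fun z => regKernel_nonneg h0 h1 x z

lemma IsTame.potential_le {α : Measure X} (h : IsTame α) {η : ℝ} (h0 : 0 ≤ η) (h1 : η ≤ 1) (x : X) :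
    potential η α x ≤ potential 0 α x := by
  refine integral_mono_ae (h.integrable_regKernel h0 h1 x)
    (h.integrable_regKernel le_rfl zero_le_one x) ?_
  filter_upwards [h.ae_ne x] with z hz using regKernel_le_regKernel_zero h0 hz

lemma IsTame.exists_potential_bound {α : Measure X} (h : IsTame α) :
    ∃ B : ℝ, ∀ x, potential 0 α x ≤ B := by
  obtain ⟨K, hK0, hK⟩ := h.integral_norm_rpow_le
  refine ⟨2 * ∫ z, logWeight z ∂α + 2 * K, fun x => ?_⟩
  calc potential 0 α x ≤ ∫ z, (2 * logWeight z + 2 * ‖x - z‖ ^ (-(1 / 2) : ℝ)) ∂α := by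
        refine integral_mono_ae (h.integrable_regKernel le_rfl zero_le_one x)
          ((h.integrable_logWeight.const_mul 2).add
            ((h.integrable_norm_rpow (by norm_num) le_rfl x).const_mul 2)) ?_
        filter_upwards [h.ae_ne x] with z hz using regKernel_zero_le hz
    _ = 2 * ∫ z, logWeight z ∂α + 2 * ∫ z, ‖x - z‖ ^ (-(1 / 2) : ℝ) ∂α := by
        rw [integral_add (h.integrable_logWeight.const_mul 2)
          ((h.integrable_norm_rpow (by norm_num) le_rfl x).const_mul 2), integral_const_mul,
          integral_const_mul]
    _ ≤ _ := by linarith [hK (1 / 2) (by norm_num) le_rfl x]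

/-- The regularized potentials converge uniformly. -/
lemma IsTame.exists_potential_sub_le {α : Measure X} (h : IsTame α) :
    ∃ K : ℝ, 0 ≤ K ∧ ∀ η : ℝ, 0 ≤ η → η ≤ 1 → ∀ x,
      potential 0 α x - potential η α x ≤ K * η ^ (1 / 4 : ℝ) := by
  obtain ⟨K, hK0, hK⟩ := h.integral_norm_rpow_le
  refine ⟨2 * K, by positivity, fun η h0 h1 x => ?_⟩
  have i1 := (h.integrable_norm_rpow (show (0 : ℝ) ≤ 1 / 2 by norm_num) le_rfl x).const_mul
    (2 * η ^ (1 / 4 : ℝ))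
  unfold potential
  rw [← integral_sub (h.integrable_regKernel le_rfl zero_le_one x) (h.integrable_regKernel h0 h1 x)]
  calc _ ≤ ∫ z, 2 * η ^ (1 / 4 : ℝ) * ‖x - z‖ ^ (-(1 / 2) : ℝ) ∂α := by
        refine integral_mono_ae ((h.integrable_regKernel le_rfl zero_le_one x).sub
          (h.integrable_regKernel h0 h1 x)) i1 ?_
        filter_upwards [h.ae_ne x] with z hz using regKernel_zero_sub_le h0 hz
    _ = 2 * η ^ (1 / 4 : ℝ) * ∫ z, ‖x - z‖ ^ (-(1 / 2) : ℝ) ∂α := integral_const_mul _ _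
    _ ≤ 2 * η ^ (1 / 4 : ℝ) * K := by gcongr; exact hK _ (by norm_num) le_rfl x
    _ = _ := by ring

lemma continuous_regKernel_left {η : ℝ} (h0 : 0 < η) (z : X) : Continuous (fun x => regKernel η x z) := by
  unfold regKernel logWeight
  have h1 : ∀ x : X, 1 + ‖x‖ ≠ 0 := fun x => by positivity
  have h2 : ∀ x : X, ‖x - z‖ ^ 2 + η ≠ 0 := fun x => by positivity
  fun_prop (disch := assumption)

lemma IsTame.continuous_potential_of_pos {α : Measure X} (h : IsTame α) {η : ℝ} (h0 : 0 < η)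
    (h1 : η ≤ 1) : Continuous (potential η α) := by
  have := h.prob
  rw [continuous_iff_continuousAt]
  intro x₀
  refine continuousAt_of_dominated (bound := fun z => (logWeight x₀ + 1) + logWeight z - Real.log η / 2)
    (Eventually.of_forall fun x => (measurable_regKernel_right η x).aestronglyMeasurable) ?_
    (((integrable_const _).add h.integrable_logWeight).sub (integrable_const _))
    (ae_of_all _ fun z => (continuous_regKernel_left h0 z).continuousAt)
  have hc : ContinuousAt (logWeight : X → ℝ) x₀ := by
    unfold logWeight
    have : 1 + ‖x₀‖ ≠ 0 := by positivity
    fun_prop (disch := assumption)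
  have : ∀ᶠ x in 𝓝 x₀, logWeight x < logWeight x₀ + 1 :=
    hc.eventually_lt continuousAt_const (by linarith)
  filter_upwards [this] with x hx
  refine ae_of_all _ fun z => ?_
  rw [Real.norm_of_nonneg (regKernel_nonneg h0.le h1 x z)]
  unfold regKernel
  have : Real.log η ≤ Real.log (‖x - z‖ ^ 2 + η) :=
    Real.log_le_log h0 (by nlinarith [norm_nonneg (x - z)])
  linarith

/-- A uniform limit, as `η → 0`, of the regularized potentials, which are continuous by dominated
convergence. -/
lemma IsTame.continuous_potential {α : Measure X} (h : IsTame α) : Continuous (potential 0 α) := by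
  obtain ⟨K, hK0, hK⟩ := h.exists_potential_sub_le
  have hu : TendstoUniformly (fun η : ℝ => potential η α) (potential 0 α) (𝓝[>] 0) := by
    rw [Metric.tendstoUniformly_iff]
    intro ε hε
    have h1 : Tendsto (fun η : ℝ => K * η ^ (1 / 4 : ℝ)) (𝓝[>] 0) (𝓝 0) := by
      have : ContinuousAt (fun η : ℝ => K * η ^ (1 / 4 : ℝ)) 0 :=
        continuousAt_const.mul (Real.continuousAt_rpow_const _ _ (Or.inr (by norm_num)))
      have h2 := this.tendsto
      rw [Real.zero_rpow (by norm_num), mul_zero] at h2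
      exact h2.mono_left nhdsWithin_le_nhds
    filter_upwards [h1.eventually_lt_const hε, Ioc_mem_nhdsGT (zero_lt_one' ℝ)] with η h2 h3 x
    rw [Real.dist_eq, abs_of_nonneg (by linarith [h.potential_le h3.1.le h3.2 x])]
    exact (hK η h3.1.le h3.2 x).trans_lt h2
  refine hu.continuous (Eventually.frequently ?_)
  filter_upwards [Ioc_mem_nhdsGT (zero_lt_one' ℝ)] with η h3
  exact h.continuous_potential_of_pos h3.1 h3.2

end

end LogGas

end

/-! ### Entropy and mutual energy of densities -/

noncomputable section

namespace LogGas

open InformationTheory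

/-- `a log (a / b) - a + b`, the pointwise relative entropy. -/
def relEnt (a b : ℝ) : ℝ := a * Real.log a - a * Real.log b - a + b

lemma relEnt_eq {a b : ℝ} (ha : 0 ≤ a) (hb : 0 < b) : relEnt a b = b * klFun (a / b) := by
  unfold relEnt klFun
  rcases ha.eq_or_lt with h | h
  · simp [← h]
  · rw [Real.log_div h.ne' hb.ne']
    field_simp
    ring

lemma relEnt_nonneg {a b : ℝ} (ha : 0 ≤ a) (hb : 0 < b) : 0 ≤ relEnt a b := by
  rw [relEnt_eq ha hb]
  exact mul_nonneg hb.le (klFun_nonneg (by positivity))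

lemma eq_of_relEnt_eq_zero {a b : ℝ} (ha : 0 ≤ a) (hb : 0 < b) (h : relEnt a b = 0) : a = b := by
  rw [relEnt_eq ha hb, mul_eq_zero, or_iff_right hb.ne', klFun_eq_zero_iff (by positivity),
    div_eq_one_iff_eq hb.ne'] at h
  exact h

lemma two_mul_one_sub_inv_sqrt_le_log {x : ℝ} (hx : 0 < x) : 2 * (1 - (√x)⁻¹) ≤ Real.log x := by
  have h := Real.one_sub_inv_le_log_of_pos (Real.sqrt_pos.2 hx)
  have h2 := Real.log_sqrt hx.le
  linarith

/-- Strong midpoint convexity of the entropy function. -/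
lemma klFun_midpoint_le {a b : ℝ} (ha : 0 ≤ a) (hb : 0 ≤ b) :
    klFun ((a + b) / 2) + (√a - √b) ^ 2 / 4 ≤ klFun a / 2 + klFun b / 2 := by
  set m := (a + b) / 2 with hm
  rcases (show 0 ≤ m by positivity).eq_or_lt with h0 | h0
  · have h1 : a = 0 := by linarith
    have h2 : b = 0 := by linarith
    simp [hm, h1, h2, klFun]
    norm_num
  -- The bound `log y ≥ 2(1 - y^{-1/2})` at `y = c/m` brings in square roots, hence the Hellinger
  -- distance. It is summed over `c = a` and `c = b`.
  have key : ∀ c : ℝ, 0 ≤ c → 2 * (c - √m * √c) ≤ c * Real.log c - c * Real.log m := by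
    intro c hc
    rcases hc.eq_or_lt with h | h
    · simp [← h]
    · have h1 := two_mul_one_sub_inv_sqrt_le_log (div_pos h h0)
      rw [Real.log_div h.ne' h0.ne', Real.sqrt_div h.le, inv_div] at h1
      have h2 : c * (√m / √c) = √m * √c := by
        have : √c ≠ 0 := (Real.sqrt_pos.2 h).ne'
        field_simp
        rw [Real.sq_sqrt h.le]
      nlinarith [mul_le_mul_of_nonneg_left h1 h.le]
  have ka := key a ha
  have kb := key b hb
  have hs : 0 < √m := Real.sqrt_pos.2 h0
  have e1 : √m ^ 2 = m := Real.sq_sqrt h0.le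
  have e2 : √a ^ 2 = a := Real.sq_sqrt ha
  have e3 : √b ^ 2 = b := Real.sq_sqrt hb
  have hp := Real.sqrt_nonneg a
  have hq := Real.sqrt_nonneg b
  set p := √a
  set q := √b
  set s := √m
  have hsum : 2 * s ^ 2 = p ^ 2 + q ^ 2 := by rw [e1, e2, e3, hm]; ring
  have hle : p + q ≤ 2 * s := by
    by_contra hc
    push Not at hc
    nlinarith [sq_nonneg (p - q)]
  -- From `2s² = p² + q²` one has `(p-q)² = 4s² - (p+q)²`, and the difference of the two sides is
  -- `(2s - (p+q))²/2`.
  have hmain : (p - q) ^ 2 / 2 ≤ 4 * s ^ 2 - 2 * s * (p + q) := by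
    nlinarith [sq_nonneg (2 * s - (p + q))]
  unfold klFun
  have : a * Real.log a + b * Real.log b - 2 * (m * Real.log m) ≥ (p - q) ^ 2 / 2 := by
    have h5 : 2 * (m * Real.log m) = a * Real.log m + b * Real.log m := by rw [hm]; ring
    nlinarith
  have h6 : 2 * m = a + b := by rw [hm]; ring
  linarith

variable {Y : Type*} [MeasurableSpace Y]

/-- A probability density with respect to `ν`. -/
structure IsDensity (ν : Measure Y) (f : Y → ℝ) : Prop where
  meas : Measurable f
  nonneg : ∀ x, 0 ≤ f x
  lintegral_eq : ∫⁻ x, ENNReal.ofReal (f x) ∂ν = 1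

/-- The mutual energy of two densities. -/
def densEnergy (k : Y → Y → ℝ≥0∞) (ν : Measure Y) (f g : Y → ℝ) : ℝ≥0∞ :=
  ∫⁻ p, k p.1 p.2 * ENNReal.ofReal (f p.1) * ENNReal.ofReal (g p.2) ∂(ν.prod ν)

/-- The entropy of a density. -/
def entropy (ν : Measure Y) (f : Y → ℝ) : ℝ≥0∞ := ∫⁻ x, ENNReal.ofReal (klFun (f x)) ∂ν

/-- The free energy of a density. -/
def densFreeEnergy (k : Y → Y → ℝ≥0∞) (γ : ℝ) (ν : Measure Y) (f : Y → ℝ) : ℝ≥0∞ :=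
  ENNReal.ofReal (γ / 2) * densEnergy k ν f f + entropy ν f

/-- The potential of a density. -/
def densPotential (k : Y → Y → ℝ≥0∞) (ν : Measure Y) (f : Y → ℝ) (x : Y) : ℝ≥0∞ :=
  ∫⁻ z, k x z * ENNReal.ofReal (f z) ∂ν

lemma IsDensity.integrable {ν : Measure Y} {f : Y → ℝ} (h : IsDensity ν f) : Integrable f ν := by
  refine ⟨h.meas.aestronglyMeasurable, ?_⟩
  rw [hasFiniteIntegral_iff_ofReal (ae_of_all _ h.nonneg), h.lintegral_eq]
  exact ENNReal.one_lt_top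

lemma IsDensity.integral_eq {ν : Measure Y} {f : Y → ℝ} (h : IsDensity ν f) : ∫ x, f x ∂ν = 1 := by
  rw [integral_eq_lintegral_of_nonneg_ae (ae_of_all _ h.nonneg) h.meas.aestronglyMeasurable,
    h.lintegral_eq, ENNReal.toReal_one]

lemma isDensity_of_integral_eq_one {ν : Measure Y} {f : Y → ℝ} (hm : Measurable f) (h0 : ∀ x, 0 ≤ f x)
    (h1 : ∫ x, f x ∂ν = 1) : IsDensity ν f := by
  refine ⟨hm, h0, ?_⟩
  rw [← ofReal_integral_eq_lintegral_ofReal _ (ae_of_all _ h0), h1, ENNReal.ofReal_one]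
  by_contra hc
  rw [integral_undef hc] at h1
  exact zero_ne_one h1

lemma IsDensity.combination {ν : Measure Y} {f g : Y → ℝ} (hf : IsDensity ν f) (hg : IsDensity ν g)
    {a b : ℝ} (ha : 0 ≤ a) (hb : 0 ≤ b) (hab : a + b = 1) :
    IsDensity ν (fun x => a * f x + b * g x) := by
  refine isDensity_of_integral_eq_one ((hf.meas.const_mul a).add (hg.meas.const_mul b))
    (fun x => add_nonneg (mul_nonneg ha (hf.nonneg x)) (mul_nonneg hb (hg.nonneg x))) ?_
  rw [integral_add (hf.integrable.const_mul a) (hg.integrable.const_mul b), integral_const_mul,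
    integral_const_mul, hf.integral_eq, hg.integral_eq]
  linarith

lemma densEnergy_comm {k : Y → Y → ℝ≥0∞} (hk : Measurable (Function.uncurry k))
    (hsymm : ∀ x z, k x z = k z x) (ν : Measure Y) [SFinite ν] {f g : Y → ℝ} (hf : Measurable f)
    (hg : Measurable g) : densEnergy k ν f g = densEnergy k ν g f := by
  unfold densEnergy
  have hm : Measurable (fun p : Y × Y => k p.1 p.2 * ENNReal.ofReal (g p.1) * ENNReal.ofReal (f p.2)) := by
    have : Measurable (fun p : Y × Y => k p.1 p.2) := hk
    fun_prop
  rw [← Measure.measurePreserving_swap.lintegral_comp (μ := ν.prod ν) hm]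
  refine lintegral_congr fun p => ?_
  simp only [Prod.fst_swap, Prod.snd_swap]
  rw [hsymm p.2 p.1]; ring

lemma densEnergy_eq_lintegral_densPotential {k : Y → Y → ℝ≥0∞} (hk : Measurable (Function.uncurry k))
    (ν : Measure Y) [SFinite ν] {f g : Y → ℝ} (hf : Measurable f) (hg : Measurable g) :
    densEnergy k ν f g = ∫⁻ x, densPotential k ν g x * ENNReal.ofReal (f x) ∂ν := by
  have hk' : Measurable (fun p : Y × Y => k p.1 p.2) := hk
  unfold densEnergy densPotential
  rw [lintegral_prod _ (by fun_prop)]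
  refine lintegral_congr fun x => ?_
  have hkx : Measurable (k x) := hk.comp (measurable_const.prodMk measurable_id)
  rw [← lintegral_mul_const _ (by fun_prop)]
  refine lintegral_congr fun z => ?_
  ring

lemma measurable_densPotential {k : Y → Y → ℝ≥0∞} (hk : Measurable (Function.uncurry k))
    (ν : Measure Y) [SFinite ν] {g : Y → ℝ} (hg : Measurable g) : Measurable (densPotential k ν g) := by
  have hk' : Measurable (fun p : Y × Y => k p.1 p.2) := hk
  exact Measurable.lintegral_prod_right' (f := fun p : Y × Y => k p.1 p.2 * ENNReal.ofReal (g p.2))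
    (by fun_prop)

lemma densEnergy_combination {k : Y → Y → ℝ≥0∞} (hk : Measurable (Function.uncurry k))
    (hsymm : ∀ x z, k x z = k z x) (ν : Measure Y) [SFinite ν] {f g : Y → ℝ} (hf : Measurable f)
    (hg : Measurable g) (hf0 : ∀ x, 0 ≤ f x) (hg0 : ∀ x, 0 ≤ g x) {a b : ℝ} (ha : 0 ≤ a) (hb : 0 ≤ b) :
    densEnergy k ν (fun x => a * f x + b * g x) (fun x => a * f x + b * g x)
      = ENNReal.ofReal (a ^ 2) * densEnergy k ν f f + ENNReal.ofReal (2 * a * b) * densEnergy k ν f g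
        + ENNReal.ofReal (b ^ 2) * densEnergy k ν g g := by
  have hk' : Measurable (fun p : Y × Y => k p.1 p.2) := hk
  have e : ENNReal.ofReal (2 * a * b) * densEnergy k ν f g
      = ENNReal.ofReal (a * b) * densEnergy k ν f g + ENNReal.ofReal (a * b) * densEnergy k ν g f := by
    rw [← densEnergy_comm hk hsymm ν hf hg, ← add_mul, ← ENNReal.ofReal_add (by positivity) (by positivity)]
    ring_nf
  rw [e]
  unfold densEnergy
  rw [← lintegral_const_mul _ (by fun_prop), ← lintegral_const_mul _ (by fun_prop),
    ← lintegral_const_mul _ (by fun_prop), ← lintegral_const_mul _ (by fun_prop),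
    ← lintegral_add_left (by fun_prop), ← lintegral_add_left (by fun_prop),
    ← lintegral_add_left (by fun_prop)]
  refine lintegral_congr fun p => ?_
  have h1 : ∀ x, ENNReal.ofReal (a * f x + b * g x)
      = ENNReal.ofReal a * ENNReal.ofReal (f x) + ENNReal.ofReal b * ENNReal.ofReal (g x) := fun x => by
    rw [ENNReal.ofReal_add (mul_nonneg ha (hf0 x)) (mul_nonneg hb (hg0 x)), ENNReal.ofReal_mul ha,
      ENNReal.ofReal_mul hb]
  rw [h1, h1, ENNReal.ofReal_pow ha, ENNReal.ofReal_pow hb, ENNReal.ofReal_mul ha]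
  ring

lemma densEnergy_le_mul {k : Y → Y → ℝ≥0∞} (ν : Measure Y) {f g : Y → ℝ} {C : ℝ}
    (hgC : ∀ x, g x ≤ C) :
    densEnergy k ν f g ≤ ENNReal.ofReal C * densEnergy k ν f (fun _ => 1) := by
  unfold densEnergy
  rw [← lintegral_const_mul' _ _ ENNReal.ofReal_ne_top]
  refine lintegral_mono fun p => ?_
  calc _ ≤ k p.1 p.2 * ENNReal.ofReal (f p.1) * ENNReal.ofReal C := by gcongr; exact hgC _
    _ = _ := by rw [ENNReal.ofReal_one]; ring

/-- With `densEnergy_le_mul`, this makes the mutual energy of any density with a bounded one finite,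
even if the former has infinite self-energy. -/
lemma densEnergy_one_le {k : Y → Y → ℝ≥0∞} (hk : Measurable (Function.uncurry k))
    (ν : Measure Y) [SFinite ν] {K : ℝ≥0∞} (hK : ∀ x, ∫⁻ z, k x z ∂ν ≤ K) {f : Y → ℝ}
    (hf : IsDensity ν f) : densEnergy k ν f (fun _ => 1) ≤ K := by
  rw [densEnergy_eq_lintegral_densPotential hk ν hf.meas measurable_const]
  calc _ ≤ ∫⁻ x, K * ENNReal.ofReal (f x) ∂ν := by
        refine lintegral_mono fun x => ?_
        gcongr
        simpa [densPotential] using hK x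
    _ = K := by
        have := hf.meas
        rw [lintegral_const_mul _ (by fun_prop), hf.lintegral_eq, mul_one]

lemma entropy_ne_top_iff {ν : Measure Y} {f : Y → ℝ} (hm : Measurable f) (h0 : ∀ x, 0 ≤ f x) :
    entropy ν f ≠ ⊤ ↔ Integrable (fun x => klFun (f x)) ν := by
  unfold entropy
  rw [← lt_top_iff_ne_top, ← hasFiniteIntegral_iff_ofReal (ae_of_all _ fun x => klFun_nonneg (h0 x))]
  exact ⟨fun h => ⟨(measurable_klFun.comp hm).aestronglyMeasurable, h⟩, fun h => h.2⟩

lemma toReal_entropy {ν : Measure Y} {f : Y → ℝ} (hm : Measurable f) (h0 : ∀ x, 0 ≤ f x) :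
    (entropy ν f).toReal = ∫ x, klFun (f x) ∂ν :=
  (integral_eq_lintegral_of_nonneg_ae (ae_of_all _ fun x => klFun_nonneg (h0 x))
    (measurable_klFun.comp hm).aestronglyMeasurable).symm

/-- Entropy balance against a density of Gibbs type `exp (-γ W) / Z`. -/
lemma integral_relEnt_eq {ν : Measure Y} {f g W : Y → ℝ} {γ Z : ℝ} (hZ : 0 < Z)
    (hf : IsDensity ν f) (hg : IsDensity ν g) (hgW : ∀ x, g x = Real.exp (-γ * W x) / Z)
    (hef : Integrable (fun x => klFun (f x)) ν) (heg : Integrable (fun x => klFun (g x)) ν)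
    (hWf : Integrable (fun x => W x * f x) ν) (hWg : Integrable (fun x => W x * g x) ν) :
    Integrable (fun x => relEnt (f x) (g x)) ν ∧
    ∫ x, relEnt (f x) (g x) ∂ν = ∫ x, klFun (f x) ∂ν - ∫ x, klFun (g x) ∂ν
      + γ * (∫ x, W x * f x ∂ν - ∫ x, W x * g x ∂ν) := by
  -- As `log g = -γW - log Z`, the difference of the entropies is linear in `f - g`; the `log Z`
  -- term integrates to zero because both masses are one.
  have e : (fun x => relEnt (f x) (g x)) = fun x => klFun (f x) - klFun (g x)
      + γ * (W x * f x - W x * g x) + Real.log Z * (f x - g x) := by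
    funext x
    have h1 : Real.log (g x) = -γ * W x - Real.log Z := by
      rw [hgW, Real.log_div (Real.exp_ne_zero _) hZ.ne', Real.log_exp]
    unfold relEnt klFun
    rw [h1]; ring
  rw [e]
  have i1 := (hef.sub heg).add ((hWf.sub hWg).const_mul γ)
  have i2 := (hf.integrable.sub hg.integrable).const_mul (Real.log Z)
  refine ⟨i1.add i2, ?_⟩
  rw [integral_add (by exact i1) (by exact i2), integral_add (by exact hef.sub heg)
    (by exact (hWf.sub hWg).const_mul γ), integral_sub hef heg, integral_const_mul,
    integral_const_mul, integral_sub hWf hWg, integral_sub hf.integrable hg.integrable,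
    hf.integral_eq, hg.integral_eq]
  ring

lemma integrable_densPotential_mul {k : Y → Y → ℝ≥0∞} (hk : Measurable (Function.uncurry k))
    (ν : Measure Y) [SFinite ν] {f g : Y → ℝ} (hf : Measurable f) (hg : Measurable g)
    (hf0 : ∀ x, 0 ≤ f x) (h : densEnergy k ν f g ≠ ⊤) (hae : ∀ᵐ x ∂ν, densPotential k ν g x ≠ ⊤) :
    Integrable (fun x => (densPotential k ν g x).toReal * f x) ν ∧
    ∫ x, (densPotential k ν g x).toReal * f x ∂ν = (densEnergy k ν f g).toReal := by
  have hm := measurable_densPotential hk ν hg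
  have hmm : Measurable (fun x => (densPotential k ν g x).toReal * f x) := hm.ennreal_toReal.mul hf
  have e : ∫⁻ x, ENNReal.ofReal ((densPotential k ν g x).toReal * f x) ∂ν = densEnergy k ν f g := by
    rw [densEnergy_eq_lintegral_densPotential hk ν hf hg]
    refine lintegral_congr_ae ?_
    filter_upwards [hae] with x hx
    rw [ENNReal.ofReal_mul ENNReal.toReal_nonneg, ENNReal.ofReal_toReal hx]
  have h0 : ∀ x, 0 ≤ (densPotential k ν g x).toReal * f x :=
    fun x => mul_nonneg ENNReal.toReal_nonneg (hf0 x)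
  refine ⟨⟨hmm.aestronglyMeasurable, ?_⟩, ?_⟩
  · rw [hasFiniteIntegral_iff_ofReal (ae_of_all _ h0), e]
    exact h.lt_top
  · rw [integral_eq_lintegral_of_nonneg_ae (ae_of_all _ h0) hmm.aestronglyMeasurable, e]

end LogGas

end

/-! ### Existence of a minimizer by the direct method in Hellinger distance -/

noncomputable section

namespace LogGas

open InformationTheory

variable {Y : Type*} [MeasurableSpace Y]

/-- The kernel is nonnegative definite on densities of finite entropy. -/
def PosDefOnDensities (k : Y → Y → ℝ≥0∞) (ν : Measure Y) : Prop :=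
  ∀ f g : Y → ℝ, IsDensity ν f → IsDensity ν g → entropy ν f ≠ ⊤ → entropy ν g ≠ ⊤ →
    2 * densEnergy k ν f g ≤ densEnergy k ν f f + densEnergy k ν g g

lemma ofReal_half : ENNReal.ofReal (1 / 2) = 2⁻¹ := by
  rw [one_div, ENNReal.ofReal_inv_of_pos (by norm_num)]; simp

lemma entropy_midpoint_le {ν : Measure Y} {f g : Y → ℝ} (hf : IsDensity ν f) (hg : IsDensity ν g) :
    entropy ν (fun x => 1 / 2 * f x + 1 / 2 * g x)
      + 4⁻¹ * ∫⁻ x, ENNReal.ofReal ((√(f x) - √(g x)) ^ 2) ∂ν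
      ≤ 2⁻¹ * entropy ν f + 2⁻¹ * entropy ν g := by
  have h1 := hf.meas
  have h2 := hg.meas
  have h3 := measurable_klFun
  unfold entropy
  rw [← lintegral_const_mul _ (by fun_prop), ← lintegral_const_mul _ (by fun_prop),
    ← lintegral_const_mul _ (by fun_prop), ← lintegral_add_left (by fun_prop),
    ← lintegral_add_left (by fun_prop)]
  refine lintegral_mono fun x => ?_
  beta_reduce
  rw [show (4⁻¹ : ℝ≥0∞) = ENNReal.ofReal (1 / 4) by
      rw [one_div, ENNReal.ofReal_inv_of_pos (by norm_num)]; simp, ← ofReal_half,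
    ← ENNReal.ofReal_mul (by norm_num), ← ENNReal.ofReal_mul (by norm_num),
    ← ENNReal.ofReal_mul (by norm_num),
    ← ENNReal.ofReal_add (mul_nonneg (by norm_num) (klFun_nonneg (hf.nonneg x)))
      (mul_nonneg (by norm_num) (klFun_nonneg (hg.nonneg x))),
    ← ENNReal.ofReal_add (klFun_nonneg (by linarith [hf.nonneg x, hg.nonneg x])) (by positivity)]
  refine ENNReal.ofReal_le_ofReal ?_
  have := klFun_midpoint_le (hf.nonneg x) (hg.nonneg x)
  rw [show 1 / 2 * f x + 1 / 2 * g x = (f x + g x) / 2 by ring]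
  linarith

/-- Positive definiteness bounds the cross term of the quadratic expansion by the mean of the
diagonal terms, which is convexity. -/
lemma densEnergy_midpoint_le {k : Y → Y → ℝ≥0∞} (hk : Measurable (Function.uncurry k))
    (hsymm : ∀ x z, k x z = k z x) {ν : Measure Y} [SFinite ν] (hpd : PosDefOnDensities k ν)
    {f g : Y → ℝ} (hf : IsDensity ν f) (hg : IsDensity ν g) (hef : entropy ν f ≠ ⊤)
    (heg : entropy ν g ≠ ⊤) :
    densEnergy k ν (fun x => 1 / 2 * f x + 1 / 2 * g x) (fun x => 1 / 2 * f x + 1 / 2 * g x)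
      ≤ 2⁻¹ * densEnergy k ν f f + 2⁻¹ * densEnergy k ν g g := by
  rw [densEnergy_combination hk hsymm ν hf.meas hg.meas hf.nonneg hg.nonneg (by norm_num) (by norm_num)]
  have e4 : ENNReal.ofReal ((1 / 2) ^ 2) = 2⁻¹ * 2⁻¹ := by
    rw [ENNReal.ofReal_pow (by norm_num), ofReal_half, sq]
  have e2 : ENNReal.ofReal (2 * (1 / 2) * (1 / 2)) = 2⁻¹ * 2⁻¹ * 2 := by
    rw [mul_assoc (2⁻¹ : ℝ≥0∞), ENNReal.inv_mul_cancel (by simp) (by simp), mul_one, ← ofReal_half]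
    norm_num
  rw [e4, e2, mul_assoc (2⁻¹ * 2⁻¹) 2]
  set A := densEnergy k ν f f
  set B := densEnergy k ν g g
  calc 2⁻¹ * 2⁻¹ * A + 2⁻¹ * 2⁻¹ * (2 * densEnergy k ν f g) + 2⁻¹ * 2⁻¹ * B
      ≤ 2⁻¹ * 2⁻¹ * A + 2⁻¹ * 2⁻¹ * (A + B) + 2⁻¹ * 2⁻¹ * B := by
        gcongr; exact hpd f g hf hg hef heg
    _ = (2⁻¹ * 2) * (2⁻¹ * A + 2⁻¹ * B) := by ring
    _ = _ := by rw [ENNReal.inv_mul_cancel (by simp) (by simp), one_mul]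

/-- Two almost minimizers of the free energy are close in Hellinger distance. -/
lemma lintegral_sqrt_sub_sq_le {k : Y → Y → ℝ≥0∞} (hk : Measurable (Function.uncurry k))
    (hsymm : ∀ x z, k x z = k z x) {ν : Measure Y} [SFinite ν] (hpd : PosDefOnDensities k ν)
    {γ : ℝ} {I δ : ℝ≥0∞} (hI : I ≠ ⊤) (hδ : δ ≠ ⊤)
    (hmin : ∀ f, IsDensity ν f → I ≤ densFreeEnergy k γ ν f)
    {f g : Y → ℝ} (hf : IsDensity ν f) (hg : IsDensity ν g)
    (hFf : densFreeEnergy k γ ν f ≤ I + δ) (hFg : densFreeEnergy k γ ν g ≤ I + δ) :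
    ∫⁻ x, ENNReal.ofReal ((√(f x) - √(g x)) ^ 2) ∂ν ≤ 4 * δ := by
  have hef : entropy ν f ≠ ⊤ :=
    ne_top_of_le_ne_top (ENNReal.add_ne_top.2 ⟨hI, hδ⟩) (le_add_self.trans hFf)
  have heg : entropy ν g ≠ ⊤ :=
    ne_top_of_le_ne_top (ENNReal.add_ne_top.2 ⟨hI, hδ⟩) (le_add_self.trans hFg)
  have hh := hmin _ (hf.combination hg (a := 1 / 2) (b := 1 / 2) (by norm_num) (by norm_num) (by norm_num))
  have h1 := entropy_midpoint_le hf hg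
  have h2 := densEnergy_midpoint_le hk hsymm hpd hf hg hef heg
  set D := ∫⁻ x, ENNReal.ofReal ((√(f x) - √(g x)) ^ 2) ∂ν
  -- The midpoint is a competitor, so its energy is at least `I`; the convexity gain `D/4` must fit
  -- into the slack `δ`.
  have h3 : I + 4⁻¹ * D ≤ I + δ := by
    calc I + 4⁻¹ * D ≤ densFreeEnergy k γ ν (fun x => 1 / 2 * f x + 1 / 2 * g x) + 4⁻¹ * D := by gcongr
      _ ≤ ENNReal.ofReal (γ / 2) * (2⁻¹ * densEnergy k ν f f + 2⁻¹ * densEnergy k ν g g)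
          + (2⁻¹ * entropy ν f + 2⁻¹ * entropy ν g) := by
          unfold densFreeEnergy
          rw [add_assoc]
          gcongr
      _ = 2⁻¹ * densFreeEnergy k γ ν f + 2⁻¹ * densFreeEnergy k γ ν g := by
          unfold densFreeEnergy; ring
      _ ≤ 2⁻¹ * (I + δ) + 2⁻¹ * (I + δ) := by gcongr
      _ = I + δ := by rw [← add_mul, ENNReal.inv_two_add_inv_two, one_mul]
  have h4 : 4⁻¹ * D ≤ δ := (ENNReal.add_le_add_iff_left hI).1 h3
  calc D = 4 * (4⁻¹ * D) := by
        rw [← mul_assoc, ENNReal.mul_inv_cancel (by simp) (by simp), one_mul]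
    _ ≤ 4 * δ := by gcongr

/-- A single integral of a nonnegative function, in the form required by Fatou's lemma. -/
lemma densFreeEnergy_eq_lintegral_prod {k : Y → Y → ℝ≥0∞} (hk : Measurable (Function.uncurry k))
    (γ : ℝ) (ν : Measure Y) [IsProbabilityMeasure ν] {f : Y → ℝ} (hf : Measurable f) :
    densFreeEnergy k γ ν f = ∫⁻ p, (ENNReal.ofReal (γ / 2)
      * (k p.1 p.2 * ENNReal.ofReal (f p.1) * ENNReal.ofReal (f p.2))
      + ENNReal.ofReal (klFun (f p.1))) ∂(ν.prod ν) := by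
  have hk' : Measurable (fun p : Y × Y => k p.1 p.2) := hk
  have h3 := measurable_klFun
  unfold densFreeEnergy densEnergy entropy
  rw [lintegral_add_left (by fun_prop), lintegral_const_mul _ (by fun_prop)]
  congr 1
  exact ((measurePreserving_fst (μ := ν) (ν := ν)).lintegral_comp (by fun_prop)).symm

/-- Lower semicontinuity of the free energy along almost everywhere convergent sequences. -/
lemma densFreeEnergy_le_of_tendsto {k : Y → Y → ℝ≥0∞} (hk : Measurable (Function.uncurry k))
    (hktop : ∀ x z, k x z ≠ ⊤) (γ : ℝ) (ν : Measure Y) [IsProbabilityMeasure ν] {f : Y → ℝ}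
    {F : ℕ → Y → ℝ} (hf : Measurable f) (hF : ∀ m, Measurable (F m))
    (hlim : ∀ᵐ x ∂ν, Tendsto (fun m => F m x) atTop (𝓝 (f x))) {I : ℝ≥0∞}
    (hI : Tendsto (fun m => densFreeEnergy k γ ν (F m)) atTop (𝓝 I)) :
    densFreeEnergy k γ ν f ≤ I := by
  have hk' : Measurable (fun p : Y × Y => k p.1 p.2) := hk
  have h3 := measurable_klFun
  rw [← hI.liminf_eq, densFreeEnergy_eq_lintegral_prod hk γ ν hf]
  have e : ∀ m, densFreeEnergy k γ ν (F m) = _ := fun m =>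
    densFreeEnergy_eq_lintegral_prod hk γ ν (hF m)
  simp_rw [e]
  refine le_trans (lintegral_mono_ae ?_) (lintegral_liminf_le fun m => ?_)
  · have l1 : ∀ᵐ p ∂(ν.prod ν), Tendsto (fun m => F m p.1) atTop (𝓝 (f p.1)) :=
      (measurePreserving_fst (μ := ν) (ν := ν)).quasiMeasurePreserving.ae hlim
    have l2 : ∀ᵐ p ∂(ν.prod ν), Tendsto (fun m => F m p.2) atTop (𝓝 (f p.2)) :=
      (measurePreserving_snd (μ := ν) (ν := ν)).quasiMeasurePreserving.ae hlim
    filter_upwards [l1, l2] with p h1 h2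
    refine (Tendsto.liminf_eq ?_).ge
    have t1 := ENNReal.tendsto_ofReal h1
    have t2 := ENNReal.tendsto_ofReal h2
    have t3 := ENNReal.tendsto_ofReal ((continuous_klFun.tendsto _).comp h1)
    refine Tendsto.add (ENNReal.Tendsto.const_mul ?_ (Or.inr ENNReal.ofReal_ne_top)) t3
    refine ENNReal.Tendsto.mul ?_ (Or.inr ENNReal.ofReal_ne_top) t2
      (Or.inr (ENNReal.mul_ne_top (hktop _ _) ENNReal.ofReal_ne_top))
    exact ENNReal.Tendsto.const_mul t1 (Or.inr (hktop _ _))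
  · have := hF m
    fun_prop

lemma eLpNorm_two_sq {ν : Measure Y} (u : Y → ℝ) :
    eLpNorm u 2 ν ^ 2 = ∫⁻ x, ENNReal.ofReal (u x ^ 2) ∂ν := by
  rw [eLpNorm_eq_lintegral_rpow_enorm_toReal (by simp) (by simp)]
  simp only [ENNReal.toReal_ofNat, one_div]
  rw [← ENNReal.rpow_natCast, ← ENNReal.rpow_mul]
  norm_num
  refine lintegral_congr fun x => ?_
  rw [Real.enorm_eq_ofReal_abs, ← ENNReal.ofReal_pow (abs_nonneg _), sq_abs]

lemma IsDensity.eLpNorm_sqrt {ν : Measure Y} {f : Y → ℝ} (hf : IsDensity ν f) :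
    eLpNorm (fun x => √(f x)) 2 ν = 1 := by
  have h := eLpNorm_two_sq (ν := ν) (fun x => √(f x))
  simp_rw [Real.sq_sqrt (hf.nonneg _)] at h
  rw [hf.lintegral_eq] at h
  have h2 := congrArg (fun y : ℝ≥0∞ => y ^ (1 / 2 : ℝ)) h
  beta_reduce at h2
  rw [← ENNReal.rpow_natCast, ← ENNReal.rpow_mul, ENNReal.one_rpow] at h2
  norm_num at h2
  exact h2

/-- Existence of a minimizer of the free energy among densities. -/
lemma exists_minimizer {k : Y → Y → ℝ≥0∞} (hk : Measurable (Function.uncurry k))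
    (hsymm : ∀ x z, k x z = k z x) (hktop : ∀ x z, k x z ≠ ⊤) {ν : Measure Y} [IsProbabilityMeasure ν]
    (hpd : PosDefOnDensities k ν) {γ : ℝ} (hfin : ∃ f, IsDensity ν f ∧ densFreeEnergy k γ ν f ≠ ⊤) :
    ∃ f, IsDensity ν f ∧ ∀ g, IsDensity ν g → densFreeEnergy k γ ν f ≤ densFreeEnergy k γ ν g := by
  set I : ℝ≥0∞ := ⨅ f : {f // IsDensity ν f}, densFreeEnergy k γ ν f with hIdef
  have hmin : ∀ f, IsDensity ν f → I ≤ densFreeEnergy k γ ν f := fun f hf =>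
    iInf_le (fun f : {f // IsDensity ν f} => densFreeEnergy k γ ν f) ⟨f, hf⟩
  have hI : I ≠ ⊤ := by
    obtain ⟨f, hf, hF⟩ := hfin
    exact ne_top_of_le_ne_top hF (hmin f hf)
  -- Chosen so that `4 δ_N = 4^{-N}/4` lies strictly below `(2^{-N})²`: the square roots then form a
  -- Cauchy sequence in `L²` with summable bounds `2^{-N}`.
  set δ : ℕ → ℝ≥0∞ := fun m => (4⁻¹ : ℝ≥0∞) ^ m * 16⁻¹ with hδ
  have hδ0 : ∀ m, δ m ≠ 0 := fun m => mul_ne_zero (pow_ne_zero _ (by simp)) (by simp)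
  have hδt : ∀ m, δ m ≠ ⊤ := fun m => ENNReal.mul_ne_top (ENNReal.pow_ne_top (by simp)) (by simp)
  have hδanti : ∀ m n, m ≤ n → δ n ≤ δ m := fun m n hmn => by
    simp only [hδ]
    gcongr ?_ * _
    exact pow_le_pow_right_of_le_one' (by simp) hmn
  have hex : ∀ m, ∃ f, IsDensity ν f ∧ densFreeEnergy k γ ν f ≤ I + δ m := by
    intro m
    have : I < I + δ m := ENNReal.lt_add_right hI (hδ0 m)
    obtain ⟨⟨f, hf⟩, h⟩ := iInf_lt_iff.1 (hIdef ▸ this)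
    exact ⟨f, hf, h.le⟩
  choose F hF hFle using hex
  have hmem : ∀ m, MemLp (fun x => √(F m x)) 2 ν := fun m =>
    ⟨(hF m).meas.sqrt.aestronglyMeasurable, by rw [(hF m).eLpNorm_sqrt]; simp⟩
  have hcau : ∀ N n m : ℕ, N ≤ n → N ≤ m →
      eLpNorm ((fun x => √(F n x)) - fun x => √(F m x)) 2 ν < (2⁻¹ : ℝ≥0∞) ^ N := by
    intro N n m hn hm
    have h := lintegral_sqrt_sub_sq_le hk hsymm hpd hI (hδt N) hmin (hF n) (hF m)
      ((hFle n).trans (by gcongr; exact hδanti _ _ hn)) ((hFle m).trans (by gcongr; exact hδanti _ _ hm))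
    have e := eLpNorm_two_sq (ν := ν) ((fun x => √(F n x)) - fun x => √(F m x))
    simp only [Pi.sub_apply] at e
    rw [← e] at h
    by_contra hc
    push Not at hc
    have h2 : ((2⁻¹ : ℝ≥0∞) ^ N) ^ 2 ≤ 4 * δ N := (pow_le_pow_left' hc 2).trans h
    have h3 : 4 * δ N = 4⁻¹ * ((2⁻¹ : ℝ≥0∞) ^ N) ^ 2 := by
      simp only [hδ]
      rw [← pow_mul, mul_comm N 2, pow_mul, ← ENNReal.inv_pow (a := 2)]
      have : (16 : ℝ≥0∞)⁻¹ = 4⁻¹ * 4⁻¹ := by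
        rw [← ENNReal.mul_inv (by simp) (by simp)]; norm_num
      rw [this, show (2 : ℝ≥0∞) ^ 2 = 4 by norm_num]
      calc (4 : ℝ≥0∞) * (4⁻¹ ^ N * (4⁻¹ * 4⁻¹)) = (4 * 4⁻¹) * (4⁻¹ * 4⁻¹ ^ N) := by ring
        _ = _ := by rw [ENNReal.mul_inv_cancel (by simp) (by simp), one_mul]
    rw [h3] at h2
    have h4 : ((2⁻¹ : ℝ≥0∞) ^ N) ^ 2 ≠ 0 := pow_ne_zero _ (pow_ne_zero _ (by simp))
    have h5 : ((2⁻¹ : ℝ≥0∞) ^ N) ^ 2 ≠ ⊤ := ENNReal.pow_ne_top (ENNReal.pow_ne_top (by simp))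
    have h6 : (4⁻¹ : ℝ≥0∞) * ((2⁻¹ : ℝ≥0∞) ^ N) ^ 2 < 1 * ((2⁻¹ : ℝ≥0∞) ^ N) ^ 2 := by
      refine (ENNReal.mul_lt_mul_iff_left h4 h5).2 ?_
      rw [ENNReal.inv_lt_one]; norm_num
    rw [one_mul] at h6
    exact absurd h2 (not_le.2 h6)
  obtain ⟨p, hp, hplim⟩ := Lp.cauchy_complete_eLpNorm (by norm_num) hmem
    (B := fun N => (2⁻¹ : ℝ≥0∞) ^ N) (by rw [ENNReal.tsum_geometric]; simp) hcau
  obtain ⟨ns, hns, hae⟩ := (tendstoInMeasure_of_tendsto_eLpNorm (by norm_num)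
    (fun m => (hmem m).1) hp.1 hplim).exists_seq_tendsto_ae
  set q := hp.1.mk p
  have hq : p =ᵐ[ν] q := hp.1.ae_eq_mk
  have hqm : Measurable q := hp.1.stronglyMeasurable_mk.measurable
  -- Each `√F_m` has `L²` norm one, and strong convergence keeps the norm; so no mass escapes in the
  -- limit.
  have hnorm : eLpNorm p 2 ν = 1 := by
    refine le_antisymm ?_ ?_
    · have l : Tendsto (fun m => eLpNorm ((fun x => √(F m x)) - p) 2 ν + 1) atTop (𝓝 (0 + 1)) :=
        hplim.add tendsto_const_nhds
      rw [zero_add] at l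
      refine ge_of_tendsto' l fun m => ?_
      have h := eLpNorm_sub_le (μ := ν) (p := 2) (hmem m).1 ((hmem m).1.sub hp.1) (by norm_num)
      rw [sub_sub_cancel, (hF m).eLpNorm_sqrt, add_comm] at h
      exact h
    · have l : Tendsto (fun m => eLpNorm ((fun x => √(F m x)) - p) 2 ν + eLpNorm p 2 ν) atTop
          (𝓝 (0 + eLpNorm p 2 ν)) := hplim.add tendsto_const_nhds
      rw [zero_add] at l
      refine ge_of_tendsto' l fun m => ?_
      have h := eLpNorm_add_le (μ := ν) (p := 2) ((hmem m).1.sub hp.1) hp.1 (by norm_num)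
      rw [sub_add_cancel, (hF m).eLpNorm_sqrt] at h
      exact h
  -- Squaring the measurable representative `q` gives a density that is nonnegative everywhere,
  -- whatever the sign of `q` on a null set.
  refine ⟨fun x => q x ^ 2, ⟨hqm.pow_const 2, fun x => sq_nonneg _, ?_⟩, ?_⟩
  · rw [← eLpNorm_two_sq, ← eLpNorm_congr_ae hq, hnorm, one_pow]
  · intro g hg
    refine le_trans ?_ (hmin g hg)
    refine densFreeEnergy_le_of_tendsto hk hktop γ ν (hqm.pow_const 2) (fun m => (hF (ns m)).meas) ?_ ?_
    · filter_upwards [hae, hq] with x hx hx'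
      have := hx.pow 2
      rw [hx'] at this
      refine this.congr fun m => ?_
      exact Real.sq_sqrt ((hF (ns m)).nonneg x)
    · have hδlim : Tendsto (fun m => I + δ m) atTop (𝓝 (I + 0 * 16⁻¹)) := by
        refine tendsto_const_nhds.add (ENNReal.Tendsto.mul_const ?_ (Or.inr (by simp)))
        exact ENNReal.tendsto_pow_atTop_nhds_zero_of_lt_one (by rw [ENNReal.inv_lt_one]; norm_num)
      rw [zero_mul, add_zero] at hδlim
      exact tendsto_of_tendsto_of_tendsto_of_le_of_le tendsto_const_nhds
        (hδlim.comp hns.tendsto_atTop) (fun m => hmin _ (hF _)) (fun m => hFle _)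

end LogGas

end

/-! ### The Euler–Lagrange equation and uniqueness of the minimizer -/

noncomputable section

namespace LogGas

open InformationTheory

variable {Y : Type*} [MeasurableSpace Y]

/-- `g` is a self-consistent density: `g = exp (-γ W_g) / Z`. -/
structure IsGibbsDensity (k : Y → Y → ℝ≥0∞) (γ : ℝ) (ν : Measure Y) (g : Y → ℝ) (Z : ℝ) : Prop where
  dens : IsDensity ν g
  pos : 0 < Z
  eq : ∀ x, g x = Real.exp (-γ * (densPotential k ν g x).toReal) / Z

lemma entropy_combination_le {ν : Measure Y} {f g : Y → ℝ} (hf : IsDensity ν f) (hg : IsDensity ν g)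
    {a b : ℝ} (ha : 0 ≤ a) (hb : 0 ≤ b) (hab : a + b = 1) :
    entropy ν (fun x => a * f x + b * g x)
      ≤ ENNReal.ofReal a * entropy ν f + ENNReal.ofReal b * entropy ν g := by
  have h1 := hf.meas
  have h2 := hg.meas
  have h3 := measurable_klFun
  unfold entropy
  rw [← lintegral_const_mul _ (by fun_prop), ← lintegral_const_mul _ (by fun_prop),
    ← lintegral_add_left (by fun_prop)]
  refine lintegral_mono fun x => ?_
  beta_reduce
  rw [← ENNReal.ofReal_mul ha, ← ENNReal.ofReal_mul hb,
    ← ENNReal.ofReal_add (mul_nonneg ha (klFun_nonneg (hf.nonneg x)))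
      (mul_nonneg hb (klFun_nonneg (hg.nonneg x)))]
  exact ENNReal.ofReal_le_ofReal (convexOn_klFun.2 (hf.nonneg x) (hg.nonneg x) ha hb hab)

lemma integrable_klFun_of_le {ν : Measure Y} [IsFiniteMeasure ν] {g : Y → ℝ} (hm : Measurable g)
    (h0 : ∀ x, 0 ≤ g x) {C : ℝ} (hC : ∀ x, g x ≤ C) : Integrable (fun x => klFun (g x)) ν := by
  obtain ⟨B, hB⟩ := (isCompact_Icc (a := (0 : ℝ)) (b := C)).exists_bound_of_continuousOn
    continuous_klFun.continuousOn
  exact Integrable.of_bound (measurable_klFun.comp hm).aestronglyMeasurable B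
    (ae_of_all _ fun x => hB _ ⟨h0 x, hC x⟩)

lemma nonneg_of_forall_nonneg_add_mul {p q : ℝ}
    (h : ∀ ε : ℝ, 0 < ε → ε < 1 → 0 ≤ p + ε * q) : 0 ≤ p := by
  have l : Tendsto (fun ε : ℝ => p + ε * q) (𝓝[>] 0) (𝓝 (p + 0 * q)) :=
    (tendsto_const_nhds.add (tendsto_id.mul_const q)).mono_left nhdsWithin_le_nhds
  rw [zero_mul, add_zero] at l
  refine ge_of_tendsto l ?_
  filter_upwards [Ioo_mem_nhdsGT (zero_lt_one' ℝ)] with ε hε using h ε hε.1 hε.2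

lemma densPotential_congr {k : Y → Y → ℝ≥0∞} {ν : Measure Y} {f g : Y → ℝ} (h : f =ᵐ[ν] g) :
    densPotential k ν f = densPotential k ν g := by
  funext x
  unfold densPotential
  refine lintegral_congr_ae ?_
  filter_upwards [h] with z hz
  rw [hz]

/-- By symmetry, the mean of the potential of `f` is the mean under `f` of the potential of the
constant density, which is at most `K`. -/
lemma ae_densPotential_ne_top {k : Y → Y → ℝ≥0∞} (hk : Measurable (Function.uncurry k))
    (hsymm : ∀ x z, k x z = k z x) {ν : Measure Y} [IsProbabilityMeasure ν] {K : ℝ≥0}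
    (hK : ∀ x, ∫⁻ z, k x z ∂ν ≤ K) {f : Y → ℝ} (hf : IsDensity ν f) :
    ∀ᵐ x ∂ν, densPotential k ν f x ≠ ⊤ := by
  have h1 : ∫⁻ x, densPotential k ν f x ∂ν ≠ ⊤ := by
    have e := densEnergy_eq_lintegral_densPotential hk ν (f := fun _ => 1) measurable_const hf.meas
    simp only [ENNReal.ofReal_one, mul_one] at e
    rw [← e, densEnergy_comm hk hsymm ν measurable_const hf.meas]
    exact ne_top_of_le_ne_top ENNReal.coe_ne_top (densEnergy_one_le hk ν hK hf)
  filter_upwards [ae_lt_top (measurable_densPotential hk ν hf.meas) h1] with x hx using hx.ne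

lemma isDensity_one (ν : Measure Y) [IsProbabilityMeasure ν] : IsDensity ν (fun _ => (1 : ℝ)) :=
  ⟨measurable_const, fun _ => zero_le_one, by simp⟩

/-- Existence of a self-consistent density. -/
theorem exists_isGibbsDensity {k : Y → Y → ℝ≥0∞} (hk : Measurable (Function.uncurry k))
    (hsymm : ∀ x z, k x z = k z x) (hktop : ∀ x z, k x z ≠ ⊤) {ν : Measure Y} [IsProbabilityMeasure ν]
    {K : ℝ≥0} (hK : ∀ x, ∫⁻ z, k x z ∂ν ≤ K) (hpd : PosDefOnDensities k ν) {γ : ℝ} (hγ : 0 ≤ γ) :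
    ∃ g Z, IsGibbsDensity k γ ν g Z := by
  -- For `γ = 0` a finite free energy does not control the interaction energy, but the constant
  -- density is an explicit solution.
  rcases hγ.eq_or_lt with h0 | hγ
  · exact ⟨fun _ => 1, 1, isDensity_one ν, one_pos, by simp [← h0]⟩
  have h1 := isDensity_one ν
  have hone : densEnergy k ν (fun _ => 1) (fun _ => 1) ≠ ⊤ :=
    ne_top_of_le_ne_top ENNReal.coe_ne_top (densEnergy_one_le hk ν hK h1)
  have hFone : densFreeEnergy k γ ν (fun _ => 1) ≠ ⊤ := by
    unfold densFreeEnergy entropy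
    simp only [klFun_one, ENNReal.ofReal_zero, lintegral_zero, add_zero]
    exact ENNReal.mul_ne_top ENNReal.ofReal_ne_top hone
  obtain ⟨f, hf, hmin⟩ := exists_minimizer hk hsymm hktop hpd ⟨_, h1, hFone⟩
  have hFf : densFreeEnergy k γ ν f ≠ ⊤ := ne_top_of_le_ne_top hFone (hmin _ h1)
  have hentf : entropy ν f ≠ ⊤ := ne_top_of_le_ne_top hFf le_add_self
  have hff : densEnergy k ν f f ≠ ⊤ := by
    intro hc
    refine hFf ?_
    unfold densFreeEnergy
    rw [hc, ENNReal.mul_top (by simpa using hγ), top_add]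
  set W : Y → ℝ := fun x => (densPotential k ν f x).toReal with hW
  have hWm : Measurable W := (measurable_densPotential hk ν hf.meas).ennreal_toReal
  have hW0 : ∀ x, 0 ≤ W x := fun x => ENNReal.toReal_nonneg
  have hexp1 : ∀ x, Real.exp (-γ * W x) ≤ 1 := fun x => by
    rw [Real.exp_le_one_iff]; nlinarith [mul_nonneg hγ.le (hW0 x)]
  have hintegr : Integrable (fun x => Real.exp (-γ * W x)) ν :=
    Integrable.of_bound (by fun_prop) 1 (ae_of_all _ fun x => by
      rw [Real.norm_of_nonneg (Real.exp_pos _).le]; exact hexp1 x)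
  set Z := ∫ x, Real.exp (-γ * W x) ∂ν with hZdef
  have hZ : 0 < Z := integral_exp_pos hintegr
  -- The Gibbs density in the potential of the minimizer `f`. It is bounded, so all its energies are
  -- finite; the aim is `f = g` almost everywhere.
  set g : Y → ℝ := fun x => Real.exp (-γ * W x) / Z with hgdef
  have hg : IsDensity ν g := by
    refine isDensity_of_integral_eq_one (by fun_prop) (fun x => by positivity) ?_
    simp only [hgdef]
    rw [integral_div, ← hZdef, div_self hZ.ne']
  have hgle : ∀ x, g x ≤ 1 / Z := fun x => by
    simp only [hgdef]; gcongr; exact hexp1 x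
  have hgpos : ∀ x, 0 < g x := fun x => by simp only [hgdef]; positivity
  have hfg : densEnergy k ν f g ≠ ⊤ := ne_top_of_le_ne_top
    (ENNReal.mul_ne_top ENNReal.ofReal_ne_top ENNReal.coe_ne_top)
    ((densEnergy_le_mul ν hgle).trans (mul_le_mul_right (densEnergy_one_le hk ν hK hf) _))
  have hgg : densEnergy k ν g g ≠ ⊤ := ne_top_of_le_ne_top
    (ENNReal.mul_ne_top ENNReal.ofReal_ne_top ENNReal.coe_ne_top)
    ((densEnergy_le_mul ν hgle).trans (mul_le_mul_right (densEnergy_one_le hk ν hK hg) _))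
  have hkg := integrable_klFun_of_le (ν := ν) hg.meas hg.nonneg hgle
  have hkf := (entropy_ne_top_iff hf.meas hf.nonneg).1 hentf
  have hentg : entropy ν g ≠ ⊤ := (entropy_ne_top_iff hg.meas hg.nonneg).2 hkg
  have hae := ae_densPotential_ne_top hk hsymm hK hf
  obtain ⟨iWf, eWf⟩ := integrable_densPotential_mul hk ν hf.meas hf.meas hf.nonneg hff hae
  obtain ⟨iWg, eWg⟩ := integrable_densPotential_mul hk ν hg.meas hf.meas hg.nonneg
    (by rwa [densEnergy_comm hk hsymm ν hg.meas hf.meas]) hae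
  rw [densEnergy_comm hk hsymm ν hg.meas hf.meas] at eWg
  obtain ⟨irel, erel⟩ := integral_relEnt_eq hZ hf hg (fun x => rfl) hkf hkg iWf iWg
  rw [eWf, eWg, ← toReal_entropy hf.meas hf.nonneg, ← toReal_entropy hg.meas hg.nonneg] at erel
  -- Minimality of `f` against `(1-ε)f + εg`, with the entropy bounded by convexity: the increment
  -- is `ε` times this expression.
  have hvar : ∀ ε : ℝ, 0 < ε → ε < 1 →
      0 ≤ (γ * ((densEnergy k ν f g).toReal - (densEnergy k ν f f).toReal)
          + ((entropy ν g).toReal - (entropy ν f).toReal))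
        + ε * (γ / 2 * ((densEnergy k ν f f).toReal - 2 * (densEnergy k ν f g).toReal
          + (densEnergy k ν g g).toReal)) := by
    intro ε h0 h1
    have hm := hmin _ (hf.combination hg (a := 1 - ε) (b := ε) (by linarith) h0.le (by ring))
    have hc := entropy_combination_le hf hg (a := 1 - ε) (b := ε) (by linarith) h0.le (by ring)
    have hm2 := hm.trans (add_le_add_right hc _)
    rw [densEnergy_combination hk hsymm ν hf.meas hg.meas hf.nonneg hg.nonneg (by linarith) h0.le] at hm2
    unfold densFreeEnergy at hm2
    rw [← ENNReal.ofReal_toReal hff, ← ENNReal.ofReal_toReal hfg, ← ENNReal.ofReal_toReal hgg,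
      ← ENNReal.ofReal_toReal hentf, ← ENNReal.ofReal_toReal hentg] at hm2
    set a := (densEnergy k ν f f).toReal
    set b := (densEnergy k ν f g).toReal
    set c := (densEnergy k ν g g).toReal
    set e := (entropy ν f).toReal
    set e' := (entropy ν g).toReal
    have ha : 0 ≤ a := ENNReal.toReal_nonneg
    have hb : 0 ≤ b := ENNReal.toReal_nonneg
    have hc' : 0 ≤ c := ENNReal.toReal_nonneg
    have he : 0 ≤ e := ENNReal.toReal_nonneg
    have he' : 0 ≤ e' := ENNReal.toReal_nonneg
    have h1' : 0 ≤ 1 - ε := by linarith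
    rw [← ENNReal.ofReal_mul (by positivity), ← ENNReal.ofReal_add (by positivity) he,
      ← ENNReal.ofReal_mul (by positivity), ← ENNReal.ofReal_mul (by positivity),
      ← ENNReal.ofReal_mul (by positivity), ← ENNReal.ofReal_mul h1', ← ENNReal.ofReal_mul h0.le,
      ← ENNReal.ofReal_add (by positivity) (by positivity),
      ← ENNReal.ofReal_add (by positivity) (by positivity), ← ENNReal.ofReal_mul (by positivity),
      ← ENNReal.ofReal_add (by positivity) (by positivity),
      ← ENNReal.ofReal_add (by positivity) (by positivity),
      ENNReal.ofReal_le_ofReal_iff (by positivity)] at hm2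
    have : 0 ≤ ε * ((γ * (b - a) + (e' - e)) + ε * (γ / 2 * (a - 2 * b + c))) := by
      nlinarith
    exact nonneg_of_mul_nonneg_right this h0
  have hEL := nonneg_of_forall_nonneg_add_mul hvar
  -- The first-order term is exactly minus the relative entropy of `f` with respect to `g`, which
  -- therefore has to vanish.
  have hle : ∫ x, relEnt (f x) (g x) ∂ν ≤ 0 := by rw [erel]; linarith
  have hz : (fun x => relEnt (f x) (g x)) =ᵐ[ν] 0 :=
    (integral_eq_zero_iff_of_nonneg (fun x => relEnt_nonneg (hf.nonneg x) (hgpos x)) irel).1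
      (le_antisymm hle (integral_nonneg fun x => relEnt_nonneg (hf.nonneg x) (hgpos x)))
  have hfg' : f =ᵐ[ν] g := by
    filter_upwards [hz] with x hx using eq_of_relEnt_eq_zero (hf.nonneg x) (hgpos x) hx
  exact ⟨g, Z, hg, hZ, fun x => by rw [← densPotential_congr hfg']⟩

/-- A self-consistent density is the unique minimizer of the free energy. -/
theorem IsGibbsDensity.densFreeEnergy_lt {k : Y → Y → ℝ≥0∞} (hk : Measurable (Function.uncurry k))
    (hsymm : ∀ x z, k x z = k z x) {ν : Measure Y} [IsProbabilityMeasure ν]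
    {K : ℝ≥0} (hK : ∀ x, ∫⁻ z, k x z ∂ν ≤ K) (hpd : PosDefOnDensities k ν) {γ : ℝ} (hγ : 0 ≤ γ)
    {g : Y → ℝ} {Z : ℝ} (hg : IsGibbsDensity k γ ν g Z) :
    densFreeEnergy k γ ν g ≠ ⊤ ∧ ∀ f, IsDensity ν f → ¬ f =ᵐ[ν] g →
      densFreeEnergy k γ ν g < densFreeEnergy k γ ν f := by
  have hZ := hg.pos
  have hgle : ∀ x, g x ≤ 1 / Z := fun x => by
    rw [hg.eq]
    gcongr
    rw [Real.exp_le_one_iff]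
    nlinarith [mul_nonneg hγ (ENNReal.toReal_nonneg (a := densPotential k ν g x))]
  have hgpos : ∀ x, 0 < g x := fun x => by rw [hg.eq]; positivity
  have hfg : ∀ f, IsDensity ν f → densEnergy k ν f g ≠ ⊤ := fun f hf => ne_top_of_le_ne_top
    (ENNReal.mul_ne_top ENNReal.ofReal_ne_top ENNReal.coe_ne_top)
    ((densEnergy_le_mul ν hgle).trans (mul_le_mul_right (densEnergy_one_le hk ν hK hf) _))
  have hgg := hfg g hg.dens
  have hkg := integrable_klFun_of_le (ν := ν) hg.dens.meas hg.dens.nonneg hgle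
  have hentg : entropy ν g ≠ ⊤ := (entropy_ne_top_iff hg.dens.meas hg.dens.nonneg).2 hkg
  have hFg : densFreeEnergy k γ ν g ≠ ⊤ :=
    ENNReal.add_ne_top.2 ⟨ENNReal.mul_ne_top ENNReal.ofReal_ne_top hgg, hentg⟩
  refine ⟨hFg, fun f hf hne => ?_⟩
  by_cases hFf : densFreeEnergy k γ ν f = ⊤
  · rw [hFf]; exact hFg.lt_top
  have hentf : entropy ν f ≠ ⊤ := ne_top_of_le_ne_top hFf le_add_self
  have hkf := (entropy_ne_top_iff hf.meas hf.nonneg).1 hentf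
  have hae := ae_densPotential_ne_top hk hsymm hK hg.dens
  obtain ⟨iWf, eWf⟩ := integrable_densPotential_mul hk ν hf.meas hg.dens.meas hf.nonneg (hfg f hf) hae
  obtain ⟨iWg, eWg⟩ := integrable_densPotential_mul hk ν hg.dens.meas hg.dens.meas hg.dens.nonneg hgg hae
  obtain ⟨irel, erel⟩ := integral_relEnt_eq hZ hf hg.dens hg.eq hkf hkg iWf iWg
  rw [eWf, eWg, ← toReal_entropy hf.meas hf.nonneg,
    ← toReal_entropy hg.dens.meas hg.dens.nonneg] at erel
  have hrelpos : 0 < ∫ x, relEnt (f x) (g x) ∂ν := by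
    refine (integral_nonneg fun x => relEnt_nonneg (hf.nonneg x) (hgpos x)).lt_of_ne fun hc => hne ?_
    have hz := (integral_eq_zero_iff_of_nonneg
      (fun x => relEnt_nonneg (hf.nonneg x) (hgpos x)) irel).1 hc.symm
    filter_upwards [hz] with x hx using eq_of_relEnt_eq_zero (hf.nonneg x) (hgpos x) hx
  rw [← ENNReal.toReal_lt_toReal hFg hFf]
  have expand : ∀ u : Y → ℝ, densFreeEnergy k γ ν u ≠ ⊤ → (densFreeEnergy k γ ν u).toReal
      = γ / 2 * (densEnergy k ν u u).toReal + (entropy ν u).toReal := fun u hu => by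
    unfold densFreeEnergy at hu ⊢
    rw [ENNReal.toReal_add (ENNReal.add_ne_top.1 hu).1 (ENNReal.add_ne_top.1 hu).2, ENNReal.toReal_mul,
      ENNReal.toReal_ofReal (by positivity)]
  rw [expand g hFg, expand f hFf]
  rcases hγ.eq_or_lt with h0 | hγ
  · rw [← h0] at erel ⊢
    linarith
  have hff : densEnergy k ν f f ≠ ⊤ := by
    intro hc
    refine hFf ?_
    unfold densFreeEnergy
    rw [hc, ENNReal.mul_top (by simpa using hγ), top_add]
  -- The free energies of `f` and `g` differ by the relative entropy plus `γ/2` times the energy of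
  -- `f - g`; the former is positive and the latter is nonnegative by this inequality.
  have hp := ENNReal.toReal_mono (ENNReal.add_ne_top.2 ⟨hff, hgg⟩) (hpd f g hf hg.dens hentf hentg)
  rw [ENNReal.toReal_mul, ENNReal.toReal_add hff hgg, ENNReal.toReal_ofNat] at hp
  nlinarith

end LogGas

end

/-! ### The equilibrium measure of a rapidly decaying weight -/

noncomputable section

namespace LogGas

open InformationTheory

variable {X : Type*} [NormedAddCommGroup X] [InnerProductSpace ℝ X] [FiniteDimensional ℝ X]
  [MeasurableSpace X] [BorelSpace X]

/-- A nonnegative weight decaying faster than any power. -/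
structure IsWeight (r : X → ℝ) : Prop where
  meas : Measurable r
  nonneg : ∀ x, 0 ≤ r x
  decay : ∀ κ : ℝ, 0 ≤ κ → ∃ C : ℝ, ∀ x, r x * (1 + ‖x‖) ^ κ ≤ C
  integral_pos : 0 < ∫ x, r x

/-- Integrability is bought with `d + 1` further powers of decay, `d` the dimension. -/
lemma IsWeight.integrable_mul_rpow {r : X → ℝ} (hr : IsWeight r) {κ : ℝ} (hκ : 0 ≤ κ) :
    Integrable (fun x => r x * (1 + ‖x‖) ^ κ) := by
  obtain ⟨C, hC⟩ := hr.decay (κ + (Module.finrank ℝ X + 1)) (by positivity)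
  have h1 : Integrable (fun x : X => C * (1 + ‖x‖) ^ (-(Module.finrank ℝ X + 1 : ℝ))) :=
    (integrable_one_add_norm (by linarith)).const_mul C
  have hm := hr.meas
  refine h1.mono' (by fun_prop : Measurable _).aestronglyMeasurable (ae_of_all _ fun x => ?_)
  have hx : 0 < 1 + ‖x‖ := by positivity
  rw [Real.norm_of_nonneg (mul_nonneg (hr.nonneg x) (by positivity)), Real.rpow_neg hx.le,
    ← div_eq_mul_inv, le_div_iff₀ (by positivity), mul_assoc, ← Real.rpow_add hx]
  exact hC x

lemma IsWeight.integrable {r : X → ℝ} (hr : IsWeight r) : Integrable r := by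
  simpa using hr.integrable_mul_rpow le_rfl

lemma IsWeight.mul_exp {r : X → ℝ} (hr : IsWeight r) {γ : ℝ} (hγ : 0 ≤ γ) (φ : X → ℝ)
    (hφ : Measurable φ) (B : ℝ) (hB : ∀ x, φ x ≤ γ * logWeight x + B) :
    IsWeight (fun x => r x * Real.exp (φ x)) := by
  have hle : ∀ x, Real.exp (φ x) ≤ (1 + ‖x‖) ^ γ * Real.exp B := fun x => by
    rw [Real.rpow_def_of_pos (by positivity), ← Real.exp_add, Real.exp_le_exp]
    have := hB x
    unfold logWeight at this
    linarith
  have hdec : ∀ κ : ℝ, 0 ≤ κ → ∃ C : ℝ, ∀ x, r x * Real.exp (φ x) * (1 + ‖x‖) ^ κ ≤ C := by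
    intro κ hκ
    obtain ⟨C, hC⟩ := hr.decay (κ + γ) (by positivity)
    refine ⟨C * Real.exp B, fun x => ?_⟩
    have hx : 0 < 1 + ‖x‖ := by positivity
    calc r x * Real.exp (φ x) * (1 + ‖x‖) ^ κ
        ≤ r x * ((1 + ‖x‖) ^ γ * Real.exp B) * (1 + ‖x‖) ^ κ := by
          gcongr
          · exact hr.nonneg x
          · exact hle x
      _ = r x * (1 + ‖x‖) ^ (κ + γ) * Real.exp B := by rw [Real.rpow_add hx]; ring
      _ ≤ _ := by gcongr; exact hC x
  have hm := hr.meas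
  refine ⟨by fun_prop, fun x => mul_nonneg (hr.nonneg x) (Real.exp_pos _).le, hdec, ?_⟩
  have hintegr : Integrable (fun x => r x * Real.exp (φ x)) := by
    refine ((hr.integrable_mul_rpow hγ).mul_const (Real.exp B)).mono'
      (by fun_prop : Measurable _).aestronglyMeasurable (ae_of_all _ fun x => ?_)
    rw [Real.norm_of_nonneg (mul_nonneg (hr.nonneg x) (Real.exp_pos _).le), mul_assoc]
    exact mul_le_mul_of_nonneg_left (hle x) (hr.nonneg x)
  have h0 := (integral_pos_iff_support_of_nonneg hr.nonneg hr.integrable).1 hr.integral_pos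
  refine (integral_pos_iff_support_of_nonneg
    (fun x => mul_nonneg (hr.nonneg x) (Real.exp_pos _).le) hintegr).2 ?_
  convert h0 using 2
  ext x
  simp [Real.exp_ne_zero]

/-- The probability measure with density proportional to a weight. -/
def weightMeasure (r : X → ℝ) : Measure X :=
  volume.withDensity fun x => ENNReal.ofReal (r x / ∫ y, r y)

lemma IsWeight.isTame {r : X → ℝ} (hr : IsWeight r) : IsTame (weightMeasure r) := by
  have hm := hr.meas
  have hpos := hr.integral_pos
  have hn : ∀ x, 0 ≤ r x / ∫ y, r y := fun x => div_nonneg (hr.nonneg x) hpos.le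
  refine ⟨⟨?_⟩, ?_, ?_⟩
  · rw [weightMeasure, withDensity_apply _ MeasurableSet.univ, setLIntegral_univ,
      ← ofReal_integral_eq_lintegral_ofReal (hr.integrable.div_const _) (ae_of_all _ hn),
      integral_div, div_self hpos.ne', ENNReal.ofReal_one]
  · obtain ⟨C, hC⟩ := hr.decay 0 le_rfl
    refine ⟨(C / ∫ y, r y).toNNReal, ?_⟩
    have : (C / ∫ y, r y).toNNReal • (volume : Measure X)
        = volume.withDensity (fun _ => ENNReal.ofReal (C / ∫ y, r y)) := by
      rw [withDensity_const]; rfl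
    rw [this]
    refine withDensity_mono (ae_of_all _ fun x => ENNReal.ofReal_le_ofReal ?_)
    have := hC x
    rw [Real.rpow_zero, mul_one] at this
    gcongr
  · rw [weightMeasure, integrable_withDensity_iff (by fun_prop) (ae_of_all _ fun x => by simp)]
    have := (hr.integrable_mul_rpow (show (0:ℝ) ≤ 2 by norm_num)).div_const (∫ y, r y)
    refine this.congr (ae_of_all _ fun x => ?_)
    simp only
    rw [ENNReal.toReal_ofReal (hn x), Real.rpow_two]
    ring

variable [Nontrivial X]

/-- The kernel of the weighted energy. -/
def weightedKernel (x z : X) : ℝ≥0∞ := ENNReal.ofReal (regKernel 0 x z)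

lemma measurable_weightedKernel : Measurable (Function.uncurry (weightedKernel : X → X → ℝ≥0∞)) := by
  unfold weightedKernel Function.uncurry; fun_prop

lemma densEnergy_eq_mutualEnergy {Y : Type*} [MeasurableSpace Y] {k : Y → Y → ℝ≥0∞}
    (hk : Measurable (Function.uncurry k)) (ν : Measure Y) [SFinite ν] {f g : Y → ℝ} (hf : Measurable f)
    (hg : Measurable g) : densEnergy k ν f g = mutualEnergy k
      (ν.withDensity fun x => ENNReal.ofReal (f x)) (ν.withDensity fun x => ENNReal.ofReal (g x)) := by
  rw [densEnergy_eq_lintegral_densPotential hk ν hf hg]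
  have e : ∀ x, ∫⁻ z, k x z ∂(ν.withDensity fun x => ENNReal.ofReal (g x)) = densPotential k ν g x := by
    intro x
    have hkx : Measurable (k x) := hk.comp (measurable_const.prodMk measurable_id)
    rw [lintegral_withDensity_eq_lintegral_mul _ (by fun_prop) hkx]
    exact lintegral_congr fun z => mul_comm _ _
  have hp := measurable_densPotential hk ν hg
  simp only [mutualEnergy, e]
  rw [lintegral_withDensity_eq_lintegral_mul _ (by fun_prop) hp]
  exact lintegral_congr fun z => mul_comm _ _

lemma IsDensity.isProbabilityMeasure {Y : Type*} [MeasurableSpace Y] {ν : Measure Y} {f : Y → ℝ}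
    (hf : IsDensity ν f) : IsProbabilityMeasure (ν.withDensity fun x => ENNReal.ofReal (f x)) :=
  ⟨by rw [withDensity_apply _ MeasurableSet.univ, setLIntegral_univ, hf.lintegral_eq]⟩

/-- Densities of finite entropy have finite logarithmic moment. -/
lemma IsTame.lintegral_logWeight_withDensity_ne_top {ν : Measure X} (hν : IsTame ν) {f : X → ℝ}
    (hf : IsDensity ν f) (hent : entropy ν f ≠ ⊤) :
    ∫⁻ x, ENNReal.ofReal (logWeight x) ∂(ν.withDensity fun x => ENNReal.ofReal (f x)) ≠ ⊤ := by
  have hm := hf.meas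
  rw [lintegral_withDensity_eq_lintegral_mul _ (by fun_prop) (by fun_prop)]
  have hi : ∫⁻ x, ENNReal.ofReal ((1 + ‖x‖) ^ 2) ∂ν ≠ ⊤ := by
    have := hν.integrable_sq.2
    rw [hasFiniteIntegral_iff_ofReal (ae_of_all _ fun x => by positivity)] at this
    exact this.ne
  refine ne_top_of_le_ne_top (ENNReal.add_ne_top.2 ⟨hent, hi⟩) ?_
  have := measurable_klFun
  rw [entropy, ← lintegral_add_left (by fun_prop)]
  refine lintegral_mono fun x => ?_
  simp only [Pi.mul_apply]
  rw [← ENNReal.ofReal_mul (hf.nonneg x), ← ENNReal.ofReal_add (klFun_nonneg (hf.nonneg x)) (by positivity)]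
  refine ENNReal.ofReal_le_ofReal ?_
  -- Young's inequality for the entropy: `f log(1+|x|) ≤ klFun f + |x|`.
  have h1 := relEnt_nonneg (hf.nonneg x) (show 0 < 1 + ‖x‖ by positivity)
  unfold relEnt at h1
  unfold klFun logWeight
  nlinarith [norm_nonneg x]

/-- The case `η = 0` of conditional positivity. Densities do not charge the diagonal, and finite
entropy supplies the logarithmic moment. -/
lemma IsTame.posDefOnDensities {ν : Measure X} (hν : IsTame ν) :
    PosDefOnDensities weightedKernel ν := by
  intro f g hf hg hef heg
  have := hν.prob
  have hat := hν.nullSingletonClass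
  have pf := hf.isProbabilityMeasure
  have pg := hg.isProbabilityMeasure
  rw [densEnergy_eq_mutualEnergy measurable_weightedKernel ν hf.meas hg.meas,
    densEnergy_eq_mutualEnergy measurable_weightedKernel ν hf.meas hf.meas,
    densEnergy_eq_mutualEnergy measurable_weightedKernel ν hg.meas hg.meas]
  have key : ∀ (a : Measure X) [IsProbabilityMeasure a] (h : X → ℝ), IsDensity ν h →
      ∀ᵐ p ∂(a.prod (ν.withDensity fun x => ENNReal.ofReal (h x))), 0 < ‖p.1 - p.2‖ ^ 2 + (0 : ℝ) := by
    intro a _ h hh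
    have := hh.isProbabilityMeasure
    have hn : NullSingletonClass (ν.withDensity fun x => ENNReal.ofReal (h x)) :=
      ⟨fun x => withDensity_absolutelyContinuous _ _ (measure_singleton x)⟩
    filter_upwards [ae_prod_ne a (ν.withDensity fun x => ENNReal.ofReal (h x))] with p hp
    have := norm_pos_iff.2 (sub_ne_zero.2 hp)
    positivity
  exact two_mul_mutualEnergy_regKernel_le le_rfl zero_le_one _ _
    (hν.lintegral_logWeight_withDensity_ne_top hf hef)
    (hν.lintegral_logWeight_withDensity_ne_top hg heg) (key _ g hg) (key _ f hf) (key _ g hg)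

lemma IsTame.lintegral_weightedKernel {α : Measure X} (h : IsTame α) (x : X) :
    ∫⁻ z, weightedKernel x z ∂α = ENNReal.ofReal (potential 0 α x) :=
  (ofReal_integral_eq_lintegral_ofReal (h.integrable_regKernel le_rfl zero_le_one x)
    (ae_of_all _ fun z => regKernel_nonneg le_rfl zero_le_one x z)).symm

lemma IsTame.exists_lintegral_weightedKernel_le {α : Measure X} (h : IsTame α) :
    ∃ K : ℝ≥0, ∀ x, ∫⁻ z, weightedKernel x z ∂α ≤ K := by
  obtain ⟨B, hB⟩ := h.exists_potential_bound
  refine ⟨B.toNNReal, fun x => ?_⟩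
  rw [h.lintegral_weightedKernel]
  exact ENNReal.ofReal_le_ofReal (hB x)

/-- `μ` solves the self-consistency equation `μ = r e^{γ (θ - W_μ)} dx / c`. -/
structure IsSelfConsistent (r : X → ℝ) (γ : ℝ) (μ : Measure X) (c : ℝ) : Prop where
  tame : IsTame μ
  pos : 0 < c
  eq : μ = volume.withDensity fun x =>
    ENNReal.ofReal (r x * Real.exp (γ * (logWeight x - potential 0 μ x)) / c)

/-- The weight `r (1 + |x|)^γ` of the reference measure. -/
def refWeight (r : X → ℝ) (γ : ℝ) (x : X) : ℝ := r x * Real.exp (γ * logWeight x)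

lemma IsWeight.refWeight {r : X → ℝ} (hr : IsWeight r) {γ : ℝ} (hγ : 0 ≤ γ) :
    IsWeight (refWeight r γ) :=
  hr.mul_exp hγ (fun x => γ * logWeight x) (by fun_prop) 0 (fun x => by simp)

/-- Existence of the equilibrium measure, together with its minimality among densities. -/
theorem exists_isSelfConsistent {r : X → ℝ} (hr : IsWeight r) {γ : ℝ} (hγ : 0 ≤ γ) :
    ∃ (g : X → ℝ) (c : ℝ), IsDensity (weightMeasure (refWeight r γ)) g ∧
      densFreeEnergy weightedKernel γ (weightMeasure (refWeight r γ)) g ≠ ⊤ ∧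
      (∀ f, IsDensity (weightMeasure (refWeight r γ)) f → ¬ f =ᵐ[weightMeasure (refWeight r γ)] g →
        densFreeEnergy weightedKernel γ (weightMeasure (refWeight r γ)) g
          < densFreeEnergy weightedKernel γ (weightMeasure (refWeight r γ)) f) ∧
      IsSelfConsistent r γ
        ((weightMeasure (refWeight r γ)).withDensity fun x => ENNReal.ofReal (g x)) c := by
  have hw := hr.refWeight hγ
  have ht := hw.isTame
  set ν := weightMeasure (refWeight r γ) with hν
  have := ht.prob
  obtain ⟨K, hK⟩ := ht.exists_lintegral_weightedKernel_le
  have hsymm : ∀ x z : X, weightedKernel x z = weightedKernel z x := fun x z => by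
    unfold weightedKernel; rw [regKernel_comm]
  obtain ⟨g, Z, hg⟩ := exists_isGibbsDensity measurable_weightedKernel hsymm
    (fun x z => ENNReal.ofReal_ne_top) hK ht.posDefOnDensities hγ
  obtain ⟨hfin, hmin⟩ := hg.densFreeEnergy_lt measurable_weightedKernel hsymm hK
    ht.posDefOnDensities hγ
  have hZ := hg.pos
  have hgm := hg.dens.meas
  have hwm := hw.meas
  have hcpos := hw.integral_pos
  refine ⟨g, (∫ y, refWeight r γ y) * Z, hg.dens, hfin, hmin, ?_⟩
  have hgle : ∀ x, g x ≤ 1 / Z := fun x => by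
    rw [hg.eq]
    gcongr
    rw [Real.exp_le_one_iff]
    nlinarith [mul_nonneg hγ (ENNReal.toReal_nonneg (a := densPotential weightedKernel ν g x))]
  -- The Gibbs density is at most `1/Z` because the potential is nonnegative; so the equilibrium
  -- measure inherits tameness from `ν`.
  have hle : (ν.withDensity fun x => ENNReal.ofReal (g x)) ≤ (1 / Z).toNNReal • ν := by
    have : (1 / Z).toNNReal • ν = ν.withDensity (fun _ => ENNReal.ofReal (1 / Z)) := by
      rw [withDensity_const]; rfl
    rw [this]
    exact withDensity_mono (ae_of_all _ fun x => ENNReal.ofReal_le_ofReal (hgle x))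
  have hμ : IsTame (ν.withDensity fun x => ENNReal.ofReal (g x)) := by
    refine ⟨hg.dens.isProbabilityMeasure, ?_, ?_⟩
    · obtain ⟨C, hC⟩ := ht.le_smul_volume
      refine ⟨(1 / Z).toNNReal * C, hle.trans ?_⟩
      rw [mul_smul]
      gcongr
    · refine Integrable.mono_measure ?_ hle
      exact ht.integrable_sq.smul_measure_nnreal
  refine ⟨hμ, by positivity, ?_⟩
  have hpot : ∀ x, (densPotential weightedKernel ν g x).toReal
      = potential 0 (ν.withDensity fun x => ENNReal.ofReal (g x)) x := by
    intro x
    have h1 := hμ.lintegral_weightedKernel x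
    have hkx : Measurable (weightedKernel x) :=
      measurable_weightedKernel.comp (measurable_const.prodMk measurable_id)
    rw [lintegral_withDensity_eq_lintegral_mul _ (by fun_prop) hkx] at h1
    have h2 : densPotential weightedKernel ν g x
        = ∫⁻ z, ((fun x => ENNReal.ofReal (g x)) * weightedKernel x) z ∂ν :=
      lintegral_congr fun z => mul_comm _ _
    rw [h2, h1, ENNReal.toReal_ofReal (potential_nonneg le_rfl zero_le_one x)]
  conv_lhs => rw [hν, weightMeasure]
  rw [← withDensity_mul _ (by fun_prop) (by fun_prop)]
  congr 1
  funext x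
  rw [Pi.mul_apply, ← ENNReal.ofReal_mul (div_nonneg (hw.nonneg x) hcpos.le)]
  congr 1
  rw [hg.eq, hpot, refWeight, mul_sub, sub_eq_add_neg, Real.exp_add, neg_mul]
  field_simp

end LogGas

end

/-! ### Product measures and the Vandermonde factor -/

noncomputable section

namespace LogGas

section Pi

variable {Y : Type*} [MeasurableSpace Y]

lemma lintegral_pi_insertNth {M : ℕ} (τ : Fin (M + 1) → Measure Y) [∀ i, SigmaFinite (τ i)]
    (i : Fin (M + 1)) {F : (Fin (M + 1) → Y) → ℝ≥0∞} (hF : Measurable F) :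
    ∫⁻ x, F x ∂(Measure.pi τ)
      = ∫⁻ u, ∫⁻ y, F (i.insertNth u y) ∂(Measure.pi fun j => τ (i.succAbove j)) ∂(τ i) := by
  have h := (measurePreserving_piFinSuccAbove τ i).symm
  rw [← h.lintegral_comp hF, lintegral_prod _ (by
    exact (hF.comp (MeasurableEquiv.measurable _)).aemeasurable)]
  rfl

lemma measurable_insertNth {M : ℕ} (i : Fin (M + 1)) :
    Measurable (fun p : Y × (Fin M → Y) => (i.insertNth p.1 p.2 : Fin (M + 1) → Y)) :=
  (MeasurableEquiv.piFinSuccAbove (fun _ : Fin (M + 1) => Y) i).symm.measurable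

lemma lintegral_pi_prod {M : ℕ} (τ : Fin M → Measure Y) [∀ i, SigmaFinite (τ i)]
    {f : Fin M → Y → ℝ≥0∞} (hf : ∀ i, Measurable (f i)) :
    ∫⁻ x, ∏ i, f i (x i) ∂(Measure.pi τ) = ∏ i, ∫⁻ x, f i x ∂(τ i) := by
  induction M with
  | zero => simp
  | succ M ih =>
    have hm : Measurable (fun x : Fin (M + 1) → Y => ∏ i, f i (x i)) :=
      Finset.measurable_fun_prod _ fun i _ => (hf i).comp (measurable_pi_apply i)
    have hm' : Measurable (fun y : Fin M → Y => ∏ i : Fin M, f i.succ (y i)) :=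
      Finset.measurable_fun_prod _ fun i _ => (hf i.succ).comp (measurable_pi_apply i)
    rw [lintegral_pi_insertNth τ 0 hm, Fin.prod_univ_succ]
    simp only [Fin.prod_univ_succ, Fin.insertNth_zero', Fin.cons_zero, Fin.cons_succ]
    simp_rw [lintegral_const_mul _ hm']
    rw [lintegral_mul_const _ (hf 0)]
    congr 1
    simpa using ih (fun i => τ i.succ) (f := fun i => f i.succ) (fun i => hf i.succ)

lemma pi_withDensity_ofReal (τ : Measure Y) [SigmaFinite τ] {g : Y → ℝ} (hg : Measurable g) (M : ℕ) :
    Measure.pi (fun _ : Fin M => τ.withDensity fun x => ENNReal.ofReal (g x))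
      = (Measure.pi fun _ : Fin M => τ).withDensity fun x => ∏ i, ENNReal.ofReal (g (x i)) := by
  refine Measure.pi_eq fun s hs => ?_
  rw [withDensity_apply _ (MeasurableSet.univ_pi hs), ← lintegral_indicator (MeasurableSet.univ_pi hs)]
  have e : ∀ x : Fin M → Y, (Set.univ.pi s).indicator (fun x => ∏ i, ENNReal.ofReal (g (x i))) x
      = ∏ i, (s i).indicator (fun y => ENNReal.ofReal (g y)) (x i) := by
    intro x
    by_cases hx : x ∈ Set.univ.pi s
    · rw [Set.indicator_of_mem hx]
      exact Finset.prod_congr rfl fun i _ => by rw [Set.indicator_of_mem (hx i (Set.mem_univ i))]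
    · rw [Set.indicator_of_notMem hx]
      simp only [Set.mem_pi, Set.mem_univ, true_imp_iff, not_forall] at hx
      obtain ⟨i, hi⟩ := hx
      exact (Finset.prod_eq_zero (Finset.mem_univ i) (Set.indicator_of_notMem hi _)).symm
  simp_rw [e]
  rw [lintegral_pi_prod (fun _ => τ) (fun i => Measurable.indicator (by fun_prop) (hs i))]
  refine Finset.prod_congr rfl fun i _ => ?_
  rw [withDensity_apply _ (hs i), lintegral_indicator (hs i)]

end Pi

section PairProd

variable {X : Type*} [NormedAddCommGroup X]

/-- `∏_{i<j} |x_i - x_j|^β`. -/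
def pairProd (β : ℝ) {M : ℕ} (x : Fin M → X) : ℝ := ∏ i, ∏ j ∈ Finset.Ioi i, ‖x i - x j‖ ^ β

lemma pairProd_nonneg (β : ℝ) {M : ℕ} (x : Fin M → X) : 0 ≤ pairProd β x :=
  Finset.prod_nonneg fun _ _ => Finset.prod_nonneg fun _ _ => by positivity

/-- Ordered pairs with half the exponent. This symmetric form lets any particle, not only the first,
be split off. -/
lemma pairProd_eq_prod_ne (β : ℝ) {M : ℕ} (x : Fin M → X) :
    pairProd β x = ∏ i, ∏ j, if j = i then 1 else ‖x i - x j‖ ^ (β / 2) := by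
  have h := Finset.prod_prod_Ioi_mul_eq_prod_prod_off_diag (fun i j => ‖x j - x i‖ ^ (β / 2))
  have h2 : pairProd β x
      = ∏ i, ∏ j ∈ Finset.Ioi i, ‖x i - x j‖ ^ (β / 2) * ‖x j - x i‖ ^ (β / 2) := by
    refine Finset.prod_congr rfl fun i _ => Finset.prod_congr rfl fun j hj => ?_
    rw [norm_sub_rev (x j), ← Real.mul_rpow (norm_nonneg _) (norm_nonneg _), ← sq,
      ← Real.rpow_natCast, ← Real.rpow_mul (norm_nonneg _)]
    congr 1
    push_cast
    ring
  rw [h2, h]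
  refine Finset.prod_congr rfl fun i _ => ?_
  rw [← Finset.prod_subset (Finset.subset_univ ({i}ᶜ : Finset (Fin M)))]
  · refine Finset.prod_congr rfl fun j hj => ?_
    rw [if_neg (by simpa using hj)]
  · intro j _ hj
    rw [if_pos (by simpa using hj)]

lemma pairProd_insertNth (β : ℝ) {M : ℕ} (i : Fin (M + 1)) (u : X) (y : Fin M → X) :
    pairProd β (i.insertNth u y : Fin (M + 1) → X) = (∏ j, ‖u - y j‖ ^ β) * pairProd β y := by
  rw [pairProd_eq_prod_ne, pairProd_eq_prod_ne, Fin.prod_univ_succAbove _ i]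
  simp only [Fin.prod_univ_succAbove _ i, Fin.insertNth_apply_same, Fin.insertNth_apply_succAbove,
    if_true, one_mul, Fin.succAbove_right_inj, if_neg (Fin.succAbove_ne i _),
    if_neg (Fin.succAbove_ne i _).symm]
  rw [Finset.prod_mul_distrib, ← mul_assoc, ← Finset.prod_mul_distrib]
  congr 1
  refine Finset.prod_congr rfl fun j _ => ?_
  rw [norm_sub_rev (y j), ← Real.mul_rpow (norm_nonneg _) (norm_nonneg _), ← sq,
    ← Real.rpow_natCast, ← Real.rpow_mul (norm_nonneg _)]
  congr 1
  push_cast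
  ring

lemma pairProd_eq_exp (β : ℝ) {M : ℕ} {x : Fin M → X} (hx : Function.Injective x) :
    pairProd β x = Real.exp (β / 2 * ∑ i, ∑ j, if j = i then 0 else Real.log ‖x i - x j‖) := by
  rw [pairProd_eq_prod_ne, Finset.mul_sum, Real.exp_sum]
  refine Finset.prod_congr rfl fun i _ => ?_
  rw [Finset.mul_sum, Real.exp_sum]
  refine Finset.prod_congr rfl fun j _ => ?_
  split_ifs with h
  · simp
  · have : 0 < ‖x i - x j‖ := norm_pos_iff.2 (sub_ne_zero.2 fun hc => h (hx hc).symm)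
    rw [Real.rpow_def_of_pos this, mul_comm]

/-- The assumption `β ≠ 0` excludes the convention `0^0 = 1`. -/
lemma pairProd_eq_zero {β : ℝ} (hβ : β ≠ 0) {M : ℕ} {x : Fin M → X} (hx : ¬ Function.Injective x) :
    pairProd β x = 0 := by
  rw [pairProd_eq_prod_ne]
  simp only [Function.Injective, not_forall] at hx
  obtain ⟨i, j, hij, hne⟩ := hx
  refine Finset.prod_eq_zero (Finset.mem_univ i) (Finset.prod_eq_zero (Finset.mem_univ j) ?_)
  rw [if_neg (Ne.symm hne), hij, sub_self, norm_zero, Real.zero_rpow (by positivity)]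

/-- From `|x-z| ≤ (1+|x|)(1+|z|)`. Treating the diagonal factors `1` in the same way gives the
exponent `βM` in place of `β(M-1)`. -/
lemma pairProd_le {β : ℝ} (hβ : 0 ≤ β) {M : ℕ} (x : Fin M → X) :
    pairProd β x ≤ ∏ i, (1 + ‖x i‖) ^ (β * M) := by
  have h1 : ∀ i j, (if j = i then 1 else ‖x i - x j‖ ^ (β / 2))
      ≤ (1 + ‖x i‖) ^ (β / 2) * (1 + ‖x j‖) ^ (β / 2) := by
    intro i j
    rw [← Real.mul_rpow (by positivity) (by positivity)]
    have hp : 0 ≤ ‖x i‖ * ‖x j‖ := by positivity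
    split_ifs
    · exact Real.one_le_rpow (by nlinarith [norm_nonneg (x i), norm_nonneg (x j)]) (by positivity)
    · refine Real.rpow_le_rpow (norm_nonneg _) ?_ (by positivity)
      nlinarith [norm_sub_le (x i) (x j)]
  rw [pairProd_eq_prod_ne]
  calc _ ≤ ∏ i, ∏ j, ((1 + ‖x i‖) ^ (β / 2) * (1 + ‖x j‖) ^ (β / 2)) := by
        refine Finset.prod_le_prod (fun i _ => Finset.prod_nonneg fun j _ => ?_)
          fun i _ => Finset.prod_le_prod (fun j _ => ?_) fun j _ => h1 i j
        all_goals split_ifs <;> positivity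
    _ = _ := by
        simp_rw [Finset.prod_mul_distrib]
        simp only [Finset.prod_const, Finset.card_univ, Fintype.card_fin]
        rw [← Finset.prod_pow, ← Finset.prod_mul_distrib]
        refine Finset.prod_congr rfl fun i _ => ?_
        rw [← Real.rpow_mul_natCast (by positivity), ← Real.rpow_add (by positivity)]
        congr 1
        ring

end PairProd

section

variable {X : Type*} [NormedAddCommGroup X] [InnerProductSpace ℝ X] [FiniteDimensional ℝ X]
  [MeasurableSpace X] [BorelSpace X]

@[fun_prop]
lemma measurable_pairProd (β : ℝ) {M : ℕ} : Measurable (fun x : Fin M → X => pairProd β x) := by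
  unfold pairProd
  fun_prop

end

end LogGas

end

/-! ### Upper bound of the Gibbs density relative to the product of equilibrium measures -/

noncomputable section

namespace LogGas

section

lemma ofReal_integral_le_lintegral_ofReal {Y : Type*} [MeasurableSpace Y] {τ : Measure Y} {h : Y → ℝ}
    (hi : Integrable h τ) : ENNReal.ofReal (∫ x, h x ∂τ) ≤ ∫⁻ x, ENNReal.ofReal (h x) ∂τ := by
  rw [integral_eq_lintegral_pos_part_sub_lintegral_neg_part hi]
  refine le_trans (ENNReal.ofReal_le_ofReal (sub_le_self _ ENNReal.toReal_nonneg)) ?_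
  exact ENNReal.ofReal_toReal_le

/-- Jensen's inequality for the exponential. -/
lemma ofReal_exp_integral_le {Y : Type*} [MeasurableSpace Y] {τ : Measure Y} [IsProbabilityMeasure τ]
    {g : Y → ℝ} (hg : Integrable g τ) :
    ENNReal.ofReal (Real.exp (∫ x, g x ∂τ)) ≤ ∫⁻ x, ENNReal.ofReal (Real.exp (g x)) ∂τ := by
  set a := ∫ x, g x ∂τ with ha
  have hi : Integrable (fun x => Real.exp a * (1 + (g x - a))) τ :=
    ((integrable_const _).add (hg.sub (integrable_const _))).const_mul _
  have e : ∫ x, Real.exp a * (1 + (g x - a)) ∂τ = Real.exp a := by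
    rw [integral_const_mul, integral_add (integrable_const _) (by exact hg.sub (integrable_const _)),
      integral_sub hg (integrable_const _), ← ha]
    simp
  rw [← e]
  refine (ofReal_integral_le_lintegral_ofReal hi).trans (lintegral_mono fun x => ?_)
  refine ENNReal.ofReal_le_ofReal ?_
  have h1 := Real.add_one_le_exp (g x - a)
  calc Real.exp a * (1 + (g x - a)) ≤ Real.exp a * Real.exp (g x - a) := by gcongr; linarith
    _ = Real.exp (g x) := by rw [← Real.exp_add]; congr 1; ring

lemma measurePreserving_eval_pair {Y : Type*} [MeasurableSpace Y] (τ : Measure Y) [IsProbabilityMeasure τ]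
    {M : ℕ} {i j : Fin M} (hij : i ≠ j) :
    MeasurePreserving (fun x : Fin M → Y => (x i, x j)) (Measure.pi fun _ => τ) (τ.prod τ) := by
  refine ⟨by fun_prop, ?_⟩
  rw [← Measure.infinitePi_eq_pi]
  exact Measure.infinitePi_map_eval_prod (P := fun _ : Fin M => τ) hij

end

variable {X : Type*} [NormedAddCommGroup X] [InnerProductSpace ℝ X] [FiniteDimensional ℝ X]
  [MeasurableSpace X] [BorelSpace X] [Nontrivial X]

lemma IsTame.measurable_potential {μ : Measure X} (h : IsTame μ) : Measurable (potential 0 μ) :=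
  h.continuous_potential.measurable

lemma IsTame.integrable_potential {μ : Measure X} (h : IsTame μ) : Integrable (potential 0 μ) μ := by
  obtain ⟨B, hB⟩ := h.exists_potential_bound
  have := h.prob
  refine Integrable.of_bound h.measurable_potential.aestronglyMeasurable B (ae_of_all _ fun x => ?_)
  rw [Real.norm_of_nonneg (potential_nonneg le_rfl zero_le_one x)]
  exact hB x

lemma IsTame.integrable_regKernel_prod {μ : Measure X} (h : IsTame μ) :
    Integrable (fun p : X × X => regKernel 0 p.1 p.2) (μ.prod μ) := by
  have := h.prob
  refine (integrable_prod_iff (measurable_regKernel 0).aestronglyMeasurable).2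
    ⟨ae_of_all _ fun x => h.integrable_regKernel le_rfl zero_le_one x, ?_⟩
  refine h.integrable_potential.congr (ae_of_all _ fun x => ?_)
  refine integral_congr_ae (ae_of_all _ fun z => ?_)
  exact (Real.norm_of_nonneg (regKernel_nonneg le_rfl zero_le_one x z)).symm

lemma IsTame.ae_injective {μ : Measure X} (h : IsTame μ) (M : ℕ) :
    ∀ᵐ x ∂(Measure.pi fun _ : Fin M => μ), Function.Injective x := by
  have := h.prob
  have := h.nullSingletonClass
  have key : ∀ i j : Fin M, i ≠ j → ∀ᵐ x ∂(Measure.pi fun _ : Fin M => μ), x i ≠ x j := fun i j hij =>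
    (measurePreserving_eval_pair μ hij).quasiMeasurePreserving.ae (ae_prod_ne μ μ)
  have h2 : ∀ᵐ x ∂(Measure.pi fun _ : Fin M => μ), ∀ i j : Fin M, i ≠ j → x i ≠ x j := by
    rw [ae_all_iff]; intro i
    rw [ae_all_iff]; intro j
    by_cases hij : i = j
    · exact ae_of_all _ fun x hne => absurd hij hne
    · filter_upwards [key i j hij] with x hx _ using hx
  filter_upwards [h2] with x hx i j hij
  by_contra hne
  exact hx i j hne hij

/-- Nonnegativity of the regularized energy of the difference between the empirical measure
of a configuration and `μ`. -/
lemma IsTame.sum_potential_le {μ : Measure X} (h : IsTame μ) {η : ℝ} (h0 : 0 < η) (h1 : η ≤ 1)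
    {M : ℕ} (x : Fin M → X) :
    2 * M * ∑ j, potential η μ (x j)
      ≤ ∑ i, ∑ j, regKernel η (x i) (x j) + M ^ 2 * ∫ z, potential 0 μ z ∂μ := by
  have hμ := h.prob
  rcases Nat.eq_zero_or_pos M with hM | hM
  · subst hM; simp
  have hM' : (0 : ℝ) < M := by exact_mod_cast hM
  -- The empirical measure has atoms, hence infinite logarithmic self-energy; regularization with `η
  -- > 0` makes the comparison with `μ` possible.
  set α : Measure X := ENNReal.ofReal ((M : ℝ)⁻¹) • ∑ j, Measure.dirac (x j) with hα
  have hlin : ∀ F : X → ℝ≥0∞, ∫⁻ z, F z ∂α = ENNReal.ofReal ((M : ℝ)⁻¹) * ∑ j, F (x j) := by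
    intro F
    rw [hα, lintegral_smul_measure, lintegral_finsetSum_measure, smul_eq_mul]
    simp
  have hprob : IsProbabilityMeasure α := by
    refine ⟨?_⟩
    have := hlin (fun _ => 1)
    rw [lintegral_one] at this
    rw [this]
    simp only [Finset.sum_const, Finset.card_univ, Fintype.card_fin, nsmul_eq_mul, mul_one]
    rw [← ENNReal.ofReal_natCast, ← ENNReal.ofReal_mul (by positivity), inv_mul_cancel₀ hM'.ne']
    simp
  have hαtop : ∫⁻ z, ENNReal.ofReal (logWeight z) ∂α ≠ ⊤ := by
    rw [hlin]
    exact ENNReal.mul_ne_top ENNReal.ofReal_ne_top (ENNReal.sum_ne_top.2 fun j _ => ENNReal.ofReal_ne_top)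
  have hae : ∀ (a b : Measure X), ∀ᵐ p ∂(a.prod b), 0 < ‖p.1 - p.2‖ ^ 2 + η := fun a b =>
    ae_of_all _ fun p => by positivity
  have key := two_mul_mutualEnergy_regKernel_le h0.le h1 α μ hαtop h.lintegral_logWeight_ne_top
    (hae _ _) (hae _ _) (hae _ _)
  have hk0 : ∀ x z : X, 0 ≤ regKernel η x z := regKernel_nonneg h0.le h1
  have hW : ∀ y, ∫⁻ z, ENNReal.ofReal (regKernel η y z) ∂μ = ENNReal.ofReal (potential η μ y) := fun y =>
    (ofReal_integral_eq_lintegral_ofReal (h.integrable_regKernel h0.le h1 y)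
      (ae_of_all _ fun z => hk0 y z)).symm
  have e1 : mutualEnergy (fun x z => ENNReal.ofReal (regKernel η x z)) α μ
      = ENNReal.ofReal ((M : ℝ)⁻¹ * ∑ j, potential η μ (x j)) := by
    unfold mutualEnergy
    simp_rw [hW]
    rw [hlin, ← ENNReal.ofReal_sum_of_nonneg fun j _ => potential_nonneg h0.le h1 _,
      ← ENNReal.ofReal_mul (by positivity)]
  have e2 : mutualEnergy (fun x z => ENNReal.ofReal (regKernel η x z)) α α
      = ENNReal.ofReal ((M : ℝ)⁻¹ * ((M : ℝ)⁻¹ * ∑ i, ∑ j, regKernel η (x i) (x j))) := by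
    unfold mutualEnergy
    simp_rw [hlin]
    rw [← Finset.mul_sum, ENNReal.ofReal_mul (by positivity), ENNReal.ofReal_mul (by positivity),
      ENNReal.ofReal_sum_of_nonneg fun i _ => Finset.sum_nonneg fun j _ => hk0 _ _]
    congr 2
    refine Finset.sum_congr rfl fun i _ => ?_
    rw [ENNReal.ofReal_sum_of_nonneg fun j _ => hk0 _ _]
  have e3 : mutualEnergy (fun x z => ENNReal.ofReal (regKernel η x z)) μ μ
      ≤ ENNReal.ofReal (∫ z, potential 0 μ z ∂μ) := by
    unfold mutualEnergy
    simp_rw [hW]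
    rw [ofReal_integral_eq_lintegral_ofReal h.integrable_potential
      (ae_of_all _ fun z => potential_nonneg le_rfl zero_le_one z)]
    exact lintegral_mono fun z => ENNReal.ofReal_le_ofReal (h.potential_le h0.le h1 z)
  have hG : 0 ≤ ∫ z, potential 0 μ z ∂μ := integral_nonneg fun z => potential_nonneg le_rfl zero_le_one z
  have hS : 0 ≤ ∑ i, ∑ j, regKernel η (x i) (x j) :=
    Finset.sum_nonneg fun i _ => Finset.sum_nonneg fun j _ => hk0 _ _
  have key2 := key.trans (add_le_add_right e3 _)
  rw [e1, e2, ← ENNReal.ofReal_add (by positivity) hG,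
    show (2 : ℝ≥0∞) = ENNReal.ofReal 2 by simp, ← ENNReal.ofReal_mul (by norm_num),
    ENNReal.ofReal_le_ofReal_iff (by positivity)] at key2
  have key3 := mul_le_mul_of_nonneg_left key2 (show (0 : ℝ) ≤ M ^ 2 by positivity)
  calc 2 * M * ∑ j, potential η μ (x j) = (M : ℝ) ^ 2 * (2 * ((M : ℝ)⁻¹ * ∑ j, potential η μ (x j))) := by
        field_simp
    _ ≤ _ := key3
    _ = _ := by field_simp

/-- The logarithm of the density of the Gibbs measure with respect to `μ^{⊗M}`, up to a constant. -/
def logTilt (γ : ℝ) (μ : Measure X) (β : ℝ) {M : ℕ} (x : Fin M → X) : ℝ :=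
  (β * (M - 1) - γ) * ∑ j, logWeight (x j)
    - β / 2 * (∑ i, ∑ j, if j = i then 0 else regKernel 0 (x i) (x j)) + γ * ∑ j, potential 0 μ (x j)

/-- The density of the Gibbs measure with respect to `μ^{⊗M}`, up to a constant. -/
def tilt (γ : ℝ) (μ : Measure X) (β : ℝ) {M : ℕ} (x : Fin M → X) : ℝ :=
  pairProd β x * ∏ j, Real.exp (-γ * (logWeight (x j) - potential 0 μ (x j)))

/-- Injectivity is needed because `logTilt` stays finite at coincident points, where `tilt` vanishes
if `β ≠ 0`. -/
lemma tilt_eq_exp (γ : ℝ) (μ : Measure X) (β : ℝ) {M : ℕ} {x : Fin M → X} (hx : Function.Injective x) :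
    tilt γ μ β x = Real.exp (logTilt γ μ β x) := by
  unfold tilt logTilt
  rw [pairProd_eq_exp β hx, ← Real.exp_sum, ← Real.exp_add]
  congr 1
  have h1 : ∑ i, ∑ j, (if j = i then 0 else Real.log ‖x i - x j‖)
      = 2 * (M - 1) * ∑ j, logWeight (x j)
        - ∑ i, ∑ j, (if j = i then 0 else regKernel 0 (x i) (x j)) := by
    have h2 : ∀ i j, (if j = i then 0 else Real.log ‖x i - x j‖)
        = (logWeight (x i) + logWeight (x j) - (if j = i then 2 * logWeight (x i) else 0))
          - (if j = i then 0 else regKernel 0 (x i) (x j)) := by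
      intro i j
      split_ifs with h
      · subst h; ring
      · rw [regKernel_zero_eq]; ring
    simp_rw [h2, Finset.sum_sub_distrib, Finset.sum_add_distrib]
    simp only [Finset.sum_const, Finset.card_univ, Fintype.card_fin, nsmul_eq_mul,
      Finset.sum_ite_eq', Finset.mem_univ, if_true, ← Finset.mul_sum]
    ring
  rw [h1, ← Finset.mul_sum, Finset.sum_sub_distrib]
  ring

/-- The interaction is bounded below by the potentials through `sum_potential_le`, so that the
potentials reappear with coefficient `-(βM - γ)`, small in the mean-field regime. Regularization
costs `K η^{1/4}` per potential and a self-energy of order `-log η` per particle. -/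
lemma IsTame.logTilt_le {μ : Measure X} (h : IsTame μ) {K : ℝ}
    (hK : ∀ η : ℝ, 0 ≤ η → η ≤ 1 → ∀ x, potential 0 μ x - potential η μ x ≤ K * η ^ (1 / 4 : ℝ))
    (γ : ℝ) {β : ℝ} (hβ : 0 ≤ β) {η : ℝ} (h0 : 0 < η) (h1 : η ≤ 1) {M : ℕ} {x : Fin M → X}
    (hx : Function.Injective x) :
    logTilt γ μ β x ≤ (β * M - γ) * (∑ j, logWeight (x j) - ∑ j, potential 0 μ (x j))
      + M * (β * M * (K * η ^ (1 / 4 : ℝ)) + β * M * (∫ z, potential 0 μ z ∂μ) / 2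
        - β * Real.log η / 4) := by
  have hpd := h.sum_potential_le h0 h1 x
  -- Off the diagonal the regularized kernel is smaller than the true one; on it the value is `2
  -- logWeight - log η / 2`.
  have hdiag : ∑ i, ∑ j, regKernel η (x i) (x j)
      ≤ (∑ i, ∑ j, if j = i then 0 else regKernel 0 (x i) (x j))
        + 2 * ∑ i, logWeight (x i) - M * (Real.log η / 2) := by
    have h2 : ∀ i j, regKernel η (x i) (x j) ≤ (if j = i then 0 else regKernel 0 (x i) (x j))
        + (if j = i then 2 * logWeight (x i) - Real.log η / 2 else 0) := by
      intro i j
      split_ifs with hij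
      · subst hij
        unfold regKernel
        simp only [sub_self, norm_zero]
        rw [zero_pow (by norm_num), zero_add]
        linarith
      · rw [add_zero]
        exact regKernel_le_regKernel_zero h0.le fun hc => hij (hx hc).symm
    calc _ ≤ ∑ i, ∑ j, ((if j = i then 0 else regKernel 0 (x i) (x j))
        + (if j = i then 2 * logWeight (x i) - Real.log η / 2 else 0)) :=
          Finset.sum_le_sum fun i _ => Finset.sum_le_sum fun j _ => h2 i j
      _ = _ := by
          simp_rw [Finset.sum_add_distrib]
          simp only [Finset.sum_ite_eq', Finset.mem_univ, if_true, Finset.sum_sub_distrib,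
            Finset.sum_const, Finset.card_univ, Fintype.card_fin, nsmul_eq_mul, ← Finset.mul_sum]
          ring
  have hW : ∑ j, potential 0 μ (x j) ≤ ∑ j, potential η μ (x j) + M * (K * η ^ (1 / 4 : ℝ)) := by
    have : ∀ j, potential 0 μ (x j) ≤ potential η μ (x j) + K * η ^ (1 / 4 : ℝ) := fun j => by
      linarith [hK η h0.le h1 (x j)]
    calc _ ≤ ∑ j, (potential η μ (x j) + K * η ^ (1 / 4 : ℝ)) := Finset.sum_le_sum fun j _ => this j
      _ = _ := by rw [Finset.sum_add_distrib]; simp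
  unfold logTilt
  set T := ∑ j, logWeight (x j)
  set S := ∑ j, potential 0 μ (x j)
  set S' := ∑ j, potential η μ (x j)
  set Q := ∑ i, ∑ j, if j = i then 0 else regKernel 0 (x i) (x j)
  set G := ∫ z, potential 0 μ z ∂μ
  set e := K * η ^ (1 / 4 : ℝ)
  have hM : (0 : ℝ) ≤ M := Nat.cast_nonneg M
  have h3 : 2 * M * S - 2 * M * (M * e) ≤ Q + 2 * T - M * (Real.log η / 2) + M ^ 2 * G := by
    have := mul_le_mul_of_nonneg_left hW (show (0 : ℝ) ≤ 2 * M by positivity)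
    linarith
  have h4 := mul_le_mul_of_nonneg_left h3 (show 0 ≤ β / 2 by positivity)
  nlinarith

lemma IsTame.integral_logTilt {μ : Measure X} (h : IsTame μ) (γ β : ℝ) (M : ℕ) :
    Integrable (fun x : Fin M → X => logTilt γ μ β x) (Measure.pi fun _ => μ) ∧
    ∫ x : Fin M → X, logTilt γ μ β x ∂(Measure.pi fun _ => μ)
      = M * ((β * (M - 1) - γ) * (∫ z, logWeight z ∂μ) - β / 2 * (M - 1) * (∫ z, potential 0 μ z ∂μ)
        + γ * ∫ z, potential 0 μ z ∂μ) := by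
  have hμ := h.prob
  have ev : ∀ (F : X → ℝ), Integrable F μ → ∀ i : Fin M,
      Integrable (fun x : Fin M → X => F (x i)) (Measure.pi fun _ => μ) ∧
      ∫ x : Fin M → X, F (x i) ∂(Measure.pi fun _ => μ) = ∫ z, F z ∂μ := by
    intro F hF i
    have mp := measurePreserving_eval (fun _ : Fin M => μ) i
    refine ⟨mp.integrable_comp_of_integrable hF, ?_⟩
    have : AEStronglyMeasurable F (Measure.map (Function.eval i) (Measure.pi fun _ : Fin M => μ)) := by
      rw [mp.map_eq]; exact hF.1
    have h2 := integral_map mp.measurable.aemeasurable this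
    rw [mp.map_eq] at h2
    exact h2.symm
  have ek : ∀ i j : Fin M, Integrable (fun x : Fin M → X => if j = i then 0 else regKernel 0 (x i) (x j))
      (Measure.pi fun _ => μ) ∧
      ∫ x : Fin M → X, (if j = i then 0 else regKernel 0 (x i) (x j)) ∂(Measure.pi fun _ => μ)
        = if j = i then 0 else ∫ z, potential 0 μ z ∂μ := by
    intro i j
    split_ifs with hij
    · simp
    · have mp := measurePreserving_eval_pair μ (M := M) (i := i) (j := j) (Ne.symm hij)
      have hi := h.integrable_regKernel_prod
      refine ⟨mp.integrable_comp_of_integrable hi, ?_⟩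
      have : AEStronglyMeasurable (fun p : X × X => regKernel 0 p.1 p.2)
          (Measure.map (fun x : Fin M → X => (x i, x j)) (Measure.pi fun _ : Fin M => μ)) := by
        rw [mp.map_eq]; exact hi.1
      have h2 := integral_map mp.measurable.aemeasurable this
      rw [mp.map_eq, integral_prod _ hi] at h2
      exact h2.symm
  have iT := integrable_finsetSum Finset.univ fun (i : Fin M) _ => (ev _ h.integrable_logWeight i).1
  have iW := integrable_finsetSum Finset.univ fun (i : Fin M) _ => (ev _ h.integrable_potential i).1
  have iQ := integrable_finsetSum Finset.univ fun (i : Fin M) _ =>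
    integrable_finsetSum Finset.univ fun (j : Fin M) _ => (ek i j).1
  have i1 := iT.const_mul (β * (M - 1) - γ)
  have i2 := iQ.const_mul (β / 2)
  have i3 := iW.const_mul γ
  refine ⟨(i1.sub i2).add i3, ?_⟩
  unfold logTilt
  rw [integral_add (by exact i1.sub i2) i3, integral_sub i1 i2, integral_const_mul, integral_const_mul,
    integral_const_mul, integral_finsetSum _ fun (i : Fin M) _ => (ev _ h.integrable_logWeight i).1,
    integral_finsetSum _ fun (i : Fin M) _ => (ev _ h.integrable_potential i).1,
    integral_finsetSum _ fun (i : Fin M) _ =>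
      integrable_finsetSum Finset.univ fun (j : Fin M) _ => (ek i j).1]
  have e1 : ∀ i : Fin M, ∫ x : Fin M → X, logWeight (x i) ∂(Measure.pi fun _ => μ) = ∫ z, logWeight z ∂μ :=
    fun i => (ev _ h.integrable_logWeight i).2
  have e2 : ∀ i : Fin M, ∫ x : Fin M → X, potential 0 μ (x i) ∂(Measure.pi fun _ => μ)
      = ∫ z, potential 0 μ z ∂μ := fun i => (ev _ h.integrable_potential i).2
  have e3 : ∀ i : Fin M, ∫ x : Fin M → X, ∑ j, (if j = i then 0 else regKernel 0 (x i) (x j))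
      ∂(Measure.pi fun _ => μ) = (M - 1) * ∫ z, potential 0 μ z ∂μ := by
    intro i
    rw [integral_finsetSum _ fun (j : Fin M) _ => (ek i j).1]
    have h5 : ∀ j : Fin M, (if j = i then 0 else ∫ z, potential 0 μ z ∂μ)
        = (∫ z, potential 0 μ z ∂μ) - (if j = i then ∫ z, potential 0 μ z ∂μ else 0) := by
      intro j; split_ifs <;> ring
    simp_rw [(ek i _).2, h5, Finset.sum_sub_distrib]
    simp only [Finset.sum_ite_eq', Finset.mem_univ, if_true,
      Finset.sum_const, Finset.card_univ, Fintype.card_fin, nsmul_eq_mul]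
    ring
  simp_rw [e1, e2, e3]
  simp only [Finset.sum_const, Finset.card_univ, Fintype.card_fin, nsmul_eq_mul]
  ring

/-- Lower bound for the normalizing constant. -/
lemma IsTame.lintegral_tilt_ge {μ : Measure X} (h : IsTame μ) (γ β : ℝ) (M : ℕ) :
    ENNReal.ofReal (Real.exp (M * ((β * (M - 1) - γ) * (∫ z, logWeight z ∂μ)
        - β / 2 * (M - 1) * (∫ z, potential 0 μ z ∂μ) + γ * ∫ z, potential 0 μ z ∂μ)))
      ≤ ∫⁻ x : Fin M → X, ENNReal.ofReal (tilt γ μ β x) ∂(Measure.pi fun _ => μ) := by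
  have hμ := h.prob
  obtain ⟨hi, he⟩ := h.integral_logTilt γ β M
  rw [← he]
  refine (ofReal_exp_integral_le hi).trans (le_of_eq (lintegral_congr_ae ?_))
  filter_upwards [h.ae_injective M] with x hx
  rw [tilt_eq_exp γ μ β hx]

/-- The tilt is at most `e^{εM} ∏ (1+|x_j|)^ε` times its integral, for `M` large. -/
theorem IsTame.eventually_tilt_le {μ : Measure X} (h : IsTame μ) {γ : ℝ} {β : ℕ → ℝ}
    (hβ : ∀ M, 0 < β M) (hlim : Tendsto (fun M : ℕ => (M : ℝ) * β M) atTop (𝓝 γ)) {ε : ℝ} (hε : 0 < ε) :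
    ∀ᶠ M : ℕ in atTop, ∀ x : Fin M → X, ENNReal.ofReal (tilt γ μ (β M) x)
      ≤ (∏ j, ENNReal.ofReal (Real.exp ε * (1 + ‖x j‖) ^ ε))
        * ∫⁻ x : Fin M → X, ENNReal.ofReal (tilt γ μ (β M) x) ∂(Measure.pi fun _ => μ) := by
  obtain ⟨K, hK0, hK⟩ := h.exists_potential_sub_le
  obtain ⟨B, hB⟩ := h.exists_potential_bound
  set G := ∫ z, potential 0 μ z ∂μ
  set Θ := ∫ z, logWeight z ∂μ
  have hβ0 : Tendsto β atTop (𝓝 0) := by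
    have h1 := hlim.mul (tendsto_inv_atTop_zero.comp (tendsto_natCast_atTop_atTop (R := ℝ)))
    rw [mul_zero] at h1
    refine h1.congr' ?_
    filter_upwards [eventually_gt_atTop 0] with M hM
    have : (M : ℝ) ≠ 0 := by exact_mod_cast hM.ne'
    simp only [Function.comp_apply]
    field_simp
  have hγ : 0 ≤ γ := ge_of_tendsto' hlim fun M => mul_nonneg (Nat.cast_nonneg M) (hβ M).le
  -- With `η` fixed, the self-energy `β log η` disappears as `M → ∞`; only the error `γ K η^{1/4}`
  -- survives.
  obtain ⟨η, h0, h1, hη⟩ : ∃ η : ℝ, 0 < η ∧ η ≤ 1 ∧ γ * (K * η ^ (1 / 4 : ℝ)) < ε := by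
    have l : Tendsto (fun η : ℝ => γ * (K * η ^ (1 / 4 : ℝ))) (𝓝[>] 0) (𝓝 0) := by
      have : ContinuousAt (fun η : ℝ => γ * (K * η ^ (1 / 4 : ℝ))) 0 :=
        continuousAt_const.mul (continuousAt_const.mul
          (Real.continuousAt_rpow_const _ _ (Or.inr (by norm_num))))
      have h2 := this.tendsto
      rw [Real.zero_rpow (by norm_num), mul_zero, mul_zero] at h2
      exact h2.mono_left nhdsWithin_le_nhds
    obtain ⟨η, hη⟩ := ((l.eventually_lt_const hε).and (Ioc_mem_nhdsGT (zero_lt_one' ℝ))).exists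
    exact ⟨η, hη.2.1, hη.2.2, hη.1⟩
  -- The exponent per particle of the upper bound, minus that of Jensen's lower bound. The terms in
  -- `G` cancel in the limit.
  have lim1 : Tendsto (fun M : ℕ => |(M : ℝ) * β M - γ| * B
      + ((M : ℝ) * β M * (K * η ^ (1 / 4 : ℝ)) + (M : ℝ) * β M * G / 2 - β M * Real.log η / 4)
      - (((M : ℝ) * β M - β M - γ) * Θ - ((M : ℝ) * β M - β M) / 2 * G + γ * G)) atTop
      (𝓝 (|γ - γ| * B + (γ * (K * η ^ (1 / 4 : ℝ)) + γ * G / 2 - 0 * Real.log η / 4)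
      - ((γ - 0 - γ) * Θ - (γ - 0) / 2 * G + γ * G))) := by
    have a1 := (hlim.sub_const γ).abs.mul_const B
    have a2 := ((hlim.mul_const (K * η ^ (1 / 4 : ℝ))).add ((hlim.mul_const G).div_const 2)).sub
      ((hβ0.mul_const (Real.log η)).div_const 4)
    have a3 := ((((hlim.sub hβ0).sub_const γ).mul_const Θ).sub
      (((hlim.sub hβ0).div_const 2).mul_const G)).add_const (γ * G)
    exact (a1.add a2).sub a3
  have lim2 : Tendsto (fun M : ℕ => |(M : ℝ) * β M - γ|) atTop (𝓝 |γ - γ|) := (hlim.sub_const γ).abs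
  have lt1 : |γ - γ| * B + (γ * (K * η ^ (1 / 4 : ℝ)) + γ * G / 2 - 0 * Real.log η / 4)
      - ((γ - 0 - γ) * Θ - (γ - 0) / 2 * G + γ * G) < ε := by
    rw [sub_self, abs_zero]; linarith
  filter_upwards [lim1.eventually_lt_const lt1, lim2.eventually_lt_const (by simpa using hε)]
    with M hM1 hM2 x
  by_cases hx : Function.Injective x
  · have low := h.lintegral_tilt_ge γ (β M) M
    refine le_trans ?_ (mul_le_mul_right low _)
    rw [← ENNReal.ofReal_prod_of_nonneg fun j _ => by positivity,
      ← ENNReal.ofReal_mul (Finset.prod_nonneg fun j _ => by positivity)]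
    refine ENNReal.ofReal_le_ofReal ?_
    have e1 : ∏ j, (Real.exp ε * (1 + ‖x j‖) ^ ε) = Real.exp (M * ε + ε * ∑ j, logWeight (x j)) := by
      rw [Real.exp_add, Finset.mul_sum, Real.exp_sum, Finset.prod_mul_distrib]
      simp only [Finset.prod_const, Finset.card_univ, Fintype.card_fin]
      rw [Real.exp_nat_mul]
      congr 1
      refine Finset.prod_congr rfl fun j _ => ?_
      rw [Real.rpow_def_of_pos (by positivity), logWeight, mul_comm]
    rw [e1, tilt_eq_exp γ μ _ hx, ← Real.exp_add, Real.exp_le_exp]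
    refine (h.logTilt_le hK γ (hβ M).le h0 h1 hx).trans ?_
    set T := ∑ j, logWeight (x j)
    set S := ∑ j, potential 0 μ (x j)
    have hT : 0 ≤ T := Finset.sum_nonneg fun j _ => logWeight_nonneg _
    have hS0 : 0 ≤ S := Finset.sum_nonneg fun j _ => potential_nonneg le_rfl zero_le_one _
    have hS : S ≤ M * B := by
      calc S ≤ ∑ _j : Fin M, B := Finset.sum_le_sum fun j _ => hB _
        _ = _ := by simp
    have hMn : (0 : ℝ) ≤ M := Nat.cast_nonneg M
    -- The potentials are bounded by `B`, but `T` is not bounded in terms of `M`; it is the origin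
    -- of the weight `(1+|x|)^ε`.
    have h3 : (β M * M - γ) * (T - S) ≤ ε * T + |(M : ℝ) * β M - γ| * (M * B) := by
      have a1 : (β M * M - γ) * T ≤ |(M : ℝ) * β M - γ| * T := by
        gcongr
        rw [mul_comm (M : ℝ)]
        exact le_abs_self _
      have a2 : -((β M * M - γ) * S) ≤ |(M : ℝ) * β M - γ| * S := by
        rw [← neg_mul]
        gcongr
        rw [mul_comm (M : ℝ)]
        exact neg_le_abs _
      have a3 : |(M : ℝ) * β M - γ| * T ≤ ε * T := by gcongr
      have a4 : |(M : ℝ) * β M - γ| * S ≤ |(M : ℝ) * β M - γ| * (M * B) := by gcongr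
      linarith
    have h4 := mul_le_mul_of_nonneg_left hM1.le hMn
    nlinarith
  · unfold tilt
    rw [pairProd_eq_zero (hβ M).ne' hx, zero_mul, ENNReal.ofReal_zero]
    exact zero_le

end LogGas

end

/-! ### The Gibbs measure seen from the equilibrium measure -/

noncomputable section

namespace LogGas

variable {X : Type*} [NormedAddCommGroup X] [InnerProductSpace ℝ X] [FiniteDimensional ℝ X]
  [MeasurableSpace X] [BorelSpace X]

/-- The measure `r dx`. -/
def baseMeasure (r : X → ℝ) : Measure X := volume.withDensity fun x => ENNReal.ofReal (r x)

/-- The partition function of `M` particles. -/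
def gasPartition (r : X → ℝ) (β : ℝ) (M : ℕ) : ℝ≥0∞ :=
  ∫⁻ x : Fin M → X, ENNReal.ofReal (pairProd β x) ∂(Measure.pi fun _ => baseMeasure r)

/-- The Gibbs measure of `M` particles. -/
def gasMeasure (r : X → ℝ) (β : ℝ) (M : ℕ) : Measure (Fin M → X) :=
  (gasPartition r β M)⁻¹ •
    (Measure.pi fun _ => baseMeasure r).withDensity fun x => ENNReal.ofReal (pairProd β x)

instance (r : X → ℝ) : SigmaFinite (baseMeasure r) := by unfold baseMeasure; infer_instance

lemma lintegral_gasMeasure (r : X → ℝ) (β : ℝ) {M : ℕ} {F : (Fin M → X) → ℝ≥0∞} (hF : Measurable F) :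
    ∫⁻ x, F x ∂(gasMeasure r β M) = (gasPartition r β M)⁻¹
      * ∫⁻ x, F x * ENNReal.ofReal (pairProd β x) ∂(Measure.pi fun _ => baseMeasure r) := by
  rw [gasMeasure, lintegral_smul_measure, lintegral_withDensity_eq_lintegral_mul _ (by fun_prop) hF,
    smul_eq_mul]
  congr 1
  exact lintegral_congr fun x => mul_comm _ _

lemma IsWeight.gasPartition_ne_top {r : X → ℝ} (hr : IsWeight r) {β : ℝ} (hβ : 0 ≤ β) (M : ℕ) :
    gasPartition r β M ≠ ⊤ := by
  have hm := hr.meas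
  have hle : gasPartition r β M ≤ ∫⁻ x : Fin M → X, ∏ i, ENNReal.ofReal ((1 + ‖x i‖) ^ (β * M))
      ∂(Measure.pi fun _ => baseMeasure r) := by
    refine lintegral_mono fun x => ?_
    rw [← ENNReal.ofReal_prod_of_nonneg fun i _ => by positivity]
    exact ENNReal.ofReal_le_ofReal (pairProd_le hβ x)
  refine ne_top_of_le_ne_top ?_ hle
  rw [lintegral_pi_prod (fun _ => baseMeasure r)
    (f := fun _ y => ENNReal.ofReal ((1 + ‖y‖) ^ (β * M))) fun i => by fun_prop]
  refine ENNReal.prod_ne_top fun i _ => ?_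
  rw [baseMeasure, lintegral_withDensity_eq_lintegral_mul _ (by fun_prop) (by fun_prop)]
  have h := (hr.integrable_mul_rpow (κ := β * M) (by positivity)).2
  rw [hasFiniteIntegral_iff_ofReal (ae_of_all _ fun x => mul_nonneg (hr.nonneg x) (by positivity))] at h
  refine ne_of_lt (lt_of_eq_of_lt (lintegral_congr fun x => ?_) h)
  rw [Pi.mul_apply, ← ENNReal.ofReal_mul (hr.nonneg x)]

variable [Nontrivial X]

/-- The self-consistency equation solved for `r dx`; the exponential factor is positive, hence can
be inverted. -/
lemma IsSelfConsistent.baseMeasure_eq {r : X → ℝ} (hr : IsWeight r) {γ c : ℝ} {μ : Measure X}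
    (h : IsSelfConsistent r γ μ c) : baseMeasure r
      = μ.withDensity fun x => ENNReal.ofReal (c * Real.exp (-γ * (logWeight x - potential 0 μ x))) := by
  have hm := hr.meas
  have hp := h.tame.measurable_potential
  have hc := h.pos
  have key : ∀ G : X → ℝ≥0∞, Measurable G → μ.withDensity G = volume.withDensity
      ((fun x => ENNReal.ofReal (r x * Real.exp (γ * (logWeight x - potential 0 μ x)) / c)) * G) := by
    intro G hG
    rw [withDensity_mul _ (by fun_prop) hG, ← h.eq]
  rw [key _ (by fun_prop), baseMeasure]
  congr 1
  funext x
  rw [Pi.mul_apply, ← ENNReal.ofReal_mul (by have := hr.nonneg x; positivity)]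
  congr 1
  have : Real.exp (-γ * (logWeight x - potential 0 μ x))
      = (Real.exp (γ * (logWeight x - potential 0 μ x)))⁻¹ := by
    rw [← Real.exp_neg]; congr 1; ring
  rw [this]
  field_simp

lemma measurable_tilt {μ : Measure X} (h : IsTame μ) (γ β : ℝ) {M : ℕ} :
    Measurable (fun x : Fin M → X => tilt γ μ β x) := by
  have hp := h.measurable_potential
  unfold tilt
  fun_prop

/-- The change of reference measure from `r dx` to `μ`. The factor `c^M` cancels in expectations. -/
lemma IsSelfConsistent.lintegral_mul_pairProd {r : X → ℝ} (hr : IsWeight r) {γ c : ℝ} {μ : Measure X}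
    (h : IsSelfConsistent r γ μ c) (β : ℝ) {M : ℕ} {F : (Fin M → X) → ℝ≥0∞} (hF : Measurable F) :
    ∫⁻ x, F x * ENNReal.ofReal (pairProd β x) ∂(Measure.pi fun _ => baseMeasure r)
      = ENNReal.ofReal c ^ M * ∫⁻ x, F x * ENNReal.ofReal (tilt γ μ β x) ∂(Measure.pi fun _ => μ) := by
  have hμ := h.tame.prob
  have hp := h.tame.measurable_potential
  have ht := measurable_tilt h.tame γ β (M := M)
  rw [h.baseMeasure_eq hr, pi_withDensity_ofReal _ (by fun_prop),
    lintegral_withDensity_eq_lintegral_mul _ (by fun_prop) (by fun_prop),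
    ← lintegral_const_mul _ (by fun_prop)]
  refine lintegral_congr fun x => ?_
  rw [Pi.mul_apply, tilt, ENNReal.ofReal_mul (pairProd_nonneg β x),
    ENNReal.ofReal_prod_of_nonneg fun _ _ => (Real.exp_pos _).le]
  simp_rw [ENNReal.ofReal_mul h.pos.le]
  rw [Finset.prod_mul_distrib]
  simp only [Finset.prod_const, Finset.card_univ, Fintype.card_fin]
  ring

lemma IsSelfConsistent.gasPartition_eq {r : X → ℝ} (hr : IsWeight r) {γ c : ℝ} {μ : Measure X}
    (h : IsSelfConsistent r γ μ c) (β : ℝ) (M : ℕ) :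
    gasPartition r β M
      = ENNReal.ofReal c ^ M * ∫⁻ x : Fin M → X, ENNReal.ofReal (tilt γ μ β x) ∂(Measure.pi fun _ => μ) := by
  unfold gasPartition
  simpa using h.lintegral_mul_pairProd hr β (F := fun _ : Fin M → X => 1) measurable_const

lemma IsSelfConsistent.lintegral_tilt_ne_zero {r : X → ℝ} {γ c : ℝ} {μ : Measure X}
    (h : IsSelfConsistent r γ μ c) (β : ℝ) (M : ℕ) :
    ∫⁻ x : Fin M → X, ENNReal.ofReal (tilt γ μ β x) ∂(Measure.pi fun _ => μ) ≠ 0 := by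
  refine ne_of_gt (lt_of_lt_of_le ?_ (h.tame.lintegral_tilt_ge γ β M))
  rw [ENNReal.ofReal_pos]
  exact Real.exp_pos _

lemma IsSelfConsistent.gasPartition_ne_zero {r : X → ℝ} (hr : IsWeight r) {γ c : ℝ} {μ : Measure X}
    (h : IsSelfConsistent r γ μ c) (β : ℝ) (M : ℕ) : gasPartition r β M ≠ 0 := by
  rw [h.gasPartition_eq hr]
  exact mul_ne_zero (pow_ne_zero _ (by simpa using h.pos)) (h.lintegral_tilt_ne_zero β M)

lemma IsSelfConsistent.isProbabilityMeasure_gasMeasure {r : X → ℝ} (hr : IsWeight r) {γ c : ℝ}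
    {μ : Measure X} (h : IsSelfConsistent r γ μ c) {β : ℝ} (hβ : 0 ≤ β) (M : ℕ) :
    IsProbabilityMeasure (gasMeasure r β M) := by
  refine ⟨?_⟩
  have e := lintegral_gasMeasure r β (M := M) (F := fun _ => 1) measurable_const
  rw [lintegral_one] at e
  rw [e]
  simp only [one_mul]
  exact ENNReal.inv_mul_cancel (h.gasPartition_ne_zero hr β M) (hr.gasPartition_ne_top hβ M)

lemma IsSelfConsistent.lintegral_gasMeasure_eq {r : X → ℝ} (hr : IsWeight r) {γ c : ℝ} {μ : Measure X}
    (h : IsSelfConsistent r γ μ c) (β : ℝ) {M : ℕ} {F : (Fin M → X) → ℝ≥0∞} (hF : Measurable F) :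
    ∫⁻ x, F x ∂(gasMeasure r β M)
      = (∫⁻ x : Fin M → X, ENNReal.ofReal (tilt γ μ β x) ∂(Measure.pi fun _ => μ))⁻¹
        * ∫⁻ x, F x * ENNReal.ofReal (tilt γ μ β x) ∂(Measure.pi fun _ => μ) := by
  have hc0 : ENNReal.ofReal c ^ M ≠ 0 := pow_ne_zero _ (by simpa using h.pos)
  have hct : ENNReal.ofReal c ^ M ≠ ⊤ := ENNReal.pow_ne_top ENNReal.ofReal_ne_top
  rw [lintegral_gasMeasure r β hF, h.lintegral_mul_pairProd hr β hF, h.gasPartition_eq hr,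
    ENNReal.mul_inv (Or.inl hc0) (Or.inl hct), mul_comm (ENNReal.ofReal c ^ M)⁻¹, mul_assoc,
    ← mul_assoc (ENNReal.ofReal c ^ M)⁻¹, ENNReal.inv_mul_cancel hc0 hct, one_mul]

/-- Domination of the Gibbs measure by almost `μ^{⊗M}`, for product test functions. -/
theorem IsSelfConsistent.eventually_lintegral_prod_le {r : X → ℝ} (hr : IsWeight r) {γ c : ℝ}
    {μ : Measure X} (h : IsSelfConsistent r γ μ c) {β : ℕ → ℝ}
    (hβ : ∀ M, 0 < β M) (hlim : Tendsto (fun M : ℕ => (M : ℝ) * β M) atTop (𝓝 γ)) {ε : ℝ} (hε : 0 < ε) :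
    ∀ᶠ M : ℕ in atTop, ∀ φ : X → ℝ≥0∞, Measurable φ →
      ∫⁻ x : Fin M → X, ∏ j, φ (x j) ∂(gasMeasure r (β M) M)
        ≤ (∫⁻ x, φ x * ENNReal.ofReal (Real.exp ε * (1 + ‖x‖) ^ ε) ∂μ) ^ M := by
  have hμ := h.tame.prob
  filter_upwards [h.tame.eventually_tilt_le hβ hlim hε] with M hM φ hφ
  have hpm : Measurable (fun x : Fin M → X => ∏ j, φ (x j)) :=
    Finset.measurable_fun_prod _ fun i _ => hφ.comp (measurable_pi_apply i)
  rw [h.lintegral_gasMeasure_eq hr (β M) hpm]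
  set I := ∫⁻ x : Fin M → X, ENNReal.ofReal (tilt γ μ (β M) x) ∂(Measure.pi fun _ => μ)
  have hI0 : I ≠ 0 := h.lintegral_tilt_ne_zero _ _
  have hIt : I ≠ ⊤ := by
    intro hc
    have := h.gasPartition_eq hr (β M) M
    rw [show (∫⁻ x : Fin M → X, ENNReal.ofReal (tilt γ μ (β M) x) ∂(Measure.pi fun _ => μ)) = ⊤ from hc,
      ENNReal.mul_top (pow_ne_zero _ (by simpa using h.pos))] at this
    exact hr.gasPartition_ne_top (hβ M).le M this
  calc I⁻¹ * ∫⁻ x : Fin M → X, (∏ j, φ (x j)) * ENNReal.ofReal (tilt γ μ (β M) x)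
        ∂(Measure.pi fun _ => μ)
      ≤ I⁻¹ * ∫⁻ x : Fin M → X, (∏ j, φ (x j)) * ((∏ j, ENNReal.ofReal (Real.exp ε * (1 + ‖x j‖) ^ ε)) * I)
        ∂(Measure.pi fun _ => μ) := by
        gcongr with x
        exact hM x
    _ = I⁻¹ * (I * ∫⁻ x : Fin M → X, ∏ j, (φ (x j) * ENNReal.ofReal (Real.exp ε * (1 + ‖x j‖) ^ ε))
        ∂(Measure.pi fun _ => μ)) := by
        rw [← lintegral_const_mul' _ _ hIt]
        congr 1
        refine lintegral_congr fun x => ?_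
        rw [Finset.prod_mul_distrib]; ring
    _ = ∫⁻ x : Fin M → X, ∏ j, (φ (x j) * ENNReal.ofReal (Real.exp ε * (1 + ‖x j‖) ^ ε))
        ∂(Measure.pi fun _ => μ) := by
        rw [← mul_assoc, ENNReal.inv_mul_cancel hI0 hIt, one_mul]
    _ = _ := by
        rw [lintegral_pi_prod (fun _ => μ)
          (f := fun _ y => φ y * ENNReal.ofReal (Real.exp ε * (1 + ‖y‖) ^ ε)) fun i => by fun_prop]
        simp

lemma ae_gasMeasure_ne {r : X → ℝ} (β : ℝ) (M : ℕ) (u : X) :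
    ∀ᵐ x ∂(gasMeasure r β M), ∀ j, x j ≠ u := by
  have hac : gasMeasure r β M ≪ Measure.pi fun _ => baseMeasure r :=
    Measure.smul_absolutelyContinuous.trans (withDensity_absolutelyContinuous _ _)
  refine hac.ae_le (ae_all_iff.2 fun j => ?_)
  refine (Measure.quasiMeasurePreserving_eval (μ := fun _ : Fin M => baseMeasure r) j).ae
    (p := fun y => y ≠ u) ?_
  have hac2 : baseMeasure r ≪ volume := withDensity_absolutelyContinuous _ _
  exact hac2.ae_le (Measure.ae_ne _ u)

/-- Hölder's inequality against the constant `1`. Used with `t` of order `1/M`, it reduces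
exponential losses `e^{εM}` to bounded ones. -/
lemma lintegral_rpow_le_rpow_lintegral {Y : Type*} [MeasurableSpace Y] {τ : Measure Y}
    [IsProbabilityMeasure τ] {F : Y → ℝ≥0∞} (hF : Measurable F) {t : ℝ} (h0 : 0 < t) (h1 : t < 1) :
    ∫⁻ x, F x ^ t ∂τ ≤ (∫⁻ x, F x ∂τ) ^ t := by
  have hpq : (1 / t).HolderConjugate (1 / (1 - t)) := by
    refine Real.holderConjugate_iff.2 ⟨by rw [lt_div_iff₀ h0]; linarith, ?_⟩
    simp
  have h := ENNReal.lintegral_mul_le_Lp_mul_Lq τ hpq (f := fun x => F x ^ t) (g := fun _ => 1)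
    (hF.pow_const t).aemeasurable measurable_const.aemeasurable
  simp only [Pi.mul_apply, mul_one, ENNReal.one_rpow, lintegral_one, measure_univ] at h
  simp_rw [← ENNReal.rpow_mul] at h
  rw [mul_one_div_cancel h0.ne'] at h
  simpa using h

end LogGas

end

/-! ### Concentration of the insertion factor -/

noncomputable section

namespace LogGas

variable {X : Type*} [NormedAddCommGroup X] [InnerProductSpace ℝ X] [FiniteDimensional ℝ X]
  [MeasurableSpace X] [BorelSpace X] [Nontrivial X]

lemma IsTame.lintegral_sq_ne_top {μ : Measure X} (h : IsTame μ) :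
    ∫⁻ x, ENNReal.ofReal ((1 + ‖x‖) ^ 2) ∂μ ≠ ⊤ := by
  have := h.integrable_sq.2
  rw [hasFiniteIntegral_iff_ofReal (ae_of_all _ fun x => by positivity)] at this
  exact this.ne

lemma norm_sub_le_mul (x v : X) : ‖x - v‖ ≤ (1 + ‖x‖) * (1 + ‖v‖) := by
  have := norm_sub_le x v
  nlinarith [norm_nonneg x, norm_nonneg v, mul_nonneg (norm_nonneg x) (norm_nonneg v)]

/-- Local uniform bounds for small moments of `|x - v|`, positive or negative. -/
lemma IsTame.exists_lintegral_rpow_le {μ : Measure X} (h : IsTame μ) {s : ℝ} (hs : |s| ≤ 1 / 2) (u : X) :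
    ∃ D : ℝ≥0, ∀ v ∈ Metric.ball u 1, ∫⁻ x, ENNReal.ofReal (‖x - v‖ ^ s) ∂μ ≤ D := by
  obtain ⟨hs1, hs2⟩ := abs_le.1 hs
  rcases le_total s 0 with h0 | h0
  · obtain ⟨K, hK⟩ := h.exists_riesz_bound
    refine ⟨K, fun v _ => ?_⟩
    have := hK (-s) (by linarith) (by linarith) v
    simpa [norm_sub_rev v] using this
  · set I := ∫⁻ x, ENNReal.ofReal ((1 + ‖x‖) ^ 2) ∂μ
    have hI : I ≠ ⊤ := h.lintegral_sq_ne_top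
    refine ⟨(ENNReal.ofReal (2 + ‖u‖) * I).toNNReal, fun v hv => ?_⟩
    rw [ENNReal.coe_toNNReal (by finiteness), ← lintegral_const_mul' _ _ ENNReal.ofReal_ne_top]
    refine lintegral_mono fun x => ?_
    rw [← ENNReal.ofReal_mul (by positivity)]
    refine ENNReal.ofReal_le_ofReal ?_
    have hv' : ‖v‖ ≤ ‖u‖ + 1 := by
      have h1 := mem_ball_iff_norm.1 hv
      have h2 : ‖v‖ ≤ ‖u‖ + ‖v - u‖ := by
        calc ‖v‖ = ‖u + (v - u)‖ := by congr 1; abel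
          _ ≤ _ := norm_add_le _ _
      linarith
    have hx := norm_nonneg x
    have h1 : 1 ≤ (1 + ‖x‖) * (1 + ‖v‖) := by nlinarith [norm_nonneg v, mul_nonneg hx (norm_nonneg v)]
    calc ‖x - v‖ ^ s ≤ ((1 + ‖x‖) * (1 + ‖v‖)) ^ s :=
          Real.rpow_le_rpow (norm_nonneg _) (norm_sub_le_mul x v) h0
      _ ≤ ((1 + ‖x‖) * (1 + ‖v‖)) ^ (1 : ℝ) := Real.rpow_le_rpow_of_exponent_le h1 (by linarith)
      _ = (1 + ‖x‖) * (1 + ‖v‖) := Real.rpow_one _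
      _ ≤ (1 + ‖x‖) ^ 2 * (2 + ‖u‖) := by
          have : (1 + ‖x‖) ≤ (1 + ‖x‖) ^ 2 := by nlinarith
          exact mul_le_mul this (by linarith) (by positivity) (by positivity)
      _ = _ := by ring

/-- Upper semicontinuity of perturbed moments of `|x - v|`. -/
lemma IsTame.eventually_lintegral_rpow_lt {μ : Measure X} (h : IsTame μ) {s : ℝ} (hs : |s| ≤ 1 / 8)
    (u : X) {A : ℝ≥0∞} (hA : ∫⁻ x, ENNReal.ofReal (‖x - u‖ ^ s) ∂μ < A) :
    ∀ᶠ p : ℝ × X in 𝓝[>] 0 ×ˢ 𝓝 u, ∫⁻ x, ENNReal.ofReal (‖x - p.2‖ ^ s)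
      * ENNReal.ofReal (Real.exp p.1 * (1 + ‖x‖) ^ p.1) ∂μ < A := by
  have hμ := h.prob
  set Φ := ∫⁻ x, ENNReal.ofReal (‖x - u‖ ^ s) ∂μ
  -- The square of `|x-v|^s` times the weight is dominated by its fourth power and `(1+|x|)²`; `|s|
  -- ≤ 1/8` keeps `4s` in the integrable range.
  obtain ⟨D, hD⟩ := h.exists_lintegral_rpow_le (s := 4 * s)
    (by rw [abs_mul, abs_of_pos (by norm_num : (0:ℝ) < 4)]; linarith) u
  set I := ∫⁻ x, ENNReal.ofReal ((1 + ‖x‖) ^ 2) ∂μ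
  have hI : I ≠ ⊤ := h.lintegral_sq_ne_top
  set D' : ℝ≥0∞ := ENNReal.ofReal (Real.exp 1) * (D + I) with hD'
  have hD't : D' ≠ ⊤ := by finiteness
  -- Truncation at height `T`: the bounded part converges by domination, and the excess is at most
  -- `y²/T`, uniformly small.
  obtain ⟨T, hT0, hT⟩ : ∃ T : ℝ, 0 < T ∧ Φ + ENNReal.ofReal T⁻¹ * D' < A := by
    have l : Tendsto (fun T : ℝ => Φ + ENNReal.ofReal T⁻¹ * D') atTop
        (𝓝 (Φ + ENNReal.ofReal 0 * D')) := by
      refine tendsto_const_nhds.add (ENNReal.Tendsto.mul_const ?_ (Or.inr hD't))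
      exact ENNReal.tendsto_ofReal tendsto_inv_atTop_zero
    rw [ENNReal.ofReal_zero, zero_mul, add_zero] at l
    obtain ⟨T, h1, h2⟩ := ((eventually_gt_atTop (0:ℝ)).and (l.eventually_lt_const hA)).exists
    exact ⟨T, h1, h2⟩
  have hfst : Tendsto (fun p : ℝ × X => p.1) (𝓝[>] 0 ×ˢ 𝓝 u) (𝓝 0) :=
    tendsto_fst.mono_right nhdsWithin_le_nhds
  have hsnd : Tendsto (fun p : ℝ × X => p.2) (𝓝[>] 0 ×ˢ 𝓝 u) (𝓝 u) := tendsto_snd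
  have hev1 : ∀ᶠ p : ℝ × X in 𝓝[>] 0 ×ˢ 𝓝 u, p.1 ∈ Set.Ioc (0:ℝ) 1 :=
    tendsto_fst.eventually (Ioc_mem_nhdsGT (zero_lt_one' ℝ))
  have hev2 : ∀ᶠ p : ℝ × X in 𝓝[>] 0 ×ˢ 𝓝 u, p.2 ∈ Metric.ball u 1 :=
    hsnd.eventually (Metric.ball_mem_nhds u one_pos)
  have hw : ∀ ε : ℝ, ε ∈ Set.Ioc (0:ℝ) 1 → ∀ x : X,
      Real.exp ε * (1 + ‖x‖) ^ ε ≤ Real.exp 1 * (1 + ‖x‖) := by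
    intro ε hε x
    have : (1 + ‖x‖) ^ ε ≤ (1 + ‖x‖) ^ (1:ℝ) :=
      Real.rpow_le_rpow_of_exponent_le (by linarith [norm_nonneg x]) hε.2
    rw [Real.rpow_one] at this
    gcongr
    exact hε.2
  have lim : Tendsto (fun p : ℝ × X => ∫⁻ x, ENNReal.ofReal (min (‖x - p.2‖ ^ s) T)
      * ENNReal.ofReal (Real.exp p.1 * (1 + ‖x‖) ^ p.1) ∂μ) (𝓝[>] 0 ×ˢ 𝓝 u)
      (𝓝 (∫⁻ x, ENNReal.ofReal (min (‖x - u‖ ^ s) T) ∂μ)) := by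
    refine tendsto_lintegral_filter_of_dominated_convergence
      (fun x => ENNReal.ofReal (T * Real.exp 1) * ENNReal.ofReal ((1 + ‖x‖) ^ 2))
      (Eventually.of_forall fun p => by fun_prop) ?_ ?_ ?_
    · filter_upwards [hev1] with p hp
      refine ae_of_all _ fun x => ?_
      rw [← ENNReal.ofReal_mul (le_min (by positivity) hT0.le), ← ENNReal.ofReal_mul (by positivity)]
      refine ENNReal.ofReal_le_ofReal ?_
      calc min (‖x - p.2‖ ^ s) T * (Real.exp p.1 * (1 + ‖x‖) ^ p.1)
          ≤ T * (Real.exp 1 * (1 + ‖x‖)) :=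
            mul_le_mul (min_le_right _ _) (hw _ hp x) (by positivity) hT0.le
        _ ≤ T * Real.exp 1 * (1 + ‖x‖) ^ 2 := by
            rw [← mul_assoc]
            gcongr
            nlinarith [norm_nonneg x]
    · rw [lintegral_const_mul' _ _ ENNReal.ofReal_ne_top]
      exact ENNReal.mul_ne_top ENNReal.ofReal_ne_top hI
    · filter_upwards [h.ae_ne u] with x hx
      have hxu : ‖x - u‖ ≠ 0 := (norm_pos_iff.2 (sub_ne_zero.2 hx.symm)).ne'
      have t1 : Tendsto (fun p : ℝ × X => ‖x - p.2‖ ^ s) (𝓝[>] 0 ×ˢ 𝓝 u) (𝓝 (‖x - u‖ ^ s)) :=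
        ((tendsto_const_nhds.sub hsnd).norm).rpow_const (Or.inl hxu)
      have t2 : Tendsto (fun p : ℝ × X => Real.exp p.1 * (1 + ‖x‖) ^ p.1) (𝓝[>] 0 ×ˢ 𝓝 u)
          (𝓝 (Real.exp 0 * (1 + ‖x‖) ^ (0:ℝ))) := by
        refine ((Real.continuous_exp.tendsto 0).comp hfst).mul ?_
        exact ((Real.continuous_const_rpow (a := 1 + ‖x‖) (by positivity)).tendsto 0).comp hfst
      rw [Real.exp_zero, Real.rpow_zero, mul_one] at t2
      have t3 := ENNReal.Tendsto.mul (ENNReal.tendsto_ofReal (t1.min (tendsto_const_nhds (x := T))))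
        (Or.inr ENNReal.ofReal_ne_top) (ENNReal.tendsto_ofReal t2) (Or.inr ENNReal.ofReal_ne_top)
      rwa [ENNReal.ofReal_one, mul_one] at t3
  have hlt : ∫⁻ x, ENNReal.ofReal (min (‖x - u‖ ^ s) T) ∂μ + ENNReal.ofReal T⁻¹ * D' < A := by
    refine lt_of_le_of_lt ?_ hT
    gcongr
    exact lintegral_mono fun x => ENNReal.ofReal_le_ofReal (min_le_left _ _)
  have lim2 := lim.add_const (ENNReal.ofReal T⁻¹ * D')
  filter_upwards [lim2.eventually_lt_const hlt, hev1, hev2] with p hp h1 h2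
  refine lt_of_le_of_lt ?_ hp
  have hbound : ∫⁻ x, ENNReal.ofReal ((‖x - p.2‖ ^ s) ^ 2)
      * ENNReal.ofReal (Real.exp p.1 * (1 + ‖x‖) ^ p.1) ∂μ ≤ D' := by
    calc _ ≤ ∫⁻ x, ENNReal.ofReal (Real.exp 1)
          * (ENNReal.ofReal (‖x - p.2‖ ^ (4 * s)) + ENNReal.ofReal ((1 + ‖x‖) ^ 2)) ∂μ := by
          refine lintegral_mono fun x => ?_
          rw [← ENNReal.ofReal_add (by positivity) (by positivity), ← ENNReal.ofReal_mul (by positivity),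
            ← ENNReal.ofReal_mul (by positivity)]
          refine ENNReal.ofReal_le_ofReal ?_
          have e4 : ‖x - p.2‖ ^ (4 * s) = ((‖x - p.2‖ ^ s) ^ 2) ^ 2 := by
            rw [← pow_mul, ← Real.rpow_mul_natCast (norm_nonneg _)]
            congr 1; push_cast; ring
          rw [e4]
          set a := (‖x - p.2‖ ^ s) ^ 2
          have ha : 0 ≤ a := by positivity
          calc a * (Real.exp p.1 * (1 + ‖x‖) ^ p.1) ≤ a * (Real.exp 1 * (1 + ‖x‖)) := by
                gcongr ?_ * ?_
                exact hw _ h1 x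
            _ = Real.exp 1 * (a * (1 + ‖x‖)) := by ring
            _ ≤ _ := by
                gcongr
                nlinarith [sq_nonneg (a - (1 + ‖x‖)), sq_nonneg a, sq_nonneg (1 + ‖x‖)]
      _ = ENNReal.ofReal (Real.exp 1) * (∫⁻ x, ENNReal.ofReal (‖x - p.2‖ ^ (4 * s)) ∂μ + I) := by
          rw [lintegral_const_mul' _ _ ENNReal.ofReal_ne_top, lintegral_add_left (by fun_prop)]
      _ ≤ D' := by
          rw [hD']
          gcongr
          exact hD _ h2
  calc _ ≤ ∫⁻ x, (ENNReal.ofReal (min (‖x - p.2‖ ^ s) T)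
        * ENNReal.ofReal (Real.exp p.1 * (1 + ‖x‖) ^ p.1) + ENNReal.ofReal T⁻¹
          * (ENNReal.ofReal ((‖x - p.2‖ ^ s) ^ 2)
            * ENNReal.ofReal (Real.exp p.1 * (1 + ‖x‖) ^ p.1))) ∂μ := by
        refine lintegral_mono fun x => ?_
        rw [← mul_assoc, ← add_mul]
        gcongr
        rw [← ENNReal.ofReal_mul (by positivity), ← ENNReal.ofReal_add (le_min (by positivity) hT0.le)
          (by positivity)]
        refine ENNReal.ofReal_le_ofReal ?_
        set y := ‖x - p.2‖ ^ s
        have hy : 0 ≤ y := by positivity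
        rcases le_total y T with hyT | hyT
        · rw [min_eq_left hyT]
          have : 0 ≤ T⁻¹ * y ^ 2 := by positivity
          linarith
        · rw [min_eq_right hyT]
          have : y ≤ T⁻¹ * y ^ 2 := by
            rw [inv_mul_eq_div, le_div_iff₀ hT0]; nlinarith
          linarith
    _ = _ + ENNReal.ofReal T⁻¹ * ∫⁻ x, ENNReal.ofReal ((‖x - p.2‖ ^ s) ^ 2)
            * ENNReal.ofReal (Real.exp p.1 * (1 + ‖x‖) ^ p.1) ∂μ := by
        rw [lintegral_add_left (by fun_prop), lintegral_const_mul' _ _ ENNReal.ofReal_ne_top]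
    _ ≤ _ := by gcongr

/-- The logarithmic potential `∫ log |x - u| μ(dx)`. -/
def logPotential (μ : Measure X) (u : X) : ℝ := ∫ x, Real.log ‖x - u‖ ∂μ

lemma IsTame.integrable_rpow {μ : Measure X} (h : IsTame μ) {s : ℝ} (hs : |s| ≤ 1 / 2) (u : X) :
    Integrable (fun x => ‖x - u‖ ^ s) μ := by
  obtain ⟨D, hD⟩ := h.exists_lintegral_rpow_le hs u
  refine ⟨Measurable.aestronglyMeasurable (by fun_prop), ?_⟩
  rw [hasFiniteIntegral_iff_ofReal (ae_of_all _ fun y => by positivity)]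
  exact (hD u (Metric.mem_ball_self one_pos)).trans_lt ENNReal.coe_lt_top

lemma IsTame.exp_log_ae {μ : Measure X} (h : IsTame μ) (s : ℝ) (u : X) :
    (fun x => Real.exp (s * Real.log ‖x - u‖)) =ᵐ[μ] fun x => ‖x - u‖ ^ s := by
  filter_upwards [h.ae_ne u] with x hx
  rw [Real.rpow_def_of_pos (norm_pos_iff.2 (sub_ne_zero.2 hx.symm)), mul_comm]

/-- First order expansion of `∫ |x - u|^s μ(dx)` at `s = 0`. -/
lemma IsTame.eventually_lintegral_rpow_lt_exp {μ : Measure X} (h : IsTame μ) (u : X) {δ : ℝ} (hδ : 0 < δ) :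
    ∀ᶠ s : ℝ in 𝓝[≠] 0, ∫⁻ x, ENNReal.ofReal (‖x - u‖ ^ s) ∂μ
      < ENNReal.ofReal (Real.exp (s * logPotential μ u + |s| * δ)) := by
  have hμ := h.prob
  set Y : X → ℝ := fun x => Real.log ‖x - u‖
  have hintegr : ∀ s : ℝ, |s| ≤ 1 / 2 → s ∈ ProbabilityTheory.integrableExpSet Y μ := fun s hs =>
    (h.integrable_rpow hs u).congr (h.exp_log_ae s u).symm
  have h0 : (0 : ℝ) ∈ interior (ProbabilityTheory.integrableExpSet Y μ) := by
    rw [mem_interior]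
    refine ⟨Metric.ball 0 (1 / 2), fun s hs => hintegr s ?_, Metric.isOpen_ball,
      Metric.mem_ball_self (by norm_num)⟩
    rw [mem_ball_zero_iff, Real.norm_eq_abs] at hs
    exact hs.le
  have hd := ProbabilityTheory.hasDerivAt_mgf h0
  have e0 : ∫ x, (fun x => Y x * Real.exp (0 * Y x)) x ∂μ = logPotential μ u := by
    simp [Y, logPotential]
  rw [e0] at hd
  -- The integral is the moment generating function of `log|x-u|`, with derivative `U(u)` at `0`.
  -- Allowing only `δ/2` here leaves room for a strict inequality.
  have hlo := (hasDerivAt_iff_isLittleO.1 hd).def (half_pos hδ)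
  have hev : ∀ᶠ s : ℝ in 𝓝 0, |s| ≤ 1 / 2 := by
    have : Metric.ball (0:ℝ) (1 / 2) ∈ 𝓝 (0:ℝ) := Metric.ball_mem_nhds _ (by norm_num)
    filter_upwards [this] with s hs
    rw [mem_ball_zero_iff, Real.norm_eq_abs] at hs
    exact hs.le
  filter_upwards [nhdsWithin_le_nhds hlo, nhdsWithin_le_nhds hev, self_mem_nhdsWithin] with s hs hs' hne
  rw [← ofReal_integral_eq_lintegral_ofReal (h.integrable_rpow hs' u)
    (ae_of_all _ fun x => by positivity)]
  rw [ENNReal.ofReal_lt_ofReal_iff (Real.exp_pos _), ← integral_congr_ae (h.exp_log_ae s u)]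
  have hs0 : 0 < |s| := abs_pos.2 hne
  rw [ProbabilityTheory.mgf_zero, sub_zero, Real.norm_eq_abs, Real.norm_eq_abs, smul_eq_mul] at hs
  have h2 := (abs_le.1 hs).2
  have h3 := Real.add_one_le_exp (s * logPotential μ u + |s| * δ)
  have h4 : ProbabilityTheory.mgf Y μ s = ∫ x, Real.exp (s * Real.log ‖x - u‖) ∂μ := rfl
  rw [← h4]
  nlinarith

lemma tendsto_zero_of_natCast_mul {β : ℕ → ℝ} {γ : ℝ}
    (hlim : Tendsto (fun M : ℕ => (M : ℝ) * β M) atTop (𝓝 γ)) : Tendsto β atTop (𝓝 0) := by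
  have h1 := hlim.mul (tendsto_inv_atTop_zero.comp (tendsto_natCast_atTop_atTop (R := ℝ)))
  rw [mul_zero] at h1
  refine h1.congr' ?_
  filter_upwards [eventually_gt_atTop 0] with M hM
  have : (M : ℝ) ≠ 0 := by exact_mod_cast hM.ne'
  simp only [Function.comp_apply]
  field_simp

/-- Exponential moments of the logarithmic statistic under the Gibbs measure. -/
theorem IsSelfConsistent.eventually_lintegral_prod_rpow_le {r : X → ℝ} (hr : IsWeight r) {γ c : ℝ}
    {μ : Measure X} (h : IsSelfConsistent r γ μ c) {β : ℕ → ℝ}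
    (hβ : ∀ M, 0 < β M) (hlim : Tendsto (fun M : ℕ => (M : ℝ) * β M) atTop (𝓝 γ))
    {u : X} {v : ℕ → X} (hv : Tendsto v atTop (𝓝 u)) {p : ℝ} (hp : p ≠ 0) {δ : ℝ} (hδ : 0 < δ) :
    ∀ᶠ M : ℕ in atTop, ∫⁻ x : Fin M → X, ∏ j, ENNReal.ofReal (‖x j - v M‖ ^ (p * β M))
        ∂(gasMeasure r (β M) M)
      ≤ ENNReal.ofReal (Real.exp ((M : ℝ) * β M * (p * logPotential μ u + |p| * δ))) := by
  have hβ0 := tendsto_zero_of_natCast_mul hlim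
  -- A small fixed exponent `s` with the sign of `p`, so that `pβ = s t` with `t > 0`.
  obtain ⟨s, hs0, hs8, hs⟩ : ∃ s : ℝ, 0 < p / s ∧ |s| ≤ 1 / 8 ∧
      ∫⁻ x, ENNReal.ofReal (‖x - u‖ ^ s) ∂μ
        < ENNReal.ofReal (Real.exp (s * logPotential μ u + |s| * δ)) := by
    have l : Tendsto (fun t : ℝ => t * p) (𝓝[>] 0) (𝓝[≠] 0) := by
      refine tendsto_nhdsWithin_iff.2 ⟨?_, ?_⟩
      · have : Tendsto (fun t : ℝ => t * p) (𝓝 0) (𝓝 (0 * p)) := tendsto_id.mul_const p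
        rw [zero_mul] at this
        exact this.mono_left nhdsWithin_le_nhds
      · filter_upwards [self_mem_nhdsWithin] with t ht
        exact mul_ne_zero (ne_of_gt ht) hp
    have h8 : ∀ᶠ s : ℝ in 𝓝[≠] 0, |s| ≤ 1 / 8 := by
      have : Metric.ball (0:ℝ) (1 / 8) ∈ 𝓝 (0:ℝ) := Metric.ball_mem_nhds _ (by norm_num)
      filter_upwards [nhdsWithin_le_nhds this] with s hs
      rw [mem_ball_zero_iff, Real.norm_eq_abs] at hs
      exact hs.le
    obtain ⟨t, ht, ht1, ht2⟩ := ((l.eventually h8).and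
      ((l.eventually (h.tame.eventually_lintegral_rpow_lt_exp u hδ)).and self_mem_nhdsWithin)).exists
    refine ⟨t * p, ?_, ht, ht1⟩
    have : (0:ℝ) < t := ht2
    rw [div_mul_cancel_right₀ hp]
    positivity
  have hsne : s ≠ 0 := by rintro rfl; simp at hs0
  set A := Real.exp (s * logPotential μ u + |s| * δ)
  -- The strict inequality at `u` absorbs both the weight with exponent `ε` and the displacement of
  -- `v M` from `u`.
  obtain ⟨ε, hεv, hε⟩ := ((h.tame.eventually_lintegral_rpow_lt hs8 u hs).curry.and
    self_mem_nhdsWithin).exists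
  have hb1 : ∀ᶠ M in atTop, p / s * β M < 1 := by
    have := hβ0.const_mul (p / s)
    rw [mul_zero] at this
    exact this.eventually_lt_const one_pos
  filter_upwards [h.eventually_lintegral_prod_le hr hβ hlim hε, hv.eventually hεv, hb1] with M h1 h2 h3
  have hprob := h.isProbabilityMeasure_gasMeasure hr (hβ M).le M
  -- Here `M t` stays bounded, so the bound `A^M` raised to the power `t` is of order one.
  set t := p / s * β M with ht
  have ht0 : 0 < t := mul_pos hs0 (hβ M)
  have hts : s * t = p * β M := by rw [ht]; field_simp
  have e1 : ∀ x : Fin M → X, ∏ j, ENNReal.ofReal (‖x j - v M‖ ^ (p * β M))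
      = (∏ j, ENNReal.ofReal (‖x j - v M‖ ^ s)) ^ t := by
    intro x
    rw [← ENNReal.prod_rpow_of_nonneg ht0.le]
    refine Finset.prod_congr rfl fun j _ => ?_
    rw [ENNReal.ofReal_rpow_of_nonneg (by positivity) ht0.le, ← Real.rpow_mul (norm_nonneg _), hts]
  simp_rw [e1]
  have hmeas : Measurable (fun x : Fin M → X => ∏ j, ENNReal.ofReal (‖x j - v M‖ ^ s)) := by fun_prop
  calc _ ≤ (∫⁻ x : Fin M → X, ∏ j, ENNReal.ofReal (‖x j - v M‖ ^ s) ∂(gasMeasure r (β M) M)) ^ t :=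
        lintegral_rpow_le_rpow_lintegral hmeas ht0 h3
    _ ≤ (ENNReal.ofReal A ^ M) ^ t := by
        gcongr
        refine (h1 (fun y => ENNReal.ofReal (‖y - v M‖ ^ s)) (by fun_prop)).trans ?_
        gcongr
    _ = _ := by
        rw [← ENNReal.ofReal_pow (Real.exp_pos _).le, ← Real.exp_nat_mul,
          ENNReal.ofReal_rpow_of_pos (Real.exp_pos _), ← Real.exp_mul]
        congr 2
        have h5 : |s| * t = |p| * β M := by
          rw [← abs_of_pos ht0, ← abs_mul, hts, abs_mul, abs_of_pos (hβ M)]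
        calc (M : ℝ) * (s * logPotential μ u + |s| * δ) * t
            = M * ((s * t) * logPotential μ u + (|s| * t) * δ) := by ring
          _ = _ := by rw [hts, h5]; ring

/-- `∏_j |x_j - v|^β`. -/
def insertFactor (β : ℝ) {M : ℕ} (v : X) (x : Fin M → X) : ℝ := ∏ j, ‖x j - v‖ ^ β

lemma insertFactor_nonneg (β : ℝ) {M : ℕ} (v : X) (x : Fin M → X) : 0 ≤ insertFactor β v x :=
  Finset.prod_nonneg fun _ _ => by positivity

@[fun_prop]
lemma measurable_insertFactor (β : ℝ) {M : ℕ} :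
    Measurable (fun p : X × (Fin M → X) => insertFactor β p.1 p.2) := by
  unfold insertFactor; fun_prop

lemma measurable_insertFactor_right (β : ℝ) {M : ℕ} (v : X) :
    Measurable (fun x : Fin M → X => insertFactor β v x) := by
  unfold insertFactor; fun_prop

/-- Equivalent to `2a(q-a)²/q ≥ 0`. For `a > 0`, `q² + 2a³/q` has minimum `3a²` at `q = a`, with
quadratic growth, so that upper bounds alone on the moments of order `2` and `-1` force
concentration at `a`. -/
lemma sq_sub_add_le {q a : ℝ} (hq : 0 < q) (ha : 0 ≤ a) :
    (q - a) ^ 2 + 3 * a ^ 2 ≤ q ^ 2 + 2 * a ^ 3 * q⁻¹ := by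
  have h : 0 ≤ 2 * a * (q - a) ^ 2 * q⁻¹ := by positivity
  have e : 2 * a * (q - a) ^ 2 * q⁻¹ = 2 * a * q - 4 * a ^ 2 + 2 * a ^ 3 * q⁻¹ := by
    field_simp; ring
  nlinarith

lemma IsSelfConsistent.lintegral_insertFactor_sub_sq_le {r : X → ℝ} (hr : IsWeight r) {γ c : ℝ}
    {μ : Measure X} (h : IsSelfConsistent r γ μ c) {β : ℝ} (hβ : 0 < β) {M : ℕ} (v : X) {a : ℝ}
    (ha : 0 ≤ a) :
    ∫⁻ x : Fin M → X, ENNReal.ofReal ((insertFactor β v x - a) ^ 2) ∂(gasMeasure r β M)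
        + ENNReal.ofReal (3 * a ^ 2)
      ≤ ∫⁻ x : Fin M → X, ∏ j, ENNReal.ofReal (‖x j - v‖ ^ (2 * β)) ∂(gasMeasure r β M)
        + ENNReal.ofReal (2 * a ^ 3)
          * ∫⁻ x : Fin M → X, ∏ j, ENNReal.ofReal (‖x j - v‖ ^ (-1 * β)) ∂(gasMeasure r β M) := by
  have hprob := h.isProbabilityMeasure_gasMeasure hr hβ.le M
  have hm := measurable_insertFactor_right (X := X) β (M := M) v
  have e : ENNReal.ofReal (3 * a ^ 2) = ∫⁻ _x : Fin M → X, ENNReal.ofReal (3 * a ^ 2) ∂(gasMeasure r β M) := by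
    simp
  rw [e, ← lintegral_add_left (by fun_prop), ← lintegral_const_mul' _ _ ENNReal.ofReal_ne_top,
    ← lintegral_add_left (by fun_prop)]
  refine lintegral_mono_ae ?_
  filter_upwards [ae_gasMeasure_ne (r := r) β M v] with x hx
  have hpos : ∀ j, 0 < ‖x j - v‖ := fun j => norm_pos_iff.2 (sub_ne_zero.2 (hx j))
  have hq : 0 < insertFactor β v x := Finset.prod_pos fun j _ => Real.rpow_pos_of_pos (hpos j) _
  have e2 : ∏ j, ENNReal.ofReal (‖x j - v‖ ^ (2 * β)) = ENNReal.ofReal (insertFactor β v x ^ 2) := by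
    rw [← ENNReal.ofReal_prod_of_nonneg fun j _ => by positivity]
    congr 1
    unfold insertFactor
    rw [← Finset.prod_pow]
    refine Finset.prod_congr rfl fun j _ => ?_
    rw [← Real.rpow_mul_natCast (norm_nonneg _)]
    congr 1; push_cast; ring
  have e3 : ∏ j, ENNReal.ofReal (‖x j - v‖ ^ (-1 * β)) = ENNReal.ofReal ((insertFactor β v x)⁻¹) := by
    rw [← ENNReal.ofReal_prod_of_nonneg fun j _ => by positivity]
    congr 1
    unfold insertFactor
    rw [← Finset.prod_inv_distrib]
    refine Finset.prod_congr rfl fun j _ => ?_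
    rw [neg_one_mul, Real.rpow_neg (norm_nonneg _)]
  rw [e2, e3, ← ENNReal.ofReal_mul (by positivity), ← ENNReal.ofReal_add (by positivity) (by positivity),
    ← ENNReal.ofReal_add (by positivity) (by positivity)]
  exact ENNReal.ofReal_le_ofReal (sq_sub_add_le hq ha)

/-- The insertion factor converges in `L²` to `e^{γ U(u)}`. -/
theorem IsSelfConsistent.tendsto_lintegral_insertFactor_sub_sq {r : X → ℝ} (hr : IsWeight r) {γ c : ℝ}
    {μ : Measure X} (h : IsSelfConsistent r γ μ c) {β : ℕ → ℝ}
    (hβ : ∀ M, 0 < β M) (hlim : Tendsto (fun M : ℕ => (M : ℝ) * β M) atTop (𝓝 γ))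
    {u : X} {v : ℕ → X} (hv : Tendsto v atTop (𝓝 u)) :
    Tendsto (fun M : ℕ => ∫⁻ x : Fin M → X, ENNReal.ofReal
      ((insertFactor (β M) (v M) x - Real.exp (γ * logPotential μ u)) ^ 2) ∂(gasMeasure r (β M) M))
      atTop (𝓝 0) := by
  set U := logPotential μ u
  set a := Real.exp (γ * U) with ha
  have hapos : 0 < a := Real.exp_pos _
  rw [ENNReal.tendsto_nhds_zero]
  intro κ hκ
  by_cases hκt : κ = ⊤
  · simp [hκt]
  have hκ' : 0 < κ.toReal := ENNReal.toReal_pos hκ.ne' hκt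
  -- The bound for `𝔼[q²] + 2a³ 𝔼[q⁻¹]` coming from the two moments; at `g = γ`, `δ = 0` it equals
  -- the minimum `3a²`.
  set B : ℝ → ℝ → ℝ := fun g δ => Real.exp (g * (2 * U + 2 * δ)) + 2 * a ^ 3 * Real.exp (g * (-U + δ))
    with hB
  have hB0 : B γ 0 = 3 * a ^ 2 := by
    have e1 : Real.exp (γ * (2 * U + 2 * 0)) = a ^ 2 := by
      rw [ha, ← Real.exp_nat_mul]; congr 1; push_cast; ring
    have e2 : a ^ 3 * Real.exp (γ * (-U + 0)) = a ^ 2 := by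
      rw [ha, ← Real.exp_nat_mul, ← Real.exp_nat_mul, ← Real.exp_add]; congr 1; push_cast; ring
    simp only [hB]
    rw [e1, mul_assoc, e2]; ring
  obtain ⟨δ, hδ, hδB⟩ : ∃ δ : ℝ, 0 < δ ∧ B γ δ < 3 * a ^ 2 + κ.toReal := by
    have : Continuous (fun δ => B γ δ) := by simp only [hB]; fun_prop
    have l := (this.tendsto 0).mono_left (nhdsWithin_le_nhds (s := Set.Ioi 0))
    rw [hB0] at l
    obtain ⟨δ, h1, h2⟩ := ((l.eventually_lt_const (show 3 * a ^ 2 < 3 * a ^ 2 + κ.toReal by linarith)).and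
      self_mem_nhdsWithin).exists
    exact ⟨δ, h2, h1⟩
  have l2 : Tendsto (fun M : ℕ => B ((M : ℝ) * β M) δ) atTop (𝓝 (B γ δ)) := by
    have : Continuous (fun g => B g δ) := by simp only [hB]; fun_prop
    exact (this.tendsto γ).comp hlim
  filter_upwards [h.eventually_lintegral_prod_rpow_le hr hβ hlim hv (p := 2) (by norm_num) hδ,
    h.eventually_lintegral_prod_rpow_le hr hβ hlim hv (p := -1) (by norm_num) hδ,
    l2.eventually_lt_const hδB] with M h1 h2 h3
  have key := h.lintegral_insertFactor_sub_sq_le hr (hβ M) (M := M) (v M) hapos.le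
  have h4 := key.trans (add_le_add h1 (mul_le_mul_right h2 _))
  rw [← ENNReal.ofReal_mul (by positivity), ← ENNReal.ofReal_add (by positivity) (by positivity)] at h4
  have h5 : ENNReal.ofReal (Real.exp ((M : ℝ) * β M * (2 * U + |2| * δ))
      + 2 * a ^ 3 * Real.exp ((M : ℝ) * β M * (-1 * U + |-1| * δ)))
      ≤ κ + ENNReal.ofReal (3 * a ^ 2) := by
    rw [← ENNReal.ofReal_toReal hκt, ← ENNReal.ofReal_add hκ'.le (by positivity)]
    refine ENNReal.ofReal_le_ofReal ?_
    simp only [hB] at h3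
    norm_num
    linarith
  exact (ENNReal.add_le_add_iff_right ENNReal.ofReal_ne_top).1 (h4.trans h5)

/-- The insertion factor converges in `L¹` to `e^{γ U(u)}`. -/
theorem IsSelfConsistent.tendsto_lintegral_insertFactor_sub {r : X → ℝ} (hr : IsWeight r) {γ c : ℝ}
    {μ : Measure X} (h : IsSelfConsistent r γ μ c) {β : ℕ → ℝ}
    (hβ : ∀ M, 0 < β M) (hlim : Tendsto (fun M : ℕ => (M : ℝ) * β M) atTop (𝓝 γ))
    {u : X} {v : ℕ → X} (hv : Tendsto v atTop (𝓝 u)) :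
    Tendsto (fun M : ℕ => ∫⁻ x : Fin M → X, ENNReal.ofReal
      |insertFactor (β M) (v M) x - Real.exp (γ * logPotential μ u)| ∂(gasMeasure r (β M) M))
      atTop (𝓝 0) := by
  have l := (h.tendsto_lintegral_insertFactor_sub_sq hr hβ hlim hv).ennrpow_const (1 / 2)
  rw [ENNReal.zero_rpow_of_pos (by norm_num)] at l
  refine tendsto_of_tendsto_of_tendsto_of_le_of_le tendsto_const_nhds l (fun _ => zero_le) fun M => ?_
  have hprob := h.isProbabilityMeasure_gasMeasure hr (hβ M).le M
  have hm := measurable_insertFactor_right (X := X) (β M) (M := M) (v M)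
  refine le_trans (le_of_eq (lintegral_congr fun x => ?_)) (lintegral_rpow_le_rpow_lintegral (by fun_prop)
    (show (0:ℝ) < 1 / 2 by norm_num) (by norm_num))
  rw [ENNReal.ofReal_rpow_of_nonneg (by positivity) (by norm_num), ← Real.sqrt_eq_rpow, Real.sqrt_sq_eq_abs]

/-- Uniform growth bound for the mean insertion factor. -/
theorem IsSelfConsistent.eventually_lintegral_insertFactor_le {r : X → ℝ} (hr : IsWeight r) {γ c : ℝ}
    {μ : Measure X} (h : IsSelfConsistent r γ μ c) {β : ℕ → ℝ}
    (hβ : ∀ M, 0 < β M) (hlim : Tendsto (fun M : ℕ => (M : ℝ) * β M) atTop (𝓝 γ)) :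
    ∃ C : ℝ, 0 ≤ C ∧ ∀ᶠ M : ℕ in atTop, ∀ u : X,
      ∫⁻ x : Fin M → X, ENNReal.ofReal (insertFactor (β M) u x) ∂(gasMeasure r (β M) M)
        ≤ ENNReal.ofReal (C * (1 + ‖u‖) ^ (γ + 1)) := by
  have hβ0 := tendsto_zero_of_natCast_mul hlim
  set I := ∫⁻ x, ENNReal.ofReal (1 + ‖x‖) * ENNReal.ofReal (Real.exp 1 * (1 + ‖x‖) ^ (1:ℝ)) ∂μ
  have hI : I ≠ ⊤ := by
    refine ne_top_of_le_ne_top (ENNReal.mul_ne_top (ENNReal.ofReal_ne_top (r := Real.exp 1))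
      h.tame.lintegral_sq_ne_top) ?_
    rw [← lintegral_const_mul' _ _ ENNReal.ofReal_ne_top]
    refine lintegral_mono fun x => ?_
    rw [← ENNReal.ofReal_mul (by positivity), ← ENNReal.ofReal_mul (by positivity), Real.rpow_one]
    exact ENNReal.ofReal_le_ofReal (le_of_eq (by ring))
  -- Taking `A ≥ 1` allows replacing `A^{Mβ}` by `A^{γ+1}` once `Mβ < γ + 1`.
  set A := max I.toReal 1
  have hA1 : 1 ≤ A := le_max_right _ _
  have hIA : I ≤ ENNReal.ofReal A := by
    rw [← ENNReal.ofReal_toReal hI]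
    exact ENNReal.ofReal_le_ofReal (le_max_left _ _)
  refine ⟨A ^ (γ + 1), by positivity, ?_⟩
  filter_upwards [h.eventually_lintegral_prod_le hr hβ hlim one_pos,
    hβ0.eventually_lt_const one_pos, hlim.eventually_lt_const (show γ < γ + 1 by linarith)]
    with M h1 h2 h3 u
  have hprob := h.isProbabilityMeasure_gasMeasure hr (hβ M).le M
  have hmeas : Measurable (fun x : Fin M → X => ∏ j, ENNReal.ofReal (1 + ‖x j‖)) := by fun_prop
  calc _ ≤ ∫⁻ x : Fin M → X, ENNReal.ofReal ((1 + ‖u‖) ^ (γ + 1))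
        * (∏ j, ENNReal.ofReal (1 + ‖x j‖)) ^ (β M) ∂(gasMeasure r (β M) M) := by
        refine lintegral_mono fun x => ?_
        rw [← ENNReal.ofReal_prod_of_nonneg fun j _ => by positivity,
          ENNReal.ofReal_rpow_of_nonneg (Finset.prod_nonneg fun j _ => by positivity) (hβ M).le,
          ← ENNReal.ofReal_mul (by positivity)]
        refine ENNReal.ofReal_le_ofReal ?_
        have hu : (1 + ‖u‖) ^ ((M : ℝ) * β M) ≤ (1 + ‖u‖) ^ (γ + 1) :=
          Real.rpow_le_rpow_of_exponent_le (by linarith [norm_nonneg u]) h3.le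
        calc insertFactor (β M) u x ≤ ∏ j, ((1 + ‖x j‖) * (1 + ‖u‖)) ^ (β M) := by
              refine Finset.prod_le_prod (fun j _ => by positivity) fun j _ => ?_
              exact Real.rpow_le_rpow (norm_nonneg _) (norm_sub_le_mul _ _) (hβ M).le
          _ = (1 + ‖u‖) ^ ((M : ℝ) * β M) * (∏ j, (1 + ‖x j‖)) ^ (β M) := by
              rw [← Real.finsetProd_rpow _ _ fun j _ => by positivity]
              have : ∀ j, ((1 + ‖x j‖) * (1 + ‖u‖)) ^ (β M) = (1 + ‖x j‖) ^ (β M) * (1 + ‖u‖) ^ (β M) :=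
                fun j => Real.mul_rpow (by positivity) (by positivity)
              simp_rw [this]
              rw [Finset.prod_mul_distrib]
              simp only [Finset.prod_const, Finset.card_univ, Fintype.card_fin]
              rw [← Real.rpow_mul_natCast (by positivity), mul_comm (β M), mul_comm]
          _ ≤ _ := by gcongr
    _ = ENNReal.ofReal ((1 + ‖u‖) ^ (γ + 1))
        * ∫⁻ x : Fin M → X, (∏ j, ENNReal.ofReal (1 + ‖x j‖)) ^ (β M) ∂(gasMeasure r (β M) M) :=
        lintegral_const_mul' _ _ ENNReal.ofReal_ne_top
    _ ≤ ENNReal.ofReal ((1 + ‖u‖) ^ (γ + 1)) * ((ENNReal.ofReal A) ^ M) ^ (β M) := by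
        gcongr
        refine (lintegral_rpow_le_rpow_lintegral hmeas (hβ M) h2).trans ?_
        gcongr
        · exact (hβ M).le
        · exact (h1 (fun y => ENNReal.ofReal (1 + ‖y‖)) (by fun_prop)).trans (by gcongr)
    _ ≤ ENNReal.ofReal ((1 + ‖u‖) ^ (γ + 1)) * ENNReal.ofReal (A ^ (γ + 1)) := by
        gcongr
        rw [← ENNReal.ofReal_pow (by positivity), ENNReal.ofReal_rpow_of_nonneg (by positivity) (hβ M).le]
        refine ENNReal.ofReal_le_ofReal ?_
        rw [← Real.rpow_natCast_mul (by positivity)]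
        exact Real.rpow_le_rpow_of_exponent_le hA1 h3.le
    _ = _ := by rw [← ENNReal.ofReal_mul (by positivity), mul_comm]

end LogGas

end

/-! ### Thinning, a differential inequality, and conditioning on one particle -/

noncomputable section

namespace LogGas

/-- An approximate solution of `L' = -l L`, `L(0) = 1` is close to `e^{-l}` at time one. -/
lemma abs_sub_exp_neg_le {L L' : ℝ → ℝ} {l ε : ℝ} (hl : 0 ≤ l) (h0 : L 0 = 1)
    (hd : ∀ t ∈ Set.Icc (0:ℝ) 1, HasDerivAt L (L' t) t)
    (hb : ∀ t ∈ Set.Icc (0:ℝ) 1, |L' t + l * L t| ≤ ε) : |L 1 - Real.exp (-l)| ≤ ε := by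
  -- The integrating factor `e^{l(t-1)}` is at most `1` on `[0,1]` and equals `1` at the endpoint;
  -- the mean value inequality then loses only `ε`.
  have key := Convex.norm_image_sub_le_of_norm_hasDerivWithin_le
    (f := fun t => Real.exp (l * (t - 1)) * L t)
    (f' := fun t => Real.exp (l * (t - 1)) * (L' t + l * L t)) (s := Set.Icc (0:ℝ) 1) (C := ε)
    (x := 0) (y := 1) (fun t ht => by
      have h1 : HasDerivAt (fun t => Real.exp (l * (t - 1))) (Real.exp (l * (t - 1)) * l) t := by
        simpa using (((hasDerivAt_id t).sub_const 1).const_mul l).exp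
      refine ((h1.mul (hd t ht)).congr_deriv ?_).hasDerivWithinAt
      ring)
    (fun t ht => by
      rw [norm_mul, Real.norm_eq_abs, Real.norm_eq_abs, abs_of_pos (Real.exp_pos _)]
      have : Real.exp (l * (t - 1)) ≤ 1 := by
        rw [Real.exp_le_one_iff]
        exact mul_nonpos_of_nonneg_of_nonpos hl (by linarith [ht.2])
      calc _ ≤ 1 * ε := mul_le_mul this (hb t ht) (abs_nonneg _) zero_le_one
        _ = ε := one_mul _)
    (convex_Icc _ _) (by simp) (by simp)
  simpa [h0] using key

/-- The product `∏_j (1 - t H(x_j))`. -/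
def thinning {Y : Type*} (H : Y → ℝ) (t : ℝ) {M : ℕ} (x : Fin M → Y) : ℝ := ∏ j, (1 - t * H (x j))

section

variable {Y : Type*} [MeasurableSpace Y]

lemma measurable_thinning {H : Y → ℝ} (hH : Measurable H) (t : ℝ) {M : ℕ} :
    Measurable (fun x : Fin M → Y => thinning H t x) := by
  unfold thinning; fun_prop

lemma one_sub_mul_mem {H : Y → ℝ} (h0 : ∀ x, 0 ≤ H x) (h1 : ∀ x, H x ≤ 1) {t : ℝ}
    (ht : t ∈ Set.Icc (0:ℝ) 1) (x : Y) : 0 ≤ 1 - t * H x ∧ 1 - t * H x ≤ 1 := by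
  constructor
  · nlinarith [mul_le_mul ht.2 (h1 x) (h0 x) zero_le_one]
  · nlinarith [mul_nonneg ht.1 (h0 x)]

lemma thinning_nonneg {H : Y → ℝ} (h0 : ∀ x, 0 ≤ H x) (h1 : ∀ x, H x ≤ 1) {t : ℝ}
    (ht : t ∈ Set.Icc (0:ℝ) 1) {M : ℕ} (x : Fin M → Y) : 0 ≤ thinning H t x :=
  Finset.prod_nonneg fun _ _ => (one_sub_mul_mem h0 h1 ht _).1

lemma thinning_le_one {H : Y → ℝ} (h0 : ∀ x, 0 ≤ H x) (h1 : ∀ x, H x ≤ 1) {t : ℝ}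
    (ht : t ∈ Set.Icc (0:ℝ) 1) {M : ℕ} (x : Fin M → Y) : thinning H t x ≤ 1 :=
  Finset.prod_le_one (fun _ _ => (one_sub_mul_mem h0 h1 ht _).1)
    fun _ _ => (one_sub_mul_mem h0 h1 ht _).2

lemma prod_erase_insertNth (φ : Y → ℝ) {M : ℕ} (i : Fin (M + 1)) (u : Y) (y : Fin M → Y) :
    ∏ j ∈ Finset.univ.erase i, φ ((i.insertNth u y : Fin (M + 1) → Y) j) = ∏ j, φ (y j) := by
  rw [← Finset.compl_singleton, ← Fin.image_succAbove_univ, Finset.prod_image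
    (fun a _ b _ h => Fin.succAbove_right_injective h)]
  simp

/-- Differentiation of `t ↦ 𝔼 ∏_j (1 - t H(x_j))`. -/
lemma hasDerivAt_integral_thinning {M : ℕ} (G : Measure (Fin M → Y)) [IsProbabilityMeasure G]
    {H : Y → ℝ} (hH : Measurable H) (h0 : ∀ x, 0 ≤ H x) (h1 : ∀ x, H x ≤ 1) {t : ℝ}
    (ht : t ∈ Set.Icc (0:ℝ) 1) :
    HasDerivAt (fun s => ∫ x, thinning H s x ∂G)
      (-(∑ i, ∫⁻ x, ENNReal.ofReal (H (x i) * ∏ j ∈ Finset.univ.erase i, (1 - t * H (x j))) ∂G).toReal)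
      t := by
  set D : ℝ → (Fin M → Y) → ℝ := fun s x =>
    ∑ i, (∏ j ∈ Finset.univ.erase i, (1 - s * H (x j))) * (-(H (x i))) with hD
  -- A whole neighbourhood of `t ∈ [0,1]` is needed to differentiate under the integral, also at the
  -- endpoints; there `|s| ≤ 2`.
  have hb : ∀ s ∈ Metric.ball t 1, ∀ x : Y, |1 - s * H x| ≤ 3 := by
    intro s hs x
    have hs' := abs_lt.1 (by simpa [Real.dist_eq] using hs : |s - t| < 1)
    have hsabs : |s| ≤ 2 := abs_le.2 ⟨by linarith [ht.1], by linarith [ht.2]⟩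
    have : |s * H x| ≤ 2 * 1 := by
      rw [abs_mul, abs_of_nonneg (h0 x)]
      exact mul_le_mul hsabs (h1 x) (h0 x) (by norm_num)
    rw [abs_le] at this ⊢
    constructor <;> linarith [this.1, this.2]
  have key := hasDerivAt_integral_of_dominated_loc_of_deriv_le (μ := G) (F := fun s x => thinning H s x)
    (F' := D) (bound := fun _ => ∑ _i : Fin M, (3:ℝ) ^ (M - 1)) (x₀ := t) (Metric.ball_mem_nhds t one_pos)
    (Eventually.of_forall fun s => (measurable_thinning hH s).aestronglyMeasurable)
    (Integrable.of_bound (measurable_thinning hH t).aestronglyMeasurable 1 (ae_of_all _ fun x => by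
      rw [Real.norm_eq_abs, abs_of_nonneg (thinning_nonneg h0 h1 ht x)]
      exact thinning_le_one h0 h1 ht x))
    (Measurable.aestronglyMeasurable (by simp only [hD]; fun_prop))
    (ae_of_all _ fun x s hs => by
      refine (norm_sum_le _ _).trans (Finset.sum_le_sum fun i _ => ?_)
      rw [norm_mul, norm_neg, Real.norm_eq_abs, Real.norm_eq_abs, Finset.abs_prod, abs_of_nonneg (h0 _)]
      calc _ ≤ (3:ℝ) ^ (M - 1) * 1 := by
            refine mul_le_mul ?_ (h1 _) (h0 _) (by positivity)
            refine (Finset.prod_le_prod (fun _ _ => abs_nonneg _) fun j _ => hb s hs (x j)).trans ?_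
            simp
        _ = _ := mul_one _)
    (integrable_const _)
    (ae_of_all _ fun x s _ => by
      have := HasDerivAt.fun_finsetProd (u := Finset.univ) (x := s)
        (f := fun (j : Fin M) (s : ℝ) => 1 - s * H (x j)) (f' := fun j => -(H (x j)))
        (fun j _ => by simpa using ((hasDerivAt_id s).mul_const (H (x j))).const_sub 1)
      simpa [hD, thinning] using this)
  refine key.2.congr_deriv ?_
  have hnn : ∀ i (x : Fin M → Y), 0 ≤ H (x i) * ∏ j ∈ Finset.univ.erase i, (1 - t * H (x j)) :=
    fun i x => mul_nonneg (h0 _) (Finset.prod_nonneg fun j _ => (one_sub_mul_mem h0 h1 ht _).1)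
  have e : ∀ x, D t x = -∑ i, H (x i) * ∏ j ∈ Finset.univ.erase i, (1 - t * H (x j)) := by
    intro x
    rw [← Finset.sum_neg_distrib]
    exact Finset.sum_congr rfl fun i _ => by ring
  simp_rw [e]
  rw [integral_neg, integral_eq_lintegral_of_nonneg_ae
    (ae_of_all _ fun x => Finset.sum_nonneg fun i _ => hnn i x)
    (Measurable.aestronglyMeasurable (by fun_prop)), ← lintegral_finsetSum _ (fun i _ => by fun_prop)]
  congr 2
  refine lintegral_congr fun x => ?_
  exact ENNReal.ofReal_sum_of_nonneg fun i _ => hnn i x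

end

variable {X : Type*} [NormedAddCommGroup X] [InnerProductSpace ℝ X] [FiniteDimensional ℝ X]
  [MeasurableSpace X] [BorelSpace X]

/-- The blow-up `v = s(u - E)`, whose Jacobian is the factor on the left. -/
lemma lintegral_comp_smul_sub {s : ℝ} (hs : 0 < s) (E : X) {φ ψ : X → ℝ≥0∞} (hφ : Measurable φ)
    (hψ : Measurable ψ) :
    ENNReal.ofReal (s ^ Module.finrank ℝ X) * ∫⁻ u, φ (s • (u - E)) * ψ u
      = ∫⁻ v, φ v * ψ (E + s⁻¹ • v) := by
  have h1 : ∫⁻ u, φ (s • (u - E)) * ψ u = ∫⁻ w : X, φ (s • w) * ψ (E + w) := by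
    rw [← lintegral_sub_right_eq_self (fun w : X => φ (s • w) * ψ (E + w)) E]
    simp
  have h2 : ∫⁻ w : X, φ (s • w) * ψ (E + w)
      = ∫⁻ v, φ v * ψ (E + s⁻¹ • v) ∂(Measure.map (s • ·) (volume : Measure X)) := by
    rw [lintegral_map (by fun_prop) (by fun_prop)]
    refine lintegral_congr fun w => ?_
    rw [smul_smul, inv_mul_cancel₀ hs.ne', one_smul]
  rw [h1, h2, Measure.map_addHaar_smul _ hs.ne', lintegral_smul_measure, smul_eq_mul, ← mul_assoc,
    ← ENNReal.ofReal_mul (by positivity), abs_of_pos (by positivity), mul_inv_cancel₀ (by positivity),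
    ENNReal.ofReal_one, one_mul]

variable [Nontrivial X]

/-- The ratio of consecutive partition functions. -/
def insertPartition (r : X → ℝ) (β : ℝ) (M : ℕ) : ℝ≥0∞ :=
  ∫⁻ u, ∫⁻ y : Fin M → X, ENNReal.ofReal (insertFactor β u y) ∂(gasMeasure r β M) ∂(baseMeasure r)

/-- The pairs containing the `i`-th particle make up the insertion factor; the remaining pairs form
a gas of `M` particles at the same `β`. -/
lemma IsSelfConsistent.lintegral_pairProd_succ {r : X → ℝ} (hr : IsWeight r) {γ c : ℝ}
    {μ : Measure X} (h : IsSelfConsistent r γ μ c) {β : ℝ} (hβ : 0 ≤ β) {M : ℕ} (i : Fin (M + 1))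
    {F : (Fin (M + 1) → X) → ℝ≥0∞} (hF : Measurable F) :
    ∫⁻ x, F x * ENNReal.ofReal (pairProd β x) ∂(Measure.pi fun _ => baseMeasure r)
      = gasPartition r β M * ∫⁻ u, ∫⁻ y, F (i.insertNth u y) * ENNReal.ofReal (insertFactor β u y)
        ∂(gasMeasure r β M) ∂(baseMeasure r) := by
  have hZ0 := h.gasPartition_ne_zero hr β M
  have hZt := hr.gasPartition_ne_top hβ M
  have hp := measurable_pairProd (X := X) β (M := M + 1)
  have hm : Measurable (fun p : X × (Fin M → X) => F (i.insertNth p.1 p.2)) :=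
    hF.comp (measurable_insertNth i)
  rw [lintegral_pi_insertNth _ i (by fun_prop), ← lintegral_const_mul' _ _ hZt]
  refine lintegral_congr fun u => ?_
  have hmu : Measurable (fun y : Fin M → X => F (i.insertNth u y)) := hm.comp measurable_prodMk_left
  have hW := measurable_insertFactor_right (X := X) β (M := M) u
  rw [lintegral_gasMeasure r β (by fun_prop), ← mul_assoc, ENNReal.mul_inv_cancel hZ0 hZt, one_mul]
  refine lintegral_congr fun y => ?_
  rw [pairProd_insertNth, ENNReal.ofReal_mul (Finset.prod_nonneg fun _ _ => by positivity), ← mul_assoc]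
  simp only [insertFactor, norm_sub_rev]

/-- Conditioning on one particle. -/
lemma IsSelfConsistent.lintegral_gasMeasure_succ {r : X → ℝ} (hr : IsWeight r) {γ c : ℝ}
    {μ : Measure X} (h : IsSelfConsistent r γ μ c) {β : ℝ} (hβ : 0 ≤ β) {M : ℕ} (i : Fin (M + 1))
    {F : (Fin (M + 1) → X) → ℝ≥0∞} (hF : Measurable F) :
    ∫⁻ x, F x ∂(gasMeasure r β (M + 1)) = (insertPartition r β M)⁻¹
      * ∫⁻ u, ∫⁻ y, F (i.insertNth u y) * ENNReal.ofReal (insertFactor β u y)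
        ∂(gasMeasure r β M) ∂(baseMeasure r) := by
  have hZ0 := h.gasPartition_ne_zero hr β M
  have hZt := hr.gasPartition_ne_top hβ M
  have e : gasPartition r β (M + 1) = gasPartition r β M * insertPartition r β M := by
    have := h.lintegral_pairProd_succ hr hβ i (F := fun _ => 1) measurable_const
    simpa [gasPartition, insertPartition] using this
  rw [lintegral_gasMeasure r β hF, h.lintegral_pairProd_succ hr hβ i hF, e,
    ENNReal.mul_inv (Or.inl hZ0) (Or.inl hZt), mul_comm (gasPartition r β M)⁻¹, mul_assoc,
    ← mul_assoc _ (gasPartition r β M), ENNReal.inv_mul_cancel hZ0 hZt, one_mul]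

lemma IsTame.logPotential_eq {μ : Measure X} (h : IsTame μ) (u : X) :
    logPotential μ u = logWeight u + ∫ x, logWeight x ∂μ - potential 0 μ u := by
  have hμ := h.prob
  have e : ∀ x, Real.log ‖x - u‖ = (logWeight u + logWeight x) - regKernel 0 u x := fun x => by
    rw [regKernel_zero_eq, norm_sub_rev]; ring
  unfold logPotential potential
  simp_rw [e]
  have hi : Integrable (fun x => logWeight u + logWeight x) μ :=
    (integrable_const _).add h.integrable_logWeight
  rw [integral_sub hi (h.integrable_regKernel le_rfl zero_le_one u),
    integral_add (integrable_const _) h.integrable_logWeight]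
  simp

lemma IsTame.continuous_logPotential {μ : Measure X} (h : IsTame μ) : Continuous (logPotential μ) := by
  have e : logPotential μ = fun u => logWeight u + ∫ x, logWeight x ∂μ - potential 0 μ u :=
    funext h.logPotential_eq
  rw [e]
  have h1 := h.continuous_potential
  have h2 : Continuous (logWeight : X → ℝ) := by
    unfold logWeight
    exact Continuous.log (by fun_prop) fun x => by positivity
  fun_prop

/-- The equilibrium density. -/
def eqDensity (r : X → ℝ) (γ : ℝ) (μ : Measure X) (c : ℝ) (x : X) : ℝ :=
  r x * Real.exp (γ * (logWeight x - potential 0 μ x)) / c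

/-- The normalisation `∫ r e^{γ U}`. -/
def eqConst (γ : ℝ) (μ : Measure X) (c : ℝ) : ℝ := c * Real.exp (γ * ∫ x, logWeight x ∂μ)

lemma IsSelfConsistent.eqConst_pos {r : X → ℝ} {γ c : ℝ} {μ : Measure X}
    (h : IsSelfConsistent r γ μ c) : 0 < eqConst γ μ c := mul_pos h.pos (Real.exp_pos _)

/-- Self-consistency in terms of `U`: the limiting density of an inserted particle is the
equilibrium density, up to the normalization. -/
lemma IsSelfConsistent.mul_exp_logPotential {r : X → ℝ} {γ c : ℝ} {μ : Measure X}
    (h : IsSelfConsistent r γ μ c) (x : X) :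
    r x * Real.exp (γ * logPotential μ x) = eqConst γ μ c * eqDensity r γ μ c x := by
  have hc := h.pos.ne'
  rw [eqDensity, eqConst, h.tame.logPotential_eq]
  have : Real.exp (γ * (logWeight x + ∫ x, logWeight x ∂μ - potential 0 μ x))
      = Real.exp (γ * (logWeight x - potential 0 μ x)) * Real.exp (γ * ∫ x, logWeight x ∂μ) := by
    rw [← Real.exp_add]; congr 1; ring
  rw [this]
  field_simp

lemma lintegral_baseMeasure {r : X → ℝ} (hr : IsWeight r) {φ : X → ℝ≥0∞} (hφ : Measurable φ) :
    ∫⁻ x, φ x ∂(baseMeasure r) = ∫⁻ x, φ x * ENNReal.ofReal (r x) := by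
  rw [baseMeasure, lintegral_withDensity_eq_lintegral_mul _ (hr.meas.ennreal_ofReal) hφ]
  exact lintegral_congr fun x => mul_comm _ _

lemma IsSelfConsistent.lintegral_exp_logPotential {r : X → ℝ} (hr : IsWeight r) {γ c : ℝ} {μ : Measure X}
    (h : IsSelfConsistent r γ μ c) :
    ∫⁻ x, ENNReal.ofReal (Real.exp (γ * logPotential μ x)) ∂(baseMeasure r)
      = ENNReal.ofReal (eqConst γ μ c) := by
  have hμ := h.tame.prob
  have hU := h.tame.continuous_logPotential.measurable
  have h1 : ∫⁻ x, ENNReal.ofReal (eqDensity r γ μ c x) = 1 := by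
    rw [← setLIntegral_univ, ← withDensity_apply _ MeasurableSet.univ]
    have := h.eq
    unfold eqDensity
    rw [← this]
    exact measure_univ
  rw [lintegral_baseMeasure hr (by fun_prop)]
  calc _ = ∫⁻ x, ENNReal.ofReal (eqConst γ μ c) * ENNReal.ofReal (eqDensity r γ μ c x) := by
        refine lintegral_congr fun x => ?_
        rw [← ENNReal.ofReal_mul (Real.exp_pos _).le, ← ENNReal.ofReal_mul h.eqConst_pos.le,
          ← h.mul_exp_logPotential, mul_comm]
    _ = _ := by rw [lintegral_const_mul' _ _ ENNReal.ofReal_ne_top, h1, mul_one]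

end LogGas

end

/-! ### Replacing the insertion factor by its limit -/

noncomputable section

namespace LogGas

/-- With `D = -L'`: both `D ≈ k p` and `L ≈ m p` for the same `p ≤ 1`, where `k ≈ l` and `m ≈ 1`,
whence `D ≈ l L`. -/
lemma abs_neg_toReal_add_le {D L p k m e₁ e₂ : ℝ≥0∞} {l : ℝ} (hl : 0 ≤ l) (hk : k ≠ ⊤) (hm : m ≠ ⊤)
    (he₁ : e₁ ≠ ⊤) (he₂ : e₂ ≠ ⊤) (hp : p ≤ 1) (h₁ : D ≤ k * p + e₁) (h₂ : k * p ≤ D + e₁)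
    (h₃ : L ≤ m * p + e₂) (h₄ : m * p ≤ L + e₂) :
    |-D.toReal + l * L.toReal|
      ≤ e₁.toReal + |k.toReal - l| + l * (|1 - m.toReal| + e₂.toReal) := by
  have hpt : p ≠ ⊤ := ne_top_of_le_ne_top ENNReal.one_ne_top hp
  have hD : D ≠ ⊤ := ne_top_of_le_ne_top (by finiteness) h₁
  have hL : L ≠ ⊤ := ne_top_of_le_ne_top (by finiteness) h₃
  lift p to ℝ≥0 using hpt
  lift D to ℝ≥0 using hD
  lift L to ℝ≥0 using hL
  lift k to ℝ≥0 using hk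
  lift m to ℝ≥0 using hm
  lift e₁ to ℝ≥0 using he₁
  lift e₂ to ℝ≥0 using he₂
  norm_cast at hp h₁ h₂ h₃ h₄
  rw [← NNReal.coe_le_coe] at hp h₁ h₂ h₃ h₄
  push_cast at hp h₁ h₂ h₃ h₄
  simp only [ENNReal.coe_toReal]
  have hp0 : (0:ℝ) ≤ p := p.2
  have e : -(D:ℝ) + l * L = (k * p - D) - (k - l) * p - l * ((1 - m) * p) - l * (m * p - L) := by ring
  have a1 : |(k:ℝ) * p - D| ≤ e₁ := abs_le.2 ⟨by linarith, by linarith⟩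
  have a2 : |(m:ℝ) * p - L| ≤ e₂ := abs_le.2 ⟨by linarith, by linarith⟩
  have a3 : |((k:ℝ) - l) * p| ≤ |(k:ℝ) - l| := by
    rw [abs_mul, abs_of_nonneg hp0]
    exact mul_le_of_le_one_right (abs_nonneg _) hp
  have a4 : |(1 - (m:ℝ)) * p| ≤ |1 - (m:ℝ)| := by
    rw [abs_mul, abs_of_nonneg hp0]
    exact mul_le_of_le_one_right (abs_nonneg _) hp
  rw [e]
  calc _ ≤ |(k:ℝ) * p - D| + |((k:ℝ) - l) * p| + |l * ((1 - (m:ℝ)) * p)| + |l * ((m:ℝ) * p - L)| := by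
        refine (abs_sub _ _).trans (add_le_add ((abs_sub _ _).trans (add_le_add (abs_sub _ _) le_rfl)) le_rfl)
    _ ≤ e₁ + |(k:ℝ) - l| + l * |1 - (m:ℝ)| + l * e₂ := by
        rw [abs_mul l, abs_mul l, abs_of_nonneg hl]
        gcongr
    _ = _ := by ring

variable {X : Type*} [NormedAddCommGroup X] [InnerProductSpace ℝ X] [FiniteDimensional ℝ X]
  [MeasurableSpace X] [BorelSpace X] [Nontrivial X]

/-- The mean distance of the insertion factor at `u` to a constant. -/
def insertError (r : X → ℝ) (β : ℝ) (M : ℕ) (u : X) (b : ℝ) : ℝ≥0∞ :=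
  ∫⁻ y : Fin M → X, ENNReal.ofReal |insertFactor β u y - b| ∂(gasMeasure r β M)

instance sFinite_gasMeasure (r : X → ℝ) (β : ℝ) (M : ℕ) : SFinite (gasMeasure r β M) := by
  unfold gasMeasure; infer_instance

lemma measurable_insertError (r : X → ℝ) (β : ℝ) (M : ℕ) {b : X → ℝ} (hb : Measurable b) :
    Measurable (fun u => insertError r β M u (b u)) := by
  unfold insertError
  refine Measurable.lintegral_prod_right' (f := fun p : X × (Fin M → X) =>
    ENNReal.ofReal |insertFactor β p.1 p.2 - b p.1|) ?_
  have := measurable_insertFactor (X := X) β (M := M)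
  fun_prop

lemma insertError_le {r : X → ℝ} {β : ℝ} {M : ℕ} [IsProbabilityMeasure (gasMeasure r β M)]
    (u : X) {b : ℝ} (hb : 0 ≤ b) :
    insertError r β M u b ≤ ∫⁻ y : Fin M → X, ENNReal.ofReal (insertFactor β u y) ∂(gasMeasure r β M)
      + ENNReal.ofReal b := by
  have e : ENNReal.ofReal b = ∫⁻ _y : Fin M → X, ENNReal.ofReal b ∂(gasMeasure r β M) := by simp
  rw [e, ← lintegral_add_right _ (by fun_prop)]
  refine lintegral_mono fun y => ?_
  rw [← ENNReal.ofReal_add (insertFactor_nonneg _ _ _) hb]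
  refine ENNReal.ofReal_le_ofReal ((abs_sub _ _).trans ?_)
  rw [abs_of_nonneg (insertFactor_nonneg _ _ _), abs_of_nonneg hb]

lemma ofReal_le_add_abs_sub {w b : ℝ} : ENNReal.ofReal w ≤ ENNReal.ofReal b + ENNReal.ofReal |w - b| := by
  refine (ENNReal.ofReal_le_ofReal ?_).trans ENNReal.ofReal_add_le
  linarith [le_abs_self (w - b)]

section Comparison

variable {r : X → ℝ} {β : ℝ} {M : ℕ} [IsProbabilityMeasure (gasMeasure r β M)] {T : (Fin M → X) → ℝ≥0∞}

/-- As `T ≤ 1`, replacing the insertion factor by `b` costs at most its `L¹` distance to `b`,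
uniformly in `T`. Neither concentration nor decorrelation of `T` itself is needed. -/
lemma lintegral_mul_insertFactor_le (hTm : Measurable T) (hT : ∀ y, T y ≤ 1) (u : X) (b : ℝ) :
    ∫⁻ y, T y * ENNReal.ofReal (insertFactor β u y) ∂(gasMeasure r β M)
      ≤ ENNReal.ofReal b * ∫⁻ y, T y ∂(gasMeasure r β M) + insertError r β M u b := by
  rw [← lintegral_const_mul' _ _ ENNReal.ofReal_ne_top, insertError, ← lintegral_add_left (by fun_prop)]
  refine lintegral_mono fun y => ?_
  calc _ ≤ T y * (ENNReal.ofReal b + ENNReal.ofReal |insertFactor β u y - b|) := by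
        gcongr; exact ofReal_le_add_abs_sub
    _ = ENNReal.ofReal b * T y + T y * ENNReal.ofReal |insertFactor β u y - b| := by ring
    _ ≤ _ := by gcongr; exact mul_le_of_le_one_left zero_le (hT y)

lemma mul_lintegral_le_lintegral_mul_insertFactor (hTm : Measurable T) (hT : ∀ y, T y ≤ 1) (u : X)
    (b : ℝ) :
    ENNReal.ofReal b * ∫⁻ y, T y ∂(gasMeasure r β M)
      ≤ ∫⁻ y, T y * ENNReal.ofReal (insertFactor β u y) ∂(gasMeasure r β M) + insertError r β M u b := by
  have hW := measurable_insertFactor_right (X := X) β (M := M) u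
  rw [← lintegral_const_mul' _ _ ENNReal.ofReal_ne_top, insertError, ← lintegral_add_left (by fun_prop)]
  refine lintegral_mono fun y => ?_
  calc _ ≤ (ENNReal.ofReal (insertFactor β u y) + ENNReal.ofReal |b - insertFactor β u y|) * T y := by
        gcongr; exact ofReal_le_add_abs_sub
    _ = T y * ENNReal.ofReal (insertFactor β u y) + T y * ENNReal.ofReal |insertFactor β u y - b| := by
        rw [abs_sub_comm]; ring
    _ ≤ _ := by gcongr; exact mul_le_of_le_one_left zero_le (hT y)

end Comparison

section Limit

variable {r : X → ℝ} {γ c : ℝ} {μ : Measure X} {β : ℕ → ℝ}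

lemma nonneg_of_tendsto_natCast_mul {γ : ℝ} {β : ℕ → ℝ} (hβ : ∀ M, 0 < β M)
    (hlim : Tendsto (fun M : ℕ => (M : ℝ) * β M) atTop (𝓝 γ)) : 0 ≤ γ :=
  ge_of_tendsto' hlim fun M => by have := hβ M; positivity

/-- Pointwise convergence in `u` is the concentration result; the polynomial growth bound on the
mean insertion factor is integrable against `r` and dominates. -/
theorem IsSelfConsistent.tendsto_lintegral_insertError (hr : IsWeight r) (h : IsSelfConsistent r γ μ c)
    (hβ : ∀ M, 0 < β M) (hlim : Tendsto (fun M : ℕ => (M : ℝ) * β M) atTop (𝓝 γ)) :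
    Tendsto (fun M : ℕ => ∫⁻ u, insertError r (β M) M u (Real.exp (γ * logPotential μ u)) ∂(baseMeasure r))
      atTop (𝓝 0) := by
  have hγ := nonneg_of_tendsto_natCast_mul hβ hlim
  have hU := h.tame.continuous_logPotential.measurable
  obtain ⟨C, hC0, hC⟩ := h.eventually_lintegral_insertFactor_le hr hβ hlim
  rw [show (0:ℝ≥0∞) = ∫⁻ _u : X, 0 ∂(baseMeasure r) by simp]
  refine tendsto_lintegral_filter_of_dominated_convergence
    (fun u => ENNReal.ofReal (C * (1 + ‖u‖) ^ (γ + 1)) + ENNReal.ofReal (Real.exp (γ * logPotential μ u)))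
    (Eventually.of_forall fun M => measurable_insertError r (β M) M (by fun_prop)) ?_ ?_ ?_
  · filter_upwards [hC] with M hM
    have := h.isProbabilityMeasure_gasMeasure hr (hβ M).le M
    refine ae_of_all _ fun u => ?_
    exact (insertError_le u (Real.exp_pos _).le).trans (by gcongr; exact hM u)
  · rw [lintegral_add_left (by fun_prop), h.lintegral_exp_logPotential hr]
    refine ENNReal.add_ne_top.2 ⟨?_, ENNReal.ofReal_ne_top⟩
    rw [lintegral_baseMeasure hr (by fun_prop)]
    have := ((hr.integrable_mul_rpow (show 0 ≤ γ + 1 by linarith)).const_mul C).lintegral_lt_top.ne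
    refine ne_top_of_le_ne_top this (lintegral_mono fun u => ?_)
    beta_reduce
    rw [← ENNReal.ofReal_mul (by positivity)]
    exact ENNReal.ofReal_le_ofReal (le_of_eq (by ring))
  · exact ae_of_all _ fun u => h.tendsto_lintegral_insertFactor_sub hr hβ hlim tendsto_const_nhds

theorem IsSelfConsistent.tendsto_insertPartition (hr : IsWeight r) (h : IsSelfConsistent r γ μ c)
    (hβ : ∀ M, 0 < β M) (hlim : Tendsto (fun M : ℕ => (M : ℝ) * β M) atTop (𝓝 γ)) :
    Tendsto (fun M : ℕ => insertPartition r (β M) M) atTop (𝓝 (ENNReal.ofReal (eqConst γ μ c))) := by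
  have hU := h.tame.continuous_logPotential.measurable
  have l := h.tendsto_lintegral_insertError hr hβ hlim
  have l1 := ENNReal.Tendsto.sub (tendsto_const_nhds (x := ENNReal.ofReal (eqConst γ μ c))) l
    (Or.inl ENNReal.ofReal_ne_top)
  have l2 := (tendsto_const_nhds (x := ENNReal.ofReal (eqConst γ μ c))).add l
  rw [tsub_zero] at l1
  rw [add_zero] at l2
  refine tendsto_of_tendsto_of_tendsto_of_le_of_le l1 l2 (fun M => ?_) fun M => ?_
  all_goals
    have := h.isProbabilityMeasure_gasMeasure hr (hβ M).le M
    have hE := measurable_insertError r (β M) M (b := fun u => Real.exp (γ * logPotential μ u)) (by fun_prop)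
  · beta_reduce
    rw [tsub_le_iff_right, ← h.lintegral_exp_logPotential hr, insertPartition,
      ← lintegral_add_right _ hE]
    refine lintegral_mono fun u => ?_
    simpa using mul_lintegral_le_lintegral_mul_insertFactor (r := r) (β := β M) (M := M) (T := fun _ => 1)
      measurable_const (fun _ => le_rfl) u (Real.exp (γ * logPotential μ u))
  · beta_reduce
    rw [← h.lintegral_exp_logPotential hr, insertPartition, ← lintegral_add_right _ hE]
    refine lintegral_mono fun u => ?_
    simpa using lintegral_mul_insertFactor_le (r := r) (β := β M) (M := M) (T := fun _ => 1)
      measurable_const (fun _ => le_rfl) u (Real.exp (γ * logPotential μ u))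

variable {f : X → ℝ} {E : X} {σ : ℕ → ℝ}

lemma tendsto_add_inv_smul (hσ : Tendsto σ atTop atTop) (v : X) :
    Tendsto (fun M => E + (σ M)⁻¹ • v) atTop (𝓝 E) := by
  have := tendsto_const_nhds (x := E).add ((tendsto_inv_atTop_zero.comp hσ).smul_const v)
  simpa using this

/-- The only place where the continuity of the weight at `E` enters the limit. -/
lemma tendsto_lintegral_mul_weight (hr : IsWeight r) (hrE : ContinuousAt r E)
    (hf : Continuous f) (hfc : HasCompactSupport f) (hσ : Tendsto σ atTop atTop) :
    Tendsto (fun M => ∫⁻ v, ENNReal.ofReal (f v) * ENNReal.ofReal (r (E + (σ M)⁻¹ • v))) atTop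
      (𝓝 (∫⁻ v, ENNReal.ofReal (f v) * ENNReal.ofReal (r E))) := by
  have hm := hr.meas
  have hfm := hf.measurable
  obtain ⟨C, hC⟩ := hr.decay 0 le_rfl
  refine tendsto_lintegral_filter_of_dominated_convergence
    (fun v => ENNReal.ofReal (f v) * ENNReal.ofReal C) (Eventually.of_forall fun M => by fun_prop) ?_ ?_ ?_
  · refine Eventually.of_forall fun M => ae_of_all _ fun v => ?_
    gcongr
    simpa using hC (E + (σ M)⁻¹ • v)
  · rw [lintegral_mul_const' _ _ ENNReal.ofReal_ne_top]
    exact ENNReal.mul_ne_top (hf.integrable_of_hasCompactSupport hfc).lintegral_lt_top.ne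
      ENNReal.ofReal_ne_top
  · refine ae_of_all _ fun v => ENNReal.Tendsto.const_mul ?_ (Or.inr ENNReal.ofReal_ne_top)
    exact ENNReal.tendsto_ofReal (hrE.tendsto.comp (tendsto_add_inv_smul hσ v))

/-- The error is evaluated at the moving points `E + v/σ_M → E` but against the fixed limit at `E`;
this is why concentration was proved along convergent sequences of points. -/
lemma IsSelfConsistent.tendsto_lintegral_mul_insertError (hr : IsWeight r)
    (h : IsSelfConsistent r γ μ c) (hβ : ∀ M, 0 < β M)
    (hlim : Tendsto (fun M : ℕ => (M : ℝ) * β M) atTop (𝓝 γ))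
    (hf : Continuous f) (hfc : HasCompactSupport f) (hσ : Tendsto σ atTop atTop) :
    Tendsto (fun M => ∫⁻ v, ENNReal.ofReal (f v)
      * (insertError r (β M) M (E + (σ M)⁻¹ • v) (Real.exp (γ * logPotential μ E))
        * ENNReal.ofReal (r (E + (σ M)⁻¹ • v)))) atTop (𝓝 0) := by
  have hγ := nonneg_of_tendsto_natCast_mul hβ hlim
  have hm := hr.meas
  have hfm := hf.measurable
  obtain ⟨C, hC⟩ := hr.decay 0 le_rfl
  obtain ⟨D, hD0, hD⟩ := h.eventually_lintegral_insertFactor_le hr hβ hlim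
  set a := Real.exp (γ * logPotential μ E)
  have ha : 0 < a := Real.exp_pos _
  have hbd : ∀ v, ENNReal.ofReal (r v) ≤ ENNReal.ofReal C := fun v =>
    ENNReal.ofReal_le_ofReal (by simpa using hC v)
  rw [show (0:ℝ≥0∞) = ∫⁻ _u : X, 0 by simp]
  refine tendsto_lintegral_filter_of_dominated_convergence
    (fun v => ENNReal.ofReal (f v * (D * (1 + (‖E‖ + ‖v‖)) ^ (γ + 1) + a)) * ENNReal.ofReal C)
    (Eventually.of_forall fun M => ?_) ?_ ?_ ?_
  · have h1 := (measurable_insertError r (β M) M (b := fun _ => a) measurable_const).comp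
      (show Measurable fun v : X => E + (σ M)⁻¹ • v by fun_prop)
    have h2 : Measurable fun v : X => r (E + (σ M)⁻¹ • v) := by fun_prop
    exact hfm.ennreal_ofReal.mul (h1.mul h2.ennreal_ofReal)
  · filter_upwards [hD, hσ.eventually_ge_atTop 1] with M hM hσM
    have := h.isProbabilityMeasure_gasMeasure hr (hβ M).le M
    refine ae_of_all _ fun v => ?_
    rw [ENNReal.ofReal_mul' (by positivity), mul_assoc]
    gcongr
    · refine (insertError_le _ ha.le).trans ?_
      rw [ENNReal.ofReal_add (by positivity) ha.le]
      gcongr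
      refine (hM _).trans (ENNReal.ofReal_le_ofReal ?_)
      gcongr
      refine (norm_add_le _ _).trans ?_
      gcongr
      rw [norm_smul, norm_inv, Real.norm_of_nonneg (by linarith)]
      exact mul_le_of_le_one_left (norm_nonneg _) (inv_le_one_of_one_le₀ hσM)
    · simpa using hC (E + (σ M)⁻¹ • v)
  · rw [lintegral_mul_const' _ _ ENNReal.ofReal_ne_top]
    refine ENNReal.mul_ne_top (Integrable.lintegral_lt_top ?_).ne ENNReal.ofReal_ne_top
    refine Continuous.integrable_of_hasCompactSupport ?_ hfc.mul_right
    refine hf.mul ((continuous_const.mul ?_).add continuous_const)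
    exact (by fun_prop : Continuous fun v : X => 1 + (‖E‖ + ‖v‖)).rpow_const
      fun v => Or.inl (by positivity)
  · refine ae_of_all _ fun v => ?_
    have l := h.tendsto_lintegral_insertFactor_sub hr hβ hlim (tendsto_add_inv_smul (E := E) hσ v)
    have l2 := ENNReal.Tendsto.const_mul (a := ENNReal.ofReal (f v))
      (ENNReal.Tendsto.mul_const (b := ENNReal.ofReal C) l (Or.inr ENNReal.ofReal_ne_top))
      (Or.inr ENNReal.ofReal_ne_top)
    rw [zero_mul, mul_zero] at l2
    refine tendsto_of_tendsto_of_tendsto_of_le_of_le tendsto_const_nhds l2 (fun _ => zero_le) fun M => ?_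
    exact mul_le_mul_right (mul_le_mul_right (hbd _) _) _

end Limit

end LogGas

end

/-! ### The approximate differential equation and the limit of the Laplace functional -/

noncomputable section

namespace LogGas

variable {X : Type*} [NormedAddCommGroup X] [InnerProductSpace ℝ X] [FiniteDimensional ℝ X]
  [MeasurableSpace X] [BorelSpace X] [Nontrivial X]

section OneStep

variable {r : X → ℝ} {γ c : ℝ} {μ : Measure X} {β : ℝ} {M : ℕ} {H : X → ℝ} {t : ℝ}

/-- The mean of `∏_j (1 - t H(y_j)) |y_j - u|^β`. -/
def tiltedMean (r : X → ℝ) (β : ℝ) (M : ℕ) (H : X → ℝ) (t : ℝ) (u : X) : ℝ≥0∞ :=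
  ∫⁻ y : Fin M → X, ENNReal.ofReal (thinning H t y) * ENNReal.ofReal (insertFactor β u y)
    ∂(gasMeasure r β M)

lemma measurable_tiltedMean (hH : Measurable H) : Measurable (tiltedMean r β M H t) := by
  unfold tiltedMean
  refine Measurable.lintegral_prod_right' (f := fun p : X × (Fin M → X) =>
    ENNReal.ofReal (thinning H t p.2) * ENNReal.ofReal (insertFactor β p.1 p.2)) ?_
  have h1 := measurable_insertFactor (X := X) β (M := M)
  have h2 := (measurable_thinning hH t (M := M)).comp
    (measurable_snd : Measurable (Prod.snd : X × (Fin M → X) → Fin M → X))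
  exact h2.ennreal_ofReal.mul h1.ennreal_ofReal

/-- All `M + 1` summands agree, because any particle can be the one split off. -/
lemma IsSelfConsistent.sum_lintegral_eq (hr : IsWeight r) (h : IsSelfConsistent r γ μ c) (hβ : 0 ≤ β)
    (hH : Measurable H) (h0 : ∀ x, 0 ≤ H x) :
    ∑ i, ∫⁻ x : Fin (M + 1) → X, ENNReal.ofReal (H (x i)
        * ∏ j ∈ Finset.univ.erase i, (1 - t * H (x j))) ∂(gasMeasure r β (M + 1))
      = (M + 1 : ℝ≥0∞) * ((insertPartition r β M)⁻¹
        * ∫⁻ u, ENNReal.ofReal (H u) * tiltedMean r β M H t u ∂(baseMeasure r)) := by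
  have e : ∀ i : Fin (M + 1), ∫⁻ x : Fin (M + 1) → X, ENNReal.ofReal (H (x i)
        * ∏ j ∈ Finset.univ.erase i, (1 - t * H (x j))) ∂(gasMeasure r β (M + 1))
      = (insertPartition r β M)⁻¹
        * ∫⁻ u, ENNReal.ofReal (H u) * tiltedMean r β M H t u ∂(baseMeasure r) := by
    intro i
    rw [h.lintegral_gasMeasure_succ hr hβ i (by fun_prop)]
    congr 1
    refine lintegral_congr fun u => ?_
    rw [tiltedMean, ← lintegral_const_mul' _ _ ENNReal.ofReal_ne_top]
    refine lintegral_congr fun y => ?_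
    rw [Fin.insertNth_apply_same, prod_erase_insertNth (fun x => 1 - t * H x), ENNReal.ofReal_mul (h0 u),
      mul_assoc, thinning]
  simp [e]

lemma IsSelfConsistent.lintegral_thinning_eq (hr : IsWeight r) (h : IsSelfConsistent r γ μ c) (hβ : 0 ≤ β)
    (hH : Measurable H) (h0 : ∀ x, 0 ≤ H x) (h1 : ∀ x, H x ≤ 1) (ht : t ∈ Set.Icc (0:ℝ) 1) :
    ∫⁻ x : Fin (M + 1) → X, ENNReal.ofReal (thinning H t x) ∂(gasMeasure r β (M + 1))
      = (insertPartition r β M)⁻¹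
        * ∫⁻ u, ENNReal.ofReal (1 - t * H u) * tiltedMean r β M H t u ∂(baseMeasure r) := by
  have hm := measurable_thinning hH t (M := M + 1)
  rw [h.lintegral_gasMeasure_succ hr hβ 0 (by fun_prop)]
  congr 1
  refine lintegral_congr fun u => ?_
  rw [tiltedMean, ← lintegral_const_mul' _ _ ENNReal.ofReal_ne_top]
  refine lintegral_congr fun y => ?_
  rw [thinning, Fin.prod_univ_succAbove _ 0]
  simp only [Fin.insertNth_apply_same, Fin.insertNth_apply_succAbove]
  rw [ENNReal.ofReal_mul (one_sub_mul_mem h0 h1 ht u).1, mul_assoc, thinning]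

/-- The rescaled mass of `H` near the reference point. -/
def localMass (r : X → ℝ) (β : ℝ) (M : ℕ) (H : X → ℝ) : ℝ≥0∞ :=
  (insertPartition r β M)⁻¹ * ((M + 1 : ℝ≥0∞) * ∫⁻ u, ENNReal.ofReal (H u) ∂(baseMeasure r))

/-- The rescaled error of the insertion factor near the reference point. -/
def localError (r : X → ℝ) (β : ℝ) (M : ℕ) (H : X → ℝ) (a : ℝ) : ℝ≥0∞ :=
  (insertPartition r β M)⁻¹ * ((M + 1 : ℝ≥0∞)
    * ∫⁻ u, ENNReal.ofReal (H u) * insertError r β M u a ∂(baseMeasure r))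

/-- The normalised global error of the insertion factor. -/
def globalError (r : X → ℝ) (β : ℝ) (M : ℕ) (b : X → ℝ) : ℝ≥0∞ :=
  (insertPartition r β M)⁻¹ * ∫⁻ u, insertError r β M u (b u) ∂(baseMeasure r)

/-- Both `L` and `-L'`, for `M + 1` particles, are compared with the thinning mean `p` of `M`
particles: `-L'` with the insertion factor frozen at `a` where `H` lives, `L` with the insertion
factor replaced by `b(u)`. -/
lemma IsSelfConsistent.abs_deriv_add_le (hr : IsWeight r) (h : IsSelfConsistent r γ μ c) (hβ : 0 ≤ β)
    (hH : Measurable H) (h0 : ∀ x, 0 ≤ H x) (h1 : ∀ x, H x ≤ 1) (ht : t ∈ Set.Icc (0:ℝ) 1)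
    {b : X → ℝ} (hb : Measurable b) (a : ℝ) {l : ℝ} (hl : 0 ≤ l)
    (hk : localMass r β M H * ENNReal.ofReal a ≠ ⊤)
    (hm : (insertPartition r β M)⁻¹ * ∫⁻ u, ENNReal.ofReal (b u) ∂(baseMeasure r) ≠ ⊤)
    (he₁ : localError r β M H a ≠ ⊤) (he₂ : globalError r β M b ≠ ⊤) :
    |-(∑ i, ∫⁻ x : Fin (M + 1) → X, ENNReal.ofReal (H (x i)
        * ∏ j ∈ Finset.univ.erase i, (1 - t * H (x j))) ∂(gasMeasure r β (M + 1))).toReal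
      + l * (∫⁻ x : Fin (M + 1) → X, ENNReal.ofReal (thinning H t x) ∂(gasMeasure r β (M + 1))).toReal|
    ≤ (localError r β M H a).toReal + |(localMass r β M H * ENNReal.ofReal a).toReal - l|
      + l * (|1 - ((insertPartition r β M)⁻¹ * ∫⁻ u, ENNReal.ofReal (b u) ∂(baseMeasure r)).toReal|
        + (globalError r β M b + (M + 1 : ℝ≥0∞)⁻¹
          * (localMass r β M H * ENNReal.ofReal a + localError r β M H a)).toReal) := by
  have hprob := h.isProbabilityMeasure_gasMeasure hr hβ M
  have hTm : Measurable fun y : Fin M → X => ENNReal.ofReal (thinning H t y) :=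
    (measurable_thinning hH t).ennreal_ofReal
  have hT : ∀ y : Fin M → X, ENNReal.ofReal (thinning H t y) ≤ 1 := fun y =>
    ENNReal.ofReal_le_one.2 (thinning_le_one h0 h1 ht y)
  have hA := measurable_tiltedMean (r := r) (β := β) (M := M) (t := t) hH
  set p := ∫⁻ y : Fin M → X, ENNReal.ofReal (thinning H t y) ∂(gasMeasure r β M) with hp
  have hp1 : p ≤ 1 := (lintegral_mono hT).trans (by simp)
  have hpt : p ≠ ⊤ := ne_top_of_le_ne_top ENNReal.one_ne_top hp1
  have up : ∀ u b, tiltedMean r β M H t u ≤ ENNReal.ofReal b * p + insertError r β M u b :=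
    fun u b => lintegral_mul_insertFactor_le hTm hT u b
  have lo : ∀ u b, ENNReal.ofReal b * p ≤ tiltedMean r β M H t u + insertError r β M u b :=
    fun u b => mul_lintegral_le_lintegral_mul_insertFactor hTm hT u b
  rw [h.sum_lintegral_eq hr hβ hH h0, h.lintegral_thinning_eq hr hβ hH h0 h1 ht]
  set q := (insertPartition r β M)⁻¹ with hq
  set B := baseMeasure r
  have hEa := measurable_insertError r β M (b := fun _ => a) measurable_const
  have hEb := measurable_insertError r β M hb
  have hHm := hH.ennreal_ofReal
  have hkp : localMass r β M H * ENNReal.ofReal a * p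
      = q * ((M + 1 : ℝ≥0∞) * ∫⁻ u, ENNReal.ofReal (H u) * (ENNReal.ofReal a * p) ∂B) := by
    rw [lintegral_mul_const' _ _ (by finiteness), localMass]; ring
  have upD : (M + 1 : ℝ≥0∞) * (q * ∫⁻ u, ENNReal.ofReal (H u) * tiltedMean r β M H t u ∂B)
      ≤ localMass r β M H * ENNReal.ofReal a * p + localError r β M H a := by
    rw [hkp, localError, ← mul_add, ← mul_add, mul_left_comm, ← lintegral_add_left (by fun_prop)]
    gcongr with u
    rw [← mul_add]
    gcongr
    exact up u a
  have loD : localMass r β M H * ENNReal.ofReal a * p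
      ≤ (M + 1 : ℝ≥0∞) * (q * ∫⁻ u, ENNReal.ofReal (H u) * tiltedMean r β M H t u ∂B)
        + localError r β M H a := by
    rw [hkp, localError, mul_left_comm (M + 1 : ℝ≥0∞) q, ← mul_add, ← mul_add,
      ← lintegral_add_left (by fun_prop)]
    gcongr with u
    rw [← mul_add]
    gcongr
    exact lo u a
  have hmp : q * (∫⁻ u, ENNReal.ofReal (b u) ∂B) * p = q * ∫⁻ u, ENNReal.ofReal (b u) * p ∂B := by
    rw [lintegral_mul_const' _ _ hpt, mul_assoc]
  have h1t : Measurable fun u => ENNReal.ofReal (1 - t * H u) := by fun_prop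
  have hM1 : (M + 1 : ℝ≥0∞) ≠ ⊤ := by finiteness
  have hM0 : (M + 1 : ℝ≥0∞) ≠ 0 := by simp
  -- A given particle is seen by `H` with weight of order `1/(M+1)` only; so the factor `1 - tH(u)`
  -- is negligible in `L`.
  have loc : q * ∫⁻ u, ENNReal.ofReal (H u) * tiltedMean r β M H t u ∂B
      ≤ (M + 1 : ℝ≥0∞)⁻¹ * (localMass r β M H * ENNReal.ofReal a + localError r β M H a) := by
    calc _ = (M + 1 : ℝ≥0∞)⁻¹ * ((M + 1 : ℝ≥0∞)
          * (q * ∫⁻ u, ENNReal.ofReal (H u) * tiltedMean r β M H t u ∂B)) := by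
          rw [← mul_assoc, ENNReal.inv_mul_cancel hM0 hM1, one_mul]
      _ ≤ (M + 1 : ℝ≥0∞)⁻¹ * (localMass r β M H * ENNReal.ofReal a * p + localError r β M H a) := by
          gcongr
      _ ≤ _ := mul_le_mul_right (add_le_add (mul_le_of_le_one_right zero_le hp1) le_rfl) _
  refine abs_neg_toReal_add_le hl hk hm he₁ ?_ hp1 upD loD ?_ ?_
  · refine ENNReal.add_ne_top.2 ⟨he₂, ENNReal.mul_ne_top (ENNReal.inv_ne_top.2 hM0) ?_⟩
    exact ENNReal.add_ne_top.2 ⟨hk, he₁⟩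
  · rw [hmp, ← add_assoc]
    refine le_trans ?_ le_self_add
    rw [globalError, ← mul_add, ← lintegral_add_right _ hEb]
    gcongr with u
    calc _ ≤ 1 * tiltedMean r β M H t u := by
          gcongr
          exact ENNReal.ofReal_le_one.2 (one_sub_mul_mem h0 h1 ht u).2
      _ ≤ _ := by rw [one_mul]; exact up u (b u)
  · rw [hmp]
    calc _ ≤ q * (∫⁻ u, ENNReal.ofReal (1 - t * H u) * tiltedMean r β M H t u ∂B
          + ∫⁻ u, ENNReal.ofReal (H u) * tiltedMean r β M H t u ∂B
          + ∫⁻ u, insertError r β M u (b u) ∂B) := by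
          rw [← lintegral_add_left (by fun_prop), ← lintegral_add_left (by fun_prop)]
          gcongr with u
          refine (lo u (b u)).trans ?_
          gcongr
          rw [← add_mul, ← ENNReal.ofReal_add (one_sub_mul_mem h0 h1 ht u).1 (h0 u)]
          refine le_mul_of_one_le_left zero_le ?_
          rw [← ENNReal.ofReal_one]
          refine ENNReal.ofReal_le_ofReal ?_
          nlinarith [mul_le_of_le_one_left (h0 u) ht.2]
      _ = q * ∫⁻ u, ENNReal.ofReal (1 - t * H u) * tiltedMean r β M H t u ∂B
          + (globalError r β M b + q * ∫⁻ u, ENNReal.ofReal (H u) * tiltedMean r β M H t u ∂B) := by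
          rw [globalError]; ring
      _ ≤ _ := by gcongr

end OneStep

/-- Convergence of the Laplace functional of the rescaled gas. -/
theorem IsSelfConsistent.tendsto_integral_thinning {r : X → ℝ} (hr : IsWeight r) {γ c : ℝ}
    {μ : Measure X} (h : IsSelfConsistent r γ μ c) {β : ℕ → ℝ} (hβ : ∀ M, 0 < β M)
    (hlim : Tendsto (fun M : ℕ => (M : ℝ) * β M) atTop (𝓝 γ)) {E : X} (hrE : ContinuousAt r E)
    {f : X → ℝ} (hf : Continuous f) (hfc : HasCompactSupport f) (hf0 : ∀ x, 0 ≤ f x)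
    (hf1 : ∀ x, f x ≤ 1) {σ : ℕ → ℝ} (hσ0 : ∀ M, 0 < σ M) (hσ : Tendsto σ atTop atTop)
    (hσd : ∀ M : ℕ, σ M ^ Module.finrank ℝ X = M + 1) :
    Tendsto (fun M : ℕ => ∫ x : Fin (M + 1) → X, thinning (fun x => f (σ M • (x - E))) 1 x
      ∂(gasMeasure r (β M) (M + 1))) atTop (𝓝 (Real.exp (-(eqDensity r γ μ c E * ∫ x, f x)))) := by
  have hU := h.tame.continuous_logPotential.measurable
  have hfm := hf.measurable
  have hrm := hr.meas
  set a := Real.exp (γ * logPotential μ E) with ha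
  set b : X → ℝ := fun u => Real.exp (γ * logPotential μ u) with hb
  have hbm : Measurable b := by fun_prop
  have hc := h.eqConst_pos
  set H : ℕ → X → ℝ := fun M x => f (σ M • (x - E)) with hH
  have hHm : ∀ M, Measurable (H M) := fun M => by simp only [hH]; fun_prop
  set l := eqDensity r γ μ c E * ∫ x, f x with hl
  have hρ0 : 0 ≤ eqDensity r γ μ c E := by
    unfold eqDensity
    exact div_nonneg (mul_nonneg (hr.nonneg _) (Real.exp_pos _).le) h.pos.le
  have hl0 : 0 ≤ l := mul_nonneg hρ0 (integral_nonneg hf0)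
  -- The number of particles `M + 1 = σ_M^d` is exactly the Jacobian of the blow-up at `E`.
  have hscale : ∀ (M : ℕ) (ψ : X → ℝ≥0∞), Measurable ψ →
      (M + 1 : ℝ≥0∞) * ∫⁻ u, ENNReal.ofReal (H M u) * ψ u ∂(baseMeasure r)
        = ∫⁻ v, ENNReal.ofReal (f v) * (ψ (E + (σ M)⁻¹ • v) * ENNReal.ofReal (r (E + (σ M)⁻¹ • v))) := by
    intro M ψ hψ
    have hHm' := hHm M
    rw [lintegral_baseMeasure hr (by fun_prop)]
    have := lintegral_comp_smul_sub (hσ0 M) E (φ := fun v => ENNReal.ofReal (f v))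
      (ψ := fun u => ψ u * ENNReal.ofReal (r u)) (by fun_prop) (by fun_prop)
    rw [← this, hσd]
    have e : ENNReal.ofReal ((M : ℝ) + 1) = (M + 1 : ℝ≥0∞) := by
      rw [ENNReal.ofReal_add (by positivity) zero_le_one]; simp
    rw [e]
    simp only [hH, mul_assoc]
  have lq := h.tendsto_insertPartition hr hβ hlim
  have hc0 : ENNReal.ofReal (eqConst γ μ c) ≠ 0 := by simpa using hc
  have lqi := tendsto_inv_iff.2 lq
  have hqit : (ENNReal.ofReal (eqConst γ μ c))⁻¹ ≠ ⊤ := ENNReal.inv_ne_top.2 hc0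
  have lk : Tendsto (fun M => localMass r (β M) M (H M) * ENNReal.ofReal a) atTop
      (𝓝 (ENNReal.ofReal l)) := by
    have l1 := tendsto_lintegral_mul_weight hr hrE hf hfc hσ
    have hintegr : ∫⁻ v, ENNReal.ofReal (f v) * ENNReal.ofReal (r E) = ENNReal.ofReal ((∫ x, f x) * r E) := by
      rw [lintegral_mul_const' _ _ ENNReal.ofReal_ne_top, ENNReal.ofReal_mul (integral_nonneg hf0),
        ofReal_integral_eq_lintegral_ofReal (hf.integrable_of_hasCompactSupport hfc) (ae_of_all _ hf0)]
    rw [hintegr] at l1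
    have l2 := ENNReal.Tendsto.mul_const (b := ENNReal.ofReal a)
      (ENNReal.Tendsto.mul lqi (Or.inr ENNReal.ofReal_ne_top) l1 (Or.inr hqit))
      (Or.inr ENNReal.ofReal_ne_top)
    -- The combination `r(E) e^{γU(E)}` divided by the limiting ratio of partition functions is the
    -- equilibrium density at `E`.
    have e : (ENNReal.ofReal (eqConst γ μ c))⁻¹ * ENNReal.ofReal ((∫ x, f x) * r E) * ENNReal.ofReal a
        = ENNReal.ofReal l := by
      have hI : 0 ≤ ∫ x, f x := integral_nonneg hf0
      have hrE := hr.nonneg E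
      rw [← ENNReal.ofReal_inv_of_pos hc, ← ENNReal.ofReal_mul (by positivity),
        ← ENNReal.ofReal_mul (by positivity)]
      congr 1
      have := h.mul_exp_logPotential E
      calc _ = (eqConst γ μ c)⁻¹ * (r E * a) * ∫ x, f x := by ring
        _ = _ := by rw [ha, this, inv_mul_cancel_left₀ hc.ne']
    rw [e] at l2
    refine l2.congr fun M => ?_
    rw [localMass]
    congr 2
    have := hscale M (fun _ => 1) measurable_const
    simpa using this.symm
  have le1 : Tendsto (fun M => localError r (β M) M (H M) a) atTop (𝓝 0) := by
    have l1 := h.tendsto_lintegral_mul_insertError (E := E) hr hβ hlim hf hfc hσ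
    have l2 := ENNReal.Tendsto.mul lqi (Or.inr ENNReal.zero_ne_top) l1 (Or.inr hqit)
    rw [mul_zero] at l2
    refine l2.congr fun M => ?_
    rw [localError, hscale M _ (measurable_insertError r (β M) M (b := fun _ => a) measurable_const)]
  have le2 : Tendsto (fun M => globalError r (β M) M b) atTop (𝓝 0) := by
    have l2 := ENNReal.Tendsto.mul lqi (Or.inr ENNReal.zero_ne_top)
      (h.tendsto_lintegral_insertError hr hβ hlim) (Or.inr hqit)
    rwa [mul_zero] at l2
  have lm : Tendsto (fun M => (insertPartition r (β M) M)⁻¹ * ∫⁻ u, ENNReal.ofReal (b u) ∂(baseMeasure r))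
      atTop (𝓝 1) := by
    have l2 := ENNReal.Tendsto.mul_const (b := ∫⁻ u, ENNReal.ofReal (b u) ∂(baseMeasure r)) lqi
      (Or.inl (ENNReal.inv_ne_zero.2 ENNReal.ofReal_ne_top))
    have e : (ENNReal.ofReal (eqConst γ μ c))⁻¹ * ∫⁻ u, ENNReal.ofReal (b u) ∂(baseMeasure r) = 1 := by
      rw [h.lintegral_exp_logPotential hr, ENNReal.inv_mul_cancel hc0 ENNReal.ofReal_ne_top]
    rwa [e] at l2
  have lM : Tendsto (fun M : ℕ => (M + 1 : ℝ≥0∞)⁻¹) atTop (𝓝 0) := by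
    have := (tendsto_add_atTop_iff_nat 1).2 ENNReal.tendsto_inv_nat_nhds_zero
    simpa using this
  have le3 : Tendsto (fun M => globalError r (β M) M b + (M + 1 : ℝ≥0∞)⁻¹
      * (localMass r (β M) M (H M) * ENNReal.ofReal a + localError r (β M) M (H M) a)) atTop (𝓝 0) := by
    have := le2.add (ENNReal.Tendsto.mul lM (Or.inr (by finiteness)) (lk.add le1)
      (Or.inr ENNReal.zero_ne_top))
    simpa using this
  have toR : ∀ {u : ℕ → ℝ≥0∞} {L : ℝ≥0∞}, L ≠ ⊤ → Tendsto u atTop (𝓝 L) →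
      Tendsto (fun M => (u M).toReal) atTop (𝓝 L.toReal) := fun hL hu =>
    (ENNReal.tendsto_toReal hL).comp hu
  set ε : ℕ → ℝ := fun M => (localError r (β M) M (H M) a).toReal
      + |(localMass r (β M) M (H M) * ENNReal.ofReal a).toReal - l|
      + l * (|1 - ((insertPartition r (β M) M)⁻¹ * ∫⁻ u, ENNReal.ofReal (b u) ∂(baseMeasure r)).toReal|
        + (globalError r (β M) M b + (M + 1 : ℝ≥0∞)⁻¹
          * (localMass r (β M) M (H M) * ENNReal.ofReal a + localError r (β M) M (H M) a)).toReal)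
  have lε : Tendsto ε atTop (𝓝 0) := by
    have := ((toR ENNReal.zero_ne_top le1).add ((toR ENNReal.ofReal_ne_top lk).sub_const l).abs).add
      (((((toR ENNReal.one_ne_top lm).const_sub 1).abs).add (toR ENNReal.zero_ne_top le3)).const_mul l)
    have e : (0:ℝ≥0∞).toReal + |(ENNReal.ofReal l).toReal - l|
        + l * (|1 - (1:ℝ≥0∞).toReal| + (0:ℝ≥0∞).toReal) = 0 := by
      simp [ENNReal.toReal_ofReal hl0]
    rwa [e] at this
  rw [tendsto_iff_dist_tendsto_zero]
  refine squeeze_zero' (Eventually.of_forall fun _ => dist_nonneg) ?_ lε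
  filter_upwards [lk.eventually_lt_const ENNReal.ofReal_lt_top, le1.eventually_lt_const ENNReal.zero_lt_top,
    le2.eventually_lt_const ENNReal.zero_lt_top, lm.eventually_lt_const ENNReal.one_lt_top] with M k1 k2 k3 k4
  have hprob := h.isProbabilityMeasure_gasMeasure hr (hβ M).le (M + 1)
  have H0 : ∀ x, 0 ≤ H M x := fun x => hf0 _
  have H1 : ∀ x, H M x ≤ 1 := fun x => hf1 _
  rw [Real.dist_eq]
  refine abs_sub_exp_neg_le (L := fun t => ∫ x : Fin (M + 1) → X, thinning (H M) t x
      ∂(gasMeasure r (β M) (M + 1)))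
    hl0 (by simp [thinning]) (fun t ht => hasDerivAt_integral_thinning _ (hHm M) H0 H1 ht) fun t ht => ?_
  have := h.abs_deriv_add_le hr (hβ M).le (hHm M) H0 H1 ht hbm a hl0 k1.ne k4.ne k2.ne k3.ne
  rw [integral_eq_lintegral_of_nonneg_ae (ae_of_all _ fun x => thinning_nonneg H0 H1 ht x)
    (measurable_thinning (hHm M) t).aestronglyMeasurable]
  exact this

end LogGas

end

/-! ### Construction of homogeneous Poisson point processes -/

noncomputable section

namespace PointProcess

/-- `e^{-s}` for `s ∈ [0, ∞]`. -/
def negExp (s : ℝ≥0∞) : ℝ≥0∞ := EReal.exp (-(s : EReal))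

lemma continuous_negExp : Continuous negExp :=
  ENNReal.continuous_exp.comp (continuous_neg.comp continuous_coe_ennreal_ereal)

lemma measurable_negExp : Measurable negExp := continuous_negExp.measurable

lemma negExp_zero : negExp 0 = 1 := by simp [negExp]

lemma negExp_coe (x : ℝ≥0) : negExp x = ENNReal.ofReal (Real.exp (-(x : ℝ))) := by
  have : -((x : ℝ≥0∞) : EReal) = ((-(x : ℝ) : ℝ) : EReal) := by
    rw [EReal.coe_neg]; rfl
  rw [negExp, this, EReal.exp_coe]

lemma negExp_le_one (s : ℝ≥0∞) : negExp s ≤ 1 := by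
  rw [negExp, EReal.exp_le_one_iff, EReal.neg_le, neg_zero]
  exact EReal.coe_ennreal_nonneg s

lemma negExp_add (s t : ℝ≥0∞) : negExp (s + t) = negExp s * negExp t := by
  rw [negExp, EReal.coe_ennreal_add, EReal.neg_add (Or.inl (EReal.coe_ennreal_ne_bot s))
    (Or.inr (EReal.coe_ennreal_ne_bot t)), sub_eq_add_neg, EReal.exp_add, negExp, negExp]

lemma negExp_sum {ι : Type*} (s : Finset ι) (g : ι → ℝ≥0∞) :
    negExp (∑ i ∈ s, g i) = ∏ i ∈ s, negExp (g i) := by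
  classical
  induction s using Finset.induction_on with
  | empty => simp [negExp_zero]
  | insert i s hi ih => rw [Finset.sum_insert hi, Finset.prod_insert hi, negExp_add, ih]

lemma tendsto_prod_negExp (g : ℕ → ℝ≥0∞) :
    Tendsto (fun n => ∏ i ∈ Finset.range n, negExp (g i)) atTop (𝓝 (negExp (∑' i, g i))) := by
  simp_rw [← negExp_sum]
  exact (continuous_negExp.tendsto _).comp (ENNReal.tendsto_nat_tsum g)

lemma lintegral_prod_infinitePi {Y : ℕ → Type*} [∀ i, MeasurableSpace (Y i)] (μ : ∀ i, Measure (Y i))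
    [∀ i, IsProbabilityMeasure (μ i)] {g : ∀ i, Y i → ℝ≥0∞} (hg : ∀ i, Measurable (g i)) (n : ℕ) :
    ∫⁻ ω, ∏ i ∈ Finset.range n, g i (ω i) ∂(Measure.infinitePi μ)
      = ∏ i ∈ Finset.range n, ∫⁻ y, g i y ∂(μ i) := by
  refine (ProbabilityTheory.lintegral_prod_eq_prod_lintegral_of_indepFun (μ := Measure.infinitePi μ)
    (Finset.range n) (fun i ω => g i (ω i)) (ProbabilityTheory.iIndepFun_infinitePi hg)
    (fun i => by fun_prop)).trans ?_
  refine Finset.prod_congr rfl fun i _ => ?_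
  exact (measurePreserving_eval_infinitePi μ i).lintegral_comp (hg i)

/-- The generating function of the Poisson law. -/
lemma lintegral_pow_poissonMeasure (m a : ℝ≥0) (ha : a ≤ 1) :
    ∫⁻ k, (a : ℝ≥0∞) ^ k ∂(ProbabilityTheory.poissonMeasure m) = negExp ((m * (1 - a) : ℝ≥0) : ℝ≥0∞) := by
  have h1 : ∑' k, ProbabilityTheory.poissonMeasure (m * a) {k} = 1 := by
    have := lintegral_countable' (μ := ProbabilityTheory.poissonMeasure (m * a)) (fun _ : ℕ => 1)
    simpa using this.symm
  rw [lintegral_countable']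
  -- Weighting the Poisson law of mean `m` by `a^k` gives a multiple of the Poisson law of mean
  -- `ma`, whose total mass is one.
  have e : ∀ k : ℕ, (a : ℝ≥0∞) ^ k * ProbabilityTheory.poissonMeasure m {k}
      = negExp ((m * (1 - a) : ℝ≥0) : ℝ≥0∞) * ProbabilityTheory.poissonMeasure (m * a) {k} := by
    intro k
    rw [ProbabilityTheory.poissonMeasure_singleton, ProbabilityTheory.poissonMeasure_singleton,
      negExp_coe, ← ENNReal.ofReal_mul (Real.exp_pos _).le, ← ENNReal.ofReal_coe_nnreal,
      ← ENNReal.ofReal_pow (NNReal.coe_nonneg a), ← ENNReal.ofReal_mul (by positivity)]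
    congr 1
    push_cast [NNReal.coe_sub ha]
    have : Real.exp (-(m:ℝ)) = Real.exp (-(m * (1 - a))) * Real.exp (-(m * a : ℝ)) := by
      rw [← Real.exp_add]; congr 1; ring
    rw [this, mul_pow]
    ring
  simp_rw [e]
  rw [ENNReal.tsum_mul_left, h1, mul_one]

variable {X : Type*} [MeasurableSpace X]

/-- The point configuration with the first `k_i` points of the `i`-th sequence, for every `i`. -/
def configuration (ω : ℕ → ℕ × (ℕ → X)) : Measure X :=
  Measure.sum fun p : ℕ × ℕ => if p.2 < (ω p.1).1 then Measure.dirac ((ω p.1).2 p.2) else 0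

/-- The law of a Poisson number of independent points. -/
def cellLaw (m : ℝ≥0) (π : Measure X) : Measure (ℕ × (ℕ → X)) :=
  (ProbabilityTheory.poissonMeasure m).prod (Measure.infinitePi fun _ => π)

instance (m : ℝ≥0) (π : Measure X) [IsProbabilityMeasure π] : IsProbabilityMeasure (cellLaw m π) := by
  unfold cellLaw; infer_instance

/-- The sum of `f` over the first `k` points of a sequence. -/
def cellSum (f : X → ℝ≥0∞) (q : ℕ × (ℕ → X)) : ℝ≥0∞ := ∑' j, if j < q.1 then f (q.2 j) else 0

lemma measurable_cellSum {f : X → ℝ≥0∞} (hf : Measurable f) : Measurable (cellSum f) := by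
  unfold cellSum
  refine Measurable.tsum fun j => ?_
  exact Measurable.ite (measurableSet_lt measurable_const measurable_fst) (by fun_prop) measurable_const

lemma lintegral_configuration {f : X → ℝ≥0∞} (hf : Measurable f) (ω : ℕ → ℕ × (ℕ → X)) :
    ∫⁻ x, f x ∂(configuration ω) = ∑' i, cellSum f (ω i) := by
  rw [configuration, lintegral_sum_measure, ENNReal.tsum_prod']
  refine tsum_congr fun i => tsum_congr fun j => ?_
  split_ifs
  · rw [lintegral_dirac' _ hf]
  · simp

lemma measurable_configuration : Measurable (configuration (X := X)) := by
  refine Measure.measurable_of_measurable_coe _ fun s hs => ?_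
  have e : ∀ ω : ℕ → ℕ × (ℕ → X), configuration ω s = ∑' i, cellSum (s.indicator 1) (ω i) := by
    intro ω
    rw [← lintegral_configuration (measurable_one.indicator hs), lintegral_indicator_one hs]
  simp_rw [e]
  have := measurable_cellSum (f := s.indicator (1 : X → ℝ≥0∞)) (measurable_one.indicator hs)
  exact Measurable.tsum fun i => by fun_prop

/-- Given `k` points, independence produces `a^k` with `a = ∫ e^{-f} dπ`; the generating function of
the Poisson law then averages over `k`. -/
lemma lintegral_negExp_cellSum (m : ℝ≥0) (π : Measure X) [IsProbabilityMeasure π] {f : X → ℝ≥0}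
    (hf : Measurable f) :
    ∫⁻ q, negExp (cellSum (fun x => f x) q) ∂(cellLaw m π)
      = negExp (∫⁻ x, ENNReal.ofReal (1 - Real.exp (-(f x : ℝ))) ∂(m • π)) := by
  set a := ∫⁻ x, negExp (f x) ∂π with ha
  have ha1 : a ≤ 1 := (lintegral_mono fun x => negExp_le_one _).trans (by simp)
  have hat : a ≠ ⊤ := ne_top_of_le_ne_top ENNReal.one_ne_top ha1
  have hfm : Measurable fun x => (f x : ℝ≥0∞) := by fun_prop
  have hS : Measurable fun q : ℕ × (ℕ → X) => negExp (cellSum (fun x => (f x : ℝ≥0∞)) q) :=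
    measurable_negExp.comp (measurable_cellSum hfm)
  rw [cellLaw, lintegral_prod _ hS.aemeasurable]
  have e : ∀ k : ℕ, ∫⁻ x, negExp (cellSum (fun x => f x) (k, x)) ∂(Measure.infinitePi fun _ : ℕ => π)
      = (a.toNNReal : ℝ≥0∞) ^ k := by
    intro k
    have e1 : ∀ x : ℕ → X, negExp (cellSum (fun x => f x) (k, x))
        = ∏ j ∈ Finset.range k, negExp (f (x j)) := by
      intro x
      rw [← negExp_sum, cellSum, tsum_eq_sum (s := Finset.range k)]
      · congr 1
        exact Finset.sum_congr rfl fun j hj => if_pos (Finset.mem_range.1 hj)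
      · intro j hj
        exact if_neg fun h => hj (Finset.mem_range.2 h)
    simp_rw [e1]
    rw [lintegral_prod_infinitePi (fun _ => π) (g := fun _ x => negExp (f x))
      (fun _ => measurable_negExp.comp hfm), ENNReal.coe_toNNReal hat]
    simp [ha]
  simp_rw [e]
  rw [lintegral_pow_poissonMeasure _ _ (by rwa [← ENNReal.coe_le_coe, ENNReal.coe_toNNReal hat])]
  congr 1
  have h2 : ∫⁻ x, ENNReal.ofReal (1 - Real.exp (-(f x : ℝ))) ∂π = 1 - a := by
    have hg : Measurable fun x => negExp (f x) := measurable_negExp.comp hfm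
    rw [ha, ← lintegral_one.trans (measure_univ (μ := π)), ← lintegral_sub hg hat
      (ae_of_all _ fun x => negExp_le_one _)]
    refine lintegral_congr fun x => ?_
    rw [negExp_coe, ENNReal.ofReal_sub _ (Real.exp_pos _).le, ENNReal.ofReal_one]
  rw [lintegral_smul_measure, h2]
  rw [ENNReal.coe_mul, ENNReal.coe_sub, ENNReal.coe_one, ENNReal.coe_toNNReal hat]
  rfl

variable (m : ℕ → ℝ≥0) (π : ℕ → Measure X) [∀ i, IsProbabilityMeasure (π i)]

/-- The law of independent Poisson numbers of independent points. -/
def configurationLaw (m : ℕ → ℝ≥0) (π : ℕ → Measure X) : Measure (ℕ → ℕ × (ℕ → X)) :=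
  Measure.infinitePi fun i => cellLaw (m i) (π i)

instance : IsProbabilityMeasure (configurationLaw m π) := by
  unfold configurationLaw; infer_instance

/-- Independent cells multiply the Laplace functionals. The infinite product is a limit of finite
ones bounded by `1`, including the case of infinite sums. -/
lemma laplaceFunctional_configuration {f : X → ℝ≥0} (hf : Measurable f) :
    laplaceFunctional (configurationLaw m π) configuration f
      = negExp (∫⁻ x, ENNReal.ofReal (1 - Real.exp (-(f x : ℝ))) ∂(Measure.sum fun i => m i • π i)) := by
  have hfm : Measurable fun x => (f x : ℝ≥0∞) := by fun_prop
  have hS : Measurable fun q : ℕ × (ℕ → X) => negExp (cellSum (fun x => (f x : ℝ≥0∞)) q) :=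
    measurable_negExp.comp (measurable_cellSum hfm)
  have l1 : Tendsto (fun n => ∫⁻ ω, ∏ i ∈ Finset.range n, negExp (cellSum (fun x => (f x : ℝ≥0∞)) (ω i))
      ∂(configurationLaw m π)) atTop (𝓝 (laplaceFunctional (configurationLaw m π) configuration f)) := by
    refine tendsto_lintegral_filter_of_dominated_convergence (fun _ => 1)
      (Eventually.of_forall fun n => Finset.measurable_prod _ fun i _ => hS.comp (measurable_pi_apply i))
      ?_ (by simp) (ae_of_all _ fun ω => ?_)
    · exact Eventually.of_forall fun n => ae_of_all _ fun ω =>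
        Finset.prod_le_one' fun i _ => negExp_le_one _
    · rw [lintegral_configuration hfm]
      exact tendsto_prod_negExp _
  have l2 := tendsto_prod_negExp fun i => ∫⁻ x, ENNReal.ofReal (1 - Real.exp (-(f x : ℝ))) ∂(m i • π i)
  rw [← lintegral_sum_measure] at l2
  refine tendsto_nhds_unique l1 (l2.congr fun n => ?_)
  rw [configurationLaw, lintegral_prod_infinitePi _ (fun _ => hS)]
  exact Finset.prod_congr rfl fun i _ => (lintegral_negExp_cellSum _ _ hf).symm

lemma ae_configurationLaw {p : ℕ → X → Prop} (hp : ∀ i, ∀ᵐ x ∂(π i), p i x) :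
    ∀ᵐ ω ∂(configurationLaw m π), ∀ i j, p i ((ω i).2 j) := by
  refine ae_all_iff.2 fun i => ae_all_iff.2 fun j => ?_
  have h1 := (measurePreserving_eval_infinitePi (fun i => cellLaw (m i) (π i)) i).quasiMeasurePreserving
  have h2 : Measure.QuasiMeasurePreserving (Prod.snd : ℕ × (ℕ → X) → _) (cellLaw (m i) (π i))
    (Measure.infinitePi fun _ => π i) := Measure.quasiMeasurePreserving_snd
  have h3 := (measurePreserving_eval_infinitePi (fun _ : ℕ => π i) j).quasiMeasurePreserving
  exact (h3.comp (h2.comp h1)).ae (hp i)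

lemma ae_injective_configurationLaw [MeasurableSingletonClass X] [MeasurableEq X]
    (hπ : ∀ i x, π i {x} = 0) :
    ∀ᵐ ω ∂(configurationLaw m π), ∀ i, Function.Injective (ω i).2 := by
  refine ae_all_iff.2 fun i => ?_
  have h1 := (measurePreserving_eval_infinitePi (fun i => cellLaw (m i) (π i)) i).quasiMeasurePreserving
  have h2 : Measure.QuasiMeasurePreserving (Prod.snd : ℕ × (ℕ → X) → _) (cellLaw (m i) (π i))
    (Measure.infinitePi fun _ => π i) := Measure.quasiMeasurePreserving_snd
  have key : ∀ᵐ x ∂(Measure.infinitePi fun _ : ℕ => π i), Function.Injective x := by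
    have : ∀ᵐ x ∂(Measure.infinitePi fun _ : ℕ => π i), ∀ j k, j ≠ k → x j ≠ x k := by
      refine ae_all_iff.2 fun j => ae_all_iff.2 fun k => ?_
      by_cases hjk : j = k
      · simp [hjk]
      have h4 : ∀ᵐ p ∂((π i).prod (π i)), p.1 ≠ p.2 := by
        rw [Measure.ae_prod_iff_ae_ae]
        · refine ae_of_all _ fun x => ?_
          rw [ae_iff]
          have : {y | ¬ (x ≠ y)} = {x} := by ext y; simp [eq_comm]
          simpa [this] using hπ i x
        · exact (measurableSet_eq_fun measurable_fst measurable_snd).compl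
      rw [← Measure.infinitePi_map_eval_prod (P := fun _ : ℕ => π i) hjk] at h4
      filter_upwards [ae_of_ae_map (by fun_prop) h4] with x hx _ using hx
    filter_upwards [this] with x hx j k hjk
    by_contra hne
    exact hx j k hne hjk
  exact (h2.comp h1).ae key

/-- The superposition of independent finite Poisson clouds is a Poisson point process. -/
theorem isPoisson_configuration [TopologicalSpace X] [MeasurableSingletonClass X] [MeasurableEq X]
    {A : ℕ → Set X} (hA : Pairwise (Function.onFun Disjoint A))
    (hAK : ∀ K, IsCompact K → ∃ n, ∀ i, n ≤ i → Disjoint K (A i))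
    (hπA : ∀ i, ∀ᵐ x ∂(π i), x ∈ A i) (hπ : ∀ i x, π i {x} = 0) :
    IsPoisson (configurationLaw m π) configuration (Measure.sum fun i => m i • π i) := by
  refine ⟨inferInstance, ⟨measurable_configuration, ?_⟩, fun f hf =>
    laplaceFunctional_configuration m π hf⟩
  filter_upwards [ae_configurationLaw m π hπA, ae_injective_configurationLaw m π hπ] with ω h1 h2
  set T : Set (ℕ × ℕ) := {p | p.2 < (ω p.1).1}
  set φ : ℕ × ℕ → X := fun p => (ω p.1).2 p.2
  -- Points of different cells differ because the cells are disjoint, points of one cell because the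
  -- laws have no atoms. Hence the process is simple.
  have hφ : Function.Injective φ := by
    rintro ⟨i, j⟩ ⟨i', j'⟩ hp
    have hi : i = i' := by
      by_contra hne
      refine Set.disjoint_left.1 (hA hne) (h1 i j) ?_
      have : (ω i).2 j = (ω i').2 j' := hp
      rw [this]
      exact h1 i' j'
    subst hi
    rw [show j = j' from h2 i hp]
  refine ⟨φ '' T, (Set.to_countable T).image φ, fun K hK => ?_, ?_⟩
  · obtain ⟨n, hn⟩ := hAK K hK
    have hfin : Set.Finite {p : ℕ × ℕ | p.1 < n ∧ p.2 < (ω p.1).1} := by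
      refine ((Set.finite_lt_nat n).biUnion (t := fun i => (fun j => (i, j)) '' {j | j < (ω i).1})
        fun i _ => (Set.finite_lt_nat _).image _).subset ?_
      rintro ⟨i, j⟩ ⟨hi, hj⟩
      exact Set.mem_biUnion (show i ∈ {i | i < n} from hi) ⟨j, hj, rfl⟩
    refine (hfin.image φ).subset ?_
    rintro _ ⟨⟨p, hp, rfl⟩, hxK⟩
    refine ⟨p, ⟨?_, hp⟩, rfl⟩
    by_contra hni
    exact Set.disjoint_left.1 (hn p.1 (not_lt.1 hni)) hxK (h1 _ _)
  · ext s hs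
    rw [configuration, Measure.sum_apply _ hs, Measure.sum_apply _ hs]
    have e : ∀ p : ℕ × ℕ, (if p.2 < (ω p.1).1 then Measure.dirac ((ω p.1).2 p.2) else 0 : Measure X) s
        = T.indicator (fun p => Measure.dirac (φ p) s) p := by
      intro p
      by_cases hp : p.2 < (ω p.1).1
      · rw [if_pos hp, Set.indicator_of_mem (show p ∈ T from hp)]
      · rw [if_neg hp, Set.indicator_of_notMem (show p ∉ T from hp)]; rfl
    simp_rw [e]
    rw [← tsum_subtype, ← (Equiv.Set.image φ T hφ).tsum_eq]
    rfl

/-- Existence of homogeneous Poisson point processes. -/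
theorem exists_isPoisson {Y : Type} [NormedAddCommGroup Y] [InnerProductSpace ℝ Y]
    [FiniteDimensional ℝ Y] [MeasurableSpace Y] [BorelSpace Y] [Nontrivial Y] {c : ℝ} (hc : 0 < c) :
    ∃ (Ω : Type) (_ : MeasurableSpace Ω) (P : Measure Ω) (Ξ : Ω → Measure Y),
      IsPoisson P Ξ (ENNReal.ofReal c • volume) := by
  set θ : Measure Y := ENNReal.ofReal c • volume with hθ
  -- Shells of unit width: of finite positive measure, so that the conditional laws exist, and a
  -- compact set meets only finitely many of them.
  set A : ℕ → Set Y := fun i => {x | (i : ℝ) ≤ ‖x‖ ∧ ‖x‖ < i + 1} with hA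
  have hAm : ∀ i, MeasurableSet (A i) := fun i =>
    (measurableSet_le measurable_const measurable_norm).inter
      (measurableSet_lt measurable_norm measurable_const)
  have hθc : ENNReal.ofReal c ≠ 0 := by simpa using hc
  have hfin : ∀ i, θ (A i) ≠ ⊤ := by
    intro i
    rw [hθ, Measure.smul_apply, smul_eq_mul]
    refine ENNReal.mul_ne_top ENNReal.ofReal_ne_top (ne_top_of_le_ne_top
      (measure_ball_lt_top (μ := volume) (x := (0 : Y)) (r := i + 1)).ne (measure_mono fun x hx => ?_))
    simpa using hx.2
  have hpos : ∀ i, θ (A i) ≠ 0 := by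
    intro i
    rw [hθ, Measure.smul_apply, smul_eq_mul]
    refine mul_ne_zero hθc ?_
    have hopen : IsOpen {x : Y | (i : ℝ) < ‖x‖ ∧ ‖x‖ < i + 1} :=
      (isOpen_lt continuous_const continuous_norm).inter (isOpen_lt continuous_norm continuous_const)
    have hne : {x : Y | (i : ℝ) < ‖x‖ ∧ ‖x‖ < i + 1}.Nonempty := by
      obtain ⟨x, hx⟩ := exists_norm_eq Y (show (0:ℝ) ≤ i + 1 / 2 by positivity)
      exact ⟨x, by rw [Set.mem_ofPred_eq, hx]; constructor <;> linarith⟩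
    have := hopen.measure_pos volume hne
    have hsub : {x : Y | (i : ℝ) < ‖x‖ ∧ ‖x‖ < i + 1} ⊆ A i := fun x hx => ⟨hx.1.le, hx.2⟩
    exact (this.trans_le (measure_mono hsub)).ne'
  have hdis : Pairwise (Function.onFun Disjoint A) := by
    intro i j hij
    refine Set.disjoint_left.2 fun x hi hj => hij ?_
    have h1 : (i : ℝ) < j + 1 := hi.1.trans_lt hj.2
    have h2 : (j : ℝ) < i + 1 := hj.1.trans_lt hi.2
    have h3 : i < j + 1 := by exact_mod_cast h1
    have h4 : j < i + 1 := by exact_mod_cast h2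
    omega
  have hun : ⋃ i, A i = Set.univ := by
    refine Set.eq_univ_of_forall fun x => Set.mem_iUnion.2 ⟨⌊‖x‖⌋₊, ?_, ?_⟩
    · exact Nat.floor_le (norm_nonneg x)
    · exact Nat.lt_floor_add_one _
  have hprob : ∀ i, IsProbabilityMeasure (ProbabilityTheory.cond θ (A i)) := fun i =>
    ProbabilityTheory.cond_isProbabilityMeasure_of_finite (hpos i) (hfin i)
  have hsum : Measure.sum (fun i => (θ (A i)).toNNReal • ProbabilityTheory.cond θ (A i)) = θ := by
    have e : ∀ i, (θ (A i)).toNNReal • ProbabilityTheory.cond θ (A i) = θ.restrict (A i) := by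
      intro i
      have e1 : (θ (A i)).toNNReal • ProbabilityTheory.cond θ (A i)
          = ((θ (A i)).toNNReal : ℝ≥0∞) • ProbabilityTheory.cond θ (A i) := rfl
      rw [e1, ProbabilityTheory.cond, smul_smul, ENNReal.coe_toNNReal (hfin i),
        ENNReal.mul_inv_cancel (hpos i) (hfin i), one_smul]
    simp_rw [e]
    rw [← Measure.restrict_iUnion hdis hAm, hun, Measure.restrict_univ]
  refine ⟨_, inferInstance, configurationLaw (fun i => (θ (A i)).toNNReal)
    (fun i => ProbabilityTheory.cond θ (A i)), configuration, ?_⟩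
  have key := isPoisson_configuration (fun i => (θ (A i)).toNNReal)
    (fun i => ProbabilityTheory.cond θ (A i)) hdis (fun K hK => ?_) (fun i => ?_) (fun i x => ?_)
  · rwa [hsum] at key
  · obtain ⟨R, hR⟩ := hK.isBounded.exists_norm_le
    obtain ⟨n, hn⟩ := exists_nat_gt R
    refine ⟨n, fun i hi => Set.disjoint_left.2 fun x hx hxA => ?_⟩
    have h1 := hR x hx
    have h2 : (n : ℝ) ≤ i := by exact_mod_cast hi
    linarith [hxA.1]
  · exact ProbabilityTheory.ae_cond_mem (hAm i)
  · refine ProbabilityTheory.cond_absolutelyContinuous ?_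
    rw [hθ, Measure.smul_apply, measure_singleton, smul_zero]

end PointProcess

end

/-! ### Translation from extended-real energies to weights -/

noncomputable section

namespace LogGas

lemma ereal_sum_ne_bot {ι : Type*} (s : Finset ι) {g : ι → EReal} (hg : ∀ i, g i ≠ ⊥) :
    ∑ i ∈ s, g i ≠ ⊥ := by
  classical
  induction s using Finset.induction_on with
  | empty => simp
  | insert i s hi ih => rw [Finset.sum_insert hi]; exact EReal.add_ne_bot_iff.2 ⟨hg i, ih⟩

lemma exp_neg_add {a b : EReal} (ha : a ≠ ⊥) (hb : b ≠ ⊥) :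
    EReal.exp (-(a + b)) = EReal.exp (-a) * EReal.exp (-b) := by
  rw [EReal.neg_add (Or.inl ha) (Or.inr hb), sub_eq_add_neg, EReal.exp_add]

lemma exp_neg_sum {ι : Type*} (s : Finset ι) {g : ι → EReal} (hg : ∀ i, g i ≠ ⊥) :
    EReal.exp (-∑ i ∈ s, g i) = ∏ i ∈ s, EReal.exp (-g i) := by
  classical
  induction s using Finset.induction_on with
  | empty => simp
  | insert i s hi ih =>
    rw [Finset.sum_insert hi, Finset.prod_insert hi, exp_neg_add (hg i) (ereal_sum_ne_bot s hg), ih]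

lemma exp_neg_coe_mul (β : ℝ) (a : EReal) : EReal.exp (-((β : EReal) * a)) = EReal.exp (-a) ^ β := by
  rw [mul_comm, ← EReal.neg_mul, EReal.exp_mul]

lemma coe_mul_ne_bot {β : ℝ} (hβ : 0 < β) {a : EReal} (ha : a ≠ ⊥) : (β : EReal) * a ≠ ⊥ := by
  rw [Ne, ← EReal.exp_eq_zero_iff, mul_comm, EReal.exp_mul, ENNReal.rpow_eq_zero_iff]
  rintro (⟨h, -⟩ | ⟨-, h⟩)
  · exact ha (EReal.exp_eq_zero_iff.1 h)
  · linarith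

variable {n : ℕ}

lemma kernel_ne_bot (x u : EuclideanSpace ℝ (Fin n)) : kernel x u ≠ ⊥ := by
  rw [kernel, Ne, ENNReal.log_eq_bot_iff]
  simp

lemma exp_neg_kernel (x u : EuclideanSpace ℝ (Fin n)) : EReal.exp (-kernel x u) = ENNReal.ofReal ‖x - u‖ := by
  rw [kernel, ENNReal.log_inv, neg_neg, ENNReal.exp_log, ofReal_norm]

/-- The Boltzmann weight `e^{-V}`. -/
def boltzmann (V : EuclideanSpace ℝ (Fin n) → EReal) (x : EuclideanSpace ℝ (Fin n)) : ℝ :=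
  (EReal.exp (-(V x))).toReal

variable {V : EuclideanSpace ℝ (Fin n) → EReal}

lemma ofReal_boltzmann (hV : ∀ x, V x ≠ ⊥) (x : EuclideanSpace ℝ (Fin n)) :
    ENNReal.ofReal (boltzmann V x) = EReal.exp (-(V x)) := by
  rw [boltzmann, ENNReal.ofReal_toReal]
  rw [Ne, EReal.exp_eq_top_iff, EReal.neg_eq_top_iff]
  exact hV x

lemma boltzmann_eq_zero {x : EuclideanSpace ℝ (Fin n)} (hx : ¬ V x < ⊤) : boltzmann V x = 0 := by
  rw [boltzmann, not_lt_top_iff.1 hx]; simp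

lemma boltzmann_of_eq_coe {x : EuclideanSpace ℝ (Fin n)} {v : ℝ} (hx : V x = v) :
    boltzmann V x = Real.exp (-v) := by
  rw [boltzmann, hx, ← EReal.coe_neg, EReal.exp_coe, ENNReal.toReal_ofReal (Real.exp_pos _).le]

lemma exists_eq_coe (hV : ∀ x, V x ≠ ⊥) {x : EuclideanSpace ℝ (Fin n)} (hx : V x < ⊤) :
    ∃ v : ℝ, V x = v := ⟨(V x).toReal, (EReal.coe_toReal hx.ne (hV x)).symm⟩

lemma boltzmann_pos (hV : ∀ x, V x ≠ ⊥) {x : EuclideanSpace ℝ (Fin n)} (hx : V x < ⊤) :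
    0 < boltzmann V x := by
  obtain ⟨v, hv⟩ := exists_eq_coe hV hx
  rw [boltzmann_of_eq_coe hv]
  exact Real.exp_pos _

lemma continuousOn_boltzmann (hV : ∀ x, V x ≠ ⊥) (hcont : ContinuousOn V {x | V x < ⊤}) :
    ContinuousOn (boltzmann V) {x | V x < ⊤} := by
  refine ENNReal.continuousOn_toReal.comp (t := {a | a ≠ ⊤})
    ((ENNReal.continuous_exp.comp continuous_neg).comp_continuousOn hcont) fun x _ => ?_
  change EReal.exp (-(V x)) ≠ ⊤
  rw [← ofReal_boltzmann hV]
  exact ENNReal.ofReal_ne_top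

lemma measurable_boltzmann (hV : ∀ x, V x ≠ ⊥) (hopen : IsOpen {x | V x < ⊤})
    (hcont : ContinuousOn V {x | V x < ⊤}) : Measurable (boltzmann V) := by
  classical
  have e : boltzmann V = {x | V x < ⊤}.piecewise (boltzmann V) (fun _ => 0) := by
    funext x
    by_cases hx : V x < ⊤
    · rw [Set.piecewise_eq_of_mem _ _ _ (show x ∈ {x | V x < ⊤} from hx)]
    · rw [Set.piecewise_eq_of_notMem _ _ _ (show x ∉ {x | V x < ⊤} from hx), boltzmann_eq_zero hx]
  rw [e]
  exact (continuousOn_boltzmann hV hcont).measurable_piecewise continuousOn_const hopen.measurableSet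

/-- The lower bounds on `V - κϑ` exponentiate to decay faster than any power; the total mass is
positive because `{V < ⊤}` is open and contains `E`. -/
lemma isWeight_boltzmann (hV : ∀ x, V x ≠ ⊥) (hopen : IsOpen {x | V x < ⊤})
    (hcont : ContinuousOn V {x | V x < ⊤})
    (hinf : ∀ κ : ℝ, 0 ≤ κ → ∃ c : ℝ, ∀ x, V x < ⊤ →
      (c : EReal) ≤ V x - ((κ * LogGas.theta x : ℝ) : EReal))
    (hintegr : (∫⁻ x, EReal.exp (-(V x))) < ⊤) {E : EuclideanSpace ℝ (Fin n)} (hE : V E < ⊤) :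
    IsWeight (boltzmann V) := by
  have hm := measurable_boltzmann hV hopen hcont
  have h0 : ∀ x, 0 ≤ boltzmann V x := fun x => ENNReal.toReal_nonneg
  refine ⟨hm, h0, fun κ hκ => ?_, ?_⟩
  · obtain ⟨c, hc⟩ := hinf κ hκ
    refine ⟨Real.exp (-c), fun x => ?_⟩
    by_cases hx : V x < ⊤
    · obtain ⟨v, hv⟩ := exists_eq_coe hV hx
      have h1 := hc x hx
      rw [hv, ← EReal.coe_sub, EReal.coe_le_coe_iff] at h1
      rw [boltzmann_of_eq_coe hv, Real.rpow_def_of_pos (by positivity), ← Real.exp_add, Real.exp_le_exp]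
      unfold theta at h1
      linarith
    · rw [boltzmann_eq_zero hx, zero_mul]
      exact (Real.exp_pos _).le
  · have hi : Integrable (boltzmann V) := by
      refine ⟨hm.aestronglyMeasurable, ?_⟩
      rw [hasFiniteIntegral_iff_ofReal (ae_of_all _ h0)]
      simpa only [ofReal_boltzmann hV] using hintegr
    rw [integral_pos_iff_support_of_nonneg h0 hi]
    refine (hopen.measure_pos volume ⟨E, hE⟩).trans_le (measure_mono fun x hx => ?_)
    exact (boltzmann_pos hV hx).ne'

/-- No summand of the energy is `⊥`, so the exponential turns the `EReal` sums into products without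
meeting `⊤ + ⊥`. -/
lemma exp_neg_energy (hV : ∀ x, V x ≠ ⊥) {β : ℝ} (hβ : 0 < β) {N : ℕ}
    (x : Fin N → EuclideanSpace ℝ (Fin n)) :
    EReal.exp (-(energy V β N x))
      = (∏ j, ENNReal.ofReal (boltzmann V (x j))) * ENNReal.ofReal (pairProd β x) := by
  have hk : ∀ i, ∑ j ∈ Finset.Ioi i, kernel (x i) (x j) ≠ ⊥ := fun i =>
    ereal_sum_ne_bot _ fun j => kernel_ne_bot _ _
  rw [energy, exp_neg_add (coe_mul_ne_bot hβ (ereal_sum_ne_bot _ hk)) (ereal_sum_ne_bot _ fun j => hV _),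
    exp_neg_sum _ fun j => hV _, exp_neg_coe_mul, exp_neg_sum _ hk, mul_comm]
  congr 1
  · exact Finset.prod_congr rfl fun j _ => (ofReal_boltzmann hV _).symm
  · have e : ∀ i, EReal.exp (-∑ j ∈ Finset.Ioi i, kernel (x i) (x j))
        = ∏ j ∈ Finset.Ioi i, ENNReal.ofReal ‖x i - x j‖ := by
      intro i
      rw [exp_neg_sum _ fun j => kernel_ne_bot _ _]
      exact Finset.prod_congr rfl fun j _ => exp_neg_kernel _ _
    simp_rw [e]
    rw [← ENNReal.prod_rpow_of_nonneg hβ.le, pairProd,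
      ENNReal.ofReal_prod_of_nonneg fun i _ => Finset.prod_nonneg fun j _ => by positivity]
    refine Finset.prod_congr rfl fun i _ => ?_
    rw [← ENNReal.prod_rpow_of_nonneg hβ.le, ENNReal.ofReal_prod_of_nonneg fun j _ => by positivity]
    exact Finset.prod_congr rfl fun j _ => ENNReal.ofReal_rpow_of_nonneg (norm_nonneg _) hβ.le

variable [Nontrivial (EuclideanSpace ℝ (Fin n))]

lemma gibbs_eq_gasMeasure (hV : ∀ x, V x ≠ ⊥) (hm : Measurable (boltzmann V)) {β : ℝ} (hβ : 0 < β)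
    (N : ℕ) : gibbs V β N = gasMeasure (boltzmann V) β N := by
  have hp := measurable_pairProd (X := EuclideanSpace ℝ (Fin n)) β (M := N)
  have hw : Measurable fun x : Fin N → EuclideanSpace ℝ (Fin n) =>
      ∏ j, ENNReal.ofReal (boltzmann V (x j)) := by fun_prop
  have e1 : (fun x => EReal.exp (-(energy V β N x)))
      = (fun x : Fin N → EuclideanSpace ℝ (Fin n) => ∏ j, ENNReal.ofReal (boltzmann V (x j)))
        * fun x => ENNReal.ofReal (pairProd β x) := funext fun x => exp_neg_energy hV hβ x
  have e2 : (Measure.pi fun _ : Fin N => baseMeasure (boltzmann V))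
      = volume.withDensity fun x => ∏ j, ENNReal.ofReal (boltzmann V (x j)) := by
    unfold baseMeasure
    rw [pi_withDensity_ofReal _ hm, volume_pi]
  have e3 : partitionFunction V β N = gasPartition (boltzmann V) β N := by
    rw [partitionFunction, gasPartition, e2,
      lintegral_withDensity_eq_lintegral_mul _ hw (by fun_prop), e1]
  rw [gibbs, gasMeasure, e3, e1, e2, withDensity_mul _ hw (by fun_prop)]

lemma refDensity_eq (hV : ∀ x, V x ≠ ⊥) (γ : ℝ) (x : EuclideanSpace ℝ (Fin n)) :
    refDensity V γ x = ENNReal.ofReal (refWeight (boltzmann V) γ x) := by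
  rw [refDensity, refWeight]
  by_cases hx : V x < ⊤
  · obtain ⟨v, hv⟩ := exists_eq_coe hV hx
    rw [hv, ← EReal.coe_sub, ← EReal.coe_neg, EReal.exp_coe, boltzmann_of_eq_coe hv, ← Real.exp_add]
    congr 2
    unfold theta logWeight
    ring
  · rw [boltzmann_eq_zero hx, not_lt_top_iff.1 hx, EReal.top_sub_coe]
    simp

lemma refMeasure_eq (hV : ∀ x, V x ≠ ⊥) (hr : IsWeight (boltzmann V)) {γ : ℝ} (hγ : 0 ≤ γ) :
    refMeasure V γ = weightMeasure (refWeight (boltzmann V) γ) := by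
  have hw := hr.refWeight hγ
  have hm := hw.meas
  have e : refDensity V γ = fun x => ENNReal.ofReal (refWeight (boltzmann V) γ x) :=
    funext (refDensity_eq hV γ)
  rw [refMeasure, weightMeasure, e,
    ← ofReal_integral_eq_lintegral_ofReal hw.integrable (ae_of_all _ hw.nonneg),
    ← withDensity_smul _ (by fun_prop)]
  congr 1
  funext x
  rw [Pi.smul_apply, smul_eq_mul, ENNReal.ofReal_div_of_pos hw.integral_pos, mul_comm]
  rfl

/-- The two kernels differ only on the diagonal, where one is `+∞` and the other uses `Real.log 0 =
0`; the diagonal is null for an atomless `μ`. -/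
lemma weightedEnergy_eq {μ : Measure (EuclideanSpace ℝ (Fin n))} (hμ : μ ≪ volume) :
    weightedEnergy μ = mutualEnergy weightedKernel μ μ := by
  have hn : NullSingletonClass μ := ⟨fun x => hμ (measure_singleton x)⟩
  refine lintegral_congr fun x => lintegral_congr_ae ?_
  filter_upwards [Measure.ae_ne μ x] with z hz
  have hpos : 0 < ‖x - z‖ := norm_pos_iff.2 (sub_ne_zero.2 hz.symm)
  rw [kernel, ENNReal.log_inv, ← ofReal_norm, ENNReal.log_ofReal_of_pos hpos, ← EReal.coe_neg,
    ← EReal.coe_add, EReal.toENNReal_of_ne_top (EReal.coe_ne_top _), EReal.toReal_coe, weightedKernel,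
    regKernel_zero_eq]
  congr 1
  unfold theta logWeight
  ring

lemma freeEnergy_withDensity {γ : ℝ} [IsFiniteMeasure (refMeasure V γ)] (hac : refMeasure V γ ≪ volume)
    {f : EuclideanSpace ℝ (Fin n) → ℝ} (hf : IsDensity (refMeasure V γ) f) :
    freeEnergy V γ ((refMeasure V γ).withDensity fun x => ENNReal.ofReal (f x))
      = densFreeEnergy weightedKernel γ (refMeasure V γ) f := by
  have hfm := hf.meas
  have hp := hf.isProbabilityMeasure
  have hle := withDensity_absolutelyContinuous (refMeasure V γ) fun x => ENNReal.ofReal (f x)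
  rw [freeEnergy, densFreeEnergy, weightedEnergy_eq (hle.trans hac),
    densEnergy_eq_mutualEnergy measurable_weightedKernel _ hfm hfm,
    InformationTheory.klDiv_eq_lintegral_klFun_of_ac hle, entropy]
  congr 1
  refine lintegral_congr_ae ?_
  filter_upwards [Measure.rnDeriv_withDensity (refMeasure V γ) (hfm.ennreal_ofReal)] with x hx
  rw [hx, ENNReal.toReal_ofReal (hf.nonneg x)]

/-- Competitors that are not absolutely continuous with respect to `ν_γ` have infinite entropy; all
others are densities, already compared up to null sets. -/
lemma isEquilibriumMeasure_withDensity {γ : ℝ} [IsFiniteMeasure (refMeasure V γ)]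
    (hac : refMeasure V γ ≪ volume) {g : EuclideanSpace ℝ (Fin n) → ℝ}
    (hg : IsDensity (refMeasure V γ) g)
    (hfin : densFreeEnergy weightedKernel γ (refMeasure V γ) g ≠ ⊤)
    (hmin : ∀ f, IsDensity (refMeasure V γ) f → ¬ f =ᵐ[refMeasure V γ] g →
      densFreeEnergy weightedKernel γ (refMeasure V γ) g
        < densFreeEnergy weightedKernel γ (refMeasure V γ) f) :
    IsEquilibriumMeasure V γ ((refMeasure V γ).withDensity fun x => ENNReal.ofReal (g x)) := by
  refine ⟨hg.isProbabilityMeasure, fun ν hν hne => ?_⟩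
  rw [freeEnergy_withDensity hac hg]
  by_cases h : ν ≪ refMeasure V γ
  · set f : EuclideanSpace ℝ (Fin n) → ℝ := fun x => (ν.rnDeriv (refMeasure V γ) x).toReal with hf
    have hfe : (fun x => ENNReal.ofReal (f x)) =ᵐ[refMeasure V γ] ν.rnDeriv (refMeasure V γ) := by
      filter_upwards [Measure.rnDeriv_lt_top ν (refMeasure V γ)] with x hx
      exact ENNReal.ofReal_toReal hx.ne
    have hνf : (refMeasure V γ).withDensity (fun x => ENNReal.ofReal (f x)) = ν := by
      have := Measure.haveLebesgueDecomposition_of_sigmaFinite ν (refMeasure V γ)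
      rw [withDensity_congr_ae hfe, Measure.withDensity_rnDeriv_eq ν (refMeasure V γ) h]
    have hfd : IsDensity (refMeasure V γ) f := by
      refine ⟨(Measure.measurable_rnDeriv _ _).ennreal_toReal, fun x => ENNReal.toReal_nonneg, ?_⟩
      rw [← setLIntegral_univ, ← withDensity_apply _ MeasurableSet.univ, hνf]
      exact measure_univ
    rw [← hνf, freeEnergy_withDensity hac hfd]
    refine hmin f hfd fun hfg => hne ?_
    rw [← hνf]
    refine withDensity_congr_ae ?_
    filter_upwards [hfg] with x hx
    rw [hx]
  · rw [freeEnergy, InformationTheory.klDiv_of_not_ac h, add_top]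
    exact hfin.lt_top

end LogGas

end

/-! ### Convergence of the local process -/

noncomputable section

namespace LogGas

variable {n : ℕ}

/-- Writing `e^{-f} = 1 - H` presents the Laplace functional as the thinning product at `t = 1`. -/
lemma laplaceFunctional_localProcess {N : ℕ} (P : Measure (Fin N → EuclideanSpace ℝ (Fin n)))
    [IsProbabilityMeasure P] (E : EuclideanSpace ℝ (Fin n)) {f : EuclideanSpace ℝ (Fin n) → ℝ≥0}
    (hf : Continuous f) :
    PointProcess.laplaceFunctional P (localProcess E N) f
      = ENNReal.ofReal (∫ x, thinning (fun x => 1 - Real.exp (-(f (((N : ℝ) ^ (1 / (n : ℝ))) • (x - E)) : ℝ)))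
        1 x ∂P) := by
  set H : EuclideanSpace ℝ (Fin n) → ℝ :=
    fun x => 1 - Real.exp (-(f (((N : ℝ) ^ (1 / (n : ℝ))) • (x - E)) : ℝ)) with hH
  have hHm : Measurable H := by fun_prop
  have h0 : ∀ x, 0 ≤ H x := fun x => by simp [hH]
  have h1 : ∀ x, H x ≤ 1 := fun x => sub_le_self _ (Real.exp_pos _).le
  have ht : (1:ℝ) ∈ Set.Icc (0:ℝ) 1 := by simp
  have hfm : Measurable fun x => (f x : ℝ≥0∞) := by fun_prop
  rw [ofReal_integral_eq_lintegral_ofReal (Integrable.of_bound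
    (measurable_thinning hHm 1).aestronglyMeasurable 1 (ae_of_all _ fun x => by
      rw [Real.norm_eq_abs, abs_of_nonneg (thinning_nonneg h0 h1 ht x)]
      exact thinning_le_one h0 h1 ht x)) (ae_of_all _ fun x => thinning_nonneg h0 h1 ht x)]
  refine lintegral_congr fun x => ?_
  change PointProcess.negExp (∫⁻ y, (f y : ℝ≥0∞) ∂(localProcess E N x)) = _
  rw [localProcess, lintegral_finsetSum_measure, PointProcess.negExp_sum, thinning,
    ENNReal.ofReal_prod_of_nonneg fun j _ => (one_sub_mul_mem h0 h1 ht _).1]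
  refine Finset.prod_congr rfl fun j _ => ?_
  rw [lintegral_dirac' _ hfm, PointProcess.negExp_coe]
  congr 1
  simp [hH]

lemma negExp_lintegral_smul {c : ℝ} (hc : 0 ≤ c) {f : EuclideanSpace ℝ (Fin n) → ℝ} (hf0 : ∀ x, 0 ≤ f x)
    (hf : Integrable f) :
    PointProcess.negExp (∫⁻ x, ENNReal.ofReal (f x) ∂(ENNReal.ofReal c • volume))
      = ENNReal.ofReal (Real.exp (-(c * ∫ x, f x))) := by
  have hI : 0 ≤ ∫ x, f x := integral_nonneg hf0
  rw [lintegral_smul_measure, smul_eq_mul, ← ofReal_integral_eq_lintegral_ofReal hf (ae_of_all _ hf0),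
    ← ENNReal.ofReal_mul hc, ← Real.coe_toNNReal (c * ∫ x, f x) (by positivity), ENNReal.ofReal_coe_nnreal,
    PointProcess.negExp_coe]

/-- The rescaled gas converges to a Poisson point process. -/
theorem IsSelfConsistent.tendstoInDistribution [Nontrivial (EuclideanSpace ℝ (Fin n))]
    {r : EuclideanSpace ℝ (Fin n) → ℝ} (hr : IsWeight r) {γ c : ℝ}
    {μ : Measure (EuclideanSpace ℝ (Fin n))} (h : IsSelfConsistent r γ μ c)
    {E : EuclideanSpace ℝ (Fin n)} (hrE : ContinuousAt r E)
    {Ω : Type*} [MeasurableSpace Ω] {P : Measure Ω} {Ξ : Ω → Measure (EuclideanSpace ℝ (Fin n))}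
    (hP : PointProcess.IsPoisson P Ξ (ENNReal.ofReal (eqDensity r γ μ c E) • volume))
    {β : ℕ → ℝ} (hβ : ∀ N, 0 < β N) (hlim : Tendsto (fun N : ℕ => (N : ℝ) * β N) atTop (𝓝 γ)) :
    PointProcess.TendstoInDistribution (fun N => gasMeasure r (β N) N) (fun N => localProcess E N) P Ξ := by
  intro f hf hfc
  have hn : n ≠ 0 := by
    rintro rfl
    exact not_subsingleton (EuclideanSpace ℝ (Fin 0)) inferInstance
  set g : EuclideanSpace ℝ (Fin n) → ℝ := fun x => 1 - Real.exp (-(f x : ℝ)) with hg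
  have hgc : Continuous g := by fun_prop
  have hgs : HasCompactSupport g := by
    refine hfc.comp_left (g := fun y : ℝ≥0 => 1 - Real.exp (-(y : ℝ))) (by simp)
  have hg0 : ∀ x, 0 ≤ g x := fun x => by simp [hg]
  have hg1 : ∀ x, g x ≤ 1 := fun x => sub_le_self _ (Real.exp_pos _).le
  have hρ : 0 ≤ eqDensity r γ μ c E :=
    div_nonneg (mul_nonneg (hr.nonneg _) (Real.exp_pos _).le) h.pos.le
  have hPf : PointProcess.laplaceFunctional P Ξ f
      = ENNReal.ofReal (Real.exp (-(eqDensity r γ μ c E * ∫ x, g x))) :=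
    (hP.2.2 f hf.measurable).trans
      (negExp_lintegral_smul hρ hg0 (hgc.integrable_of_hasCompactSupport hgs))
  -- The gas of `M + 1` particles is analysed through that of `M` particles at the same `β (M+1)`;
  -- since `β → 0`, also `M β(M+1) → γ`.
  rw [hPf, ← tendsto_add_atTop_iff_nat 1]
  have hlim' : Tendsto (fun M : ℕ => (M : ℝ) * β (M + 1)) atTop (𝓝 γ) := by
    have h1 := (tendsto_add_atTop_iff_nat 1).2 hlim
    have h2 := (tendsto_add_atTop_iff_nat 1).2 (tendsto_zero_of_natCast_mul hlim)
    have h3 := h1.sub h2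
    rw [sub_zero] at h3
    refine h3.congr fun M => ?_
    push_cast
    ring
  have hn' : 0 < 1 / (n : ℝ) := by positivity
  set σ : ℕ → ℝ := fun M => ((M + 1 : ℕ) : ℝ) ^ (1 / (n : ℝ)) with hσ
  have hσ0 : ∀ M, 0 < σ M := fun M => Real.rpow_pos_of_pos (by positivity) _
  have hσt : Tendsto σ atTop atTop :=
    (tendsto_rpow_atTop hn').comp ((tendsto_add_atTop_iff_nat 1).2 tendsto_natCast_atTop_atTop)
  have hσd : ∀ M : ℕ, σ M ^ Module.finrank ℝ (EuclideanSpace ℝ (Fin n)) = M + 1 := by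
    intro M
    rw [finrank_euclideanSpace_fin, hσ]
    simp only
    rw [← Real.rpow_mul_natCast (by positivity), one_div, inv_mul_cancel₀ (by positivity), Real.rpow_one]
    push_cast
    rfl
  have key := h.tendsto_integral_thinning hr (fun M => hβ (M + 1)) hlim' hrE hgc hgs hg0 hg1 hσ0 hσt hσd
  refine (ENNReal.tendsto_ofReal key).congr fun M => ?_
  have := h.isProbabilityMeasure_gasMeasure hr (hβ (M + 1)).le (M + 1)
  rw [laplaceFunctional_localProcess _ E hf]

end LogGas

end

/-! ### The main theorem -/

theorem mainTheorem3 (n : ℕ) (hn : n = 1 ∨ n = 2)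
    (V : EuclideanSpace ℝ (Fin n) → EReal)
    (hV_bot : ∀ x, V x ≠ ⊥)
    (hV_open : IsOpen {x | V x < ⊤})
    (hV_cont : ContinuousOn V {x | V x < ⊤})
    (hV_inf : ∀ κ : ℝ, 0 ≤ κ → ∃ c : ℝ, ∀ x, V x < ⊤ →
      (c : EReal) ≤ V x - ((κ * LogGas.theta x : ℝ) : EReal))
    (hV_int : ∀ κ : ℝ, 0 ≤ κ →
      (∫⁻ x, ENNReal.ofReal (‖x‖ ^ κ) * EReal.exp (-(V x))) < ⊤)
    (E : EuclideanSpace ℝ (Fin n)) (hE : V E < ⊤)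
    (γ : ℝ) (hγ : 0 ≤ γ) :
    ∃ (μ : Measure (EuclideanSpace ℝ (Fin n))) (ρ : EuclideanSpace ℝ (Fin n) → ℝ),
      LogGas.IsEquilibriumMeasure V γ μ ∧
      Measurable ρ ∧ (∀ x, 0 ≤ ρ x) ∧ ContinuousOn ρ {x | V x < ⊤} ∧
      μ = volume.withDensity (fun x => ENNReal.ofReal (ρ x)) ∧
      0 < ρ E ∧
      ∃ (Ω : Type) (_ : MeasurableSpace Ω) (P : Measure Ω)
        (Ξ : Ω → Measure (EuclideanSpace ℝ (Fin n))),
        PointProcess.IsPoisson P Ξ (ENNReal.ofReal (ρ E) • volume) ∧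
        ∀ β : ℕ → ℝ, (∀ N, 0 < β N) →
          Tendsto (fun N : ℕ => (N : ℝ) * β N) atTop (𝓝 γ) →
          (∀ N, IsProbabilityMeasure (LogGas.gibbs V (β N) N)) ∧
          PointProcess.TendstoInDistribution (fun N => LogGas.gibbs V (β N) N)
            (fun N => LogGas.localProcess E N) P Ξ := by
  -- Makes the space nontrivial, so that Lebesgue measure has no atoms and `|x|^{-1/2}` is locally
  -- integrable.
  have : NeZero n := ⟨by rcases hn with rfl | rfl <;> norm_num⟩
  have hr : LogGas.IsWeight (LogGas.boltzmann V) :=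
    LogGas.isWeight_boltzmann hV_bot hV_open hV_cont hV_inf (by simpa using hV_int 0 le_rfl) hE
  have href := LogGas.refMeasure_eq hV_bot hr hγ
  obtain ⟨g, c, hg, hfin, hmin, hself⟩ := LogGas.exists_isSelfConsistent hr hγ
  rw [← href] at hg hfin hmin hself
  have htame := (hr.refWeight hγ).isTame
  rw [← href] at htame
  have hprob := htame.prob
  set μ := (LogGas.refMeasure V γ).withDensity fun x => ENNReal.ofReal (g x) with hμ
  have hw := hself.tame.continuous_potential
  have hlw : Continuous (LogGas.logWeight : EuclideanSpace ℝ (Fin n) → ℝ) :=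
    Continuous.log (by fun_prop) fun x => by positivity
  have hrc := LogGas.continuousOn_boltzmann hV_bot hV_cont
  have hrm := hr.meas
  have hρE : 0 < LogGas.eqDensity (LogGas.boltzmann V) γ μ c E :=
    div_pos (mul_pos (LogGas.boltzmann_pos hV_bot hE) (Real.exp_pos _)) hself.pos
  refine ⟨μ, LogGas.eqDensity (LogGas.boltzmann V) γ μ c,
    LogGas.isEquilibriumMeasure_withDensity htame.absolutelyContinuous hg hfin hmin, ?_, fun x => ?_, ?_,
    hself.eq, hρE, ?_⟩
  · have h1 := hw.measurable
    have h2 := hlw.measurable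
    unfold LogGas.eqDensity
    fun_prop
  · exact div_nonneg (mul_nonneg (hr.nonneg x) (Real.exp_pos _).le) hself.pos.le
  · have h3 : Continuous fun x => Real.exp (γ * (LogGas.logWeight x - LogGas.potential 0 μ x)) := by
      fun_prop
    exact (hrc.mul h3.continuousOn).div_const c
  · obtain ⟨Ω, mΩ, P, Ξ, hP⟩ := PointProcess.exists_isPoisson (Y := EuclideanSpace ℝ (Fin n)) hρE
    refine ⟨Ω, mΩ, P, Ξ, hP, fun β hβ hlim => ?_⟩
    have e : ∀ N, LogGas.gibbs V (β N) N = LogGas.gasMeasure (LogGas.boltzmann V) (β N) N := fun N =>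
      LogGas.gibbs_eq_gasMeasure hV_bot hrm (hβ N) N
    simp only [e]
    refine ⟨fun N => hself.isProbabilityMeasure_gasMeasure hr (hβ N).le N, ?_⟩
    -- Openness of `{V < ⊤}` upgrades continuity of the weight on that set to continuity at `E` in
    -- the whole space.
    exact hself.tendstoInDistribution hr (hrc.continuousAt (hV_open.mem_nhds hE)) hP hβ hlim
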